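/- Let $M^n$, $n\ge 3$, be a smooth Riemannian manifold with nonnegative sectional curvature (not necessarily complete) and let $f\colon M^n\to\mathbb{R}^{n+2}$ be a smooth isometric immersion. For $p\in M$ let $\{\xi,\eta\}$ be an orthonormal basis of the normal space of $f$ at $p$ whose shape operators $A=A_\xi$, $B=A_\eta$ are both positive semidefinite (such a basis exists because of the curvature assumption). Assume that $f$ is locally wide, that is, at every point $p\in M$ either $\ker A\cap\ker B\ne 0$, or $\ker A\oplus\ker B=T_pM$ with $A\neq 0$ and $B\ne 0$. Let $U_1$ be the (open) set of the points $p\in M$ at which, for a suitable such basis, $\operatorname{rank}A=n-1$, $\operatorname{rank}B=1$ and $\ker A\cap\ker B=0$. Let $\pi\colon\tilde U_1\to U_1$ be the universal cover of $U_1$ (of each connected component, if $U_1$ is not connected), with the covering smooth structure and the covering metric. Then there is an isometric immersion $g\colon\tilde U_1\to\mathbb{R}^{n+1}$ such that 1. $g$ is convex, i.e. its second fundamental form is positive semidefinite with respect to a smooth unit normal field along $g$; 2. the index of relative nullity of $g$, i.e. the dimension of $\{X : \alpha_g(X,Y)=0 \text{ for all } Y\}$ for the second fundamental form $\alpha_g$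 of $g$, equals one at every point; 3. $f\circ\pi$ is a composition of $g$: there are a flat Riemannian manifold $N_0^{n+1}$, an isometric embedding $g'\colon\tilde U_1\hookrightarrow N_0^{n+1}$, an isometric immersion (local isometry) $j\colon N_0^{n+1}\to\mathbb{R}^{n+1}$ with $g=j\circ g'$, and an isometric immersion $h\colon N_0^{n+1}\to\mathbb{R}^{n+2}$ with $f\circ\pi=h\circ g'$. -/

import Mathlib

open scoped Manifold ContDiff RealInnerProductSpace Topology
open Module Bundle

noncomputable section

namespace WideImmersion

universe u

/-- The Euclidean space of dimension `d`. -/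
abbrev Euc (d : ℕ) : Type := EuclideanSpace ℝ (Fin d)

/-- The `i`-th vector of the standard basis of the `d`-dimensional Euclidean space. -/
def stdVec {d : ℕ} (i : Fin d) : Euc d := EuclideanSpace.single i (1 : ℝ)

/-- Smooth Riemannian metrics on a smooth manifold `M` of dimension `d`. -/
abbrev Metric (d : ℕ) (M : Type*) [TopologicalSpace M] [ChartedSpace (Euc d) M]
    [IsManifold (𝓡 d) ∞ M] : Type _ :=
  ContMDiffRiemannianMetric (𝓡 d) ∞ (Euc d) (fun x : M => TangentSpace (𝓡 d) x)

section Curvature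

variable {d : ℕ} {M : Type*} [TopologicalSpace M] [ChartedSpace (Euc d) M]
  [IsManifold (𝓡 d) ∞ M] (γ : Metric d M)

/-- The matrix of the metric in the coordinates given by the preferred chart at `p`, at the point
with coordinates `y`. -/
def gram (p : M) (y : Euc d) : Matrix (Fin d) (Fin d) ℝ := fun i j =>
  γ.inner ((extChartAt (𝓡 d) p).symm y)
    (mfderiv (𝓡 d) (𝓡 d) (extChartAt (𝓡 d) p).symm y (stdVec i : Euc d))
    (mfderiv (𝓡 d) (𝓡 d) (extChartAt (𝓡 d) p).symm y (stdVec j : Euc d))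

/-- The coordinate derivative of the matrix of the metric: `∂ᵢ gⱼₖ`. -/
def gramDeriv (p : M) (y : Euc d) (i j k : Fin d) : ℝ :=
  fderiv ℝ (fun z => gram γ p z j k) y (stdVec i)

/-- The Christoffel symbols `Γᵏᵢⱼ` of the Levi-Civita connection in the preferred chart
at `p`. -/
def christoffel (p : M) (y : Euc d) (k i j : Fin d) : ℝ :=
  (1 / 2 : ℝ) * ∑ l, (gram γ p y)⁻¹ k l *
    (gramDeriv γ p y i j l + gramDeriv γ p y j i l - gramDeriv γ p y l i j)

/-- The coefficients of the curvature tensor at `p` in the preferred chart at `p`: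
`R(∂ᵢ, ∂ⱼ)∂ₖ = ∑ₗ Rˡᵢⱼₖ ∂ₗ`, with `R(X, Y) = [∇_X, ∇_Y] - ∇_[X,Y]`. -/
def curvatureCoeff (p : M) (l i j k : Fin d) : ℝ :=
  fderiv ℝ (fun y => christoffel γ p y l j k) (extChartAt (𝓡 d) p p) (stdVec i)
  - fderiv ℝ (fun y => christoffel γ p y l i k) (extChartAt (𝓡 d) p p) (stdVec j)
  + ∑ m, (christoffel γ p (extChartAt (𝓡 d) p p) l i m
            * christoffel γ p (extChartAt (𝓡 d) p p) m j k
          - christoffel γ p (extChartAt (𝓡 d) p p) l j m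
            * christoffel γ p (extChartAt (𝓡 d) p p) m i k)

/-- The coordinates of a tangent vector at `p` with respect to the preferred chart at `p`. -/
def coord {p : M} (X : TangentSpace (𝓡 d) p) : Euc d := X

/-- The curvature tensor `R(X, Y)Z` at `p`. The tangent space at `p` is the Euclidean model space,
through the preferred chart at `p`. -/
def curvature (p : M) (X Y Z : TangentSpace (𝓡 d) p) : TangentSpace (𝓡 d) p :=
  (∑ l, (∑ i, ∑ j, ∑ k, coord X i * coord Y j * coord Z k
    * curvatureCoeff γ p l i j k) • (stdVec l : Euc d) : Euc d)

/-- The sectional curvature of the plane spanned by `X` and `Y`. -/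
def sectionalCurvature (p : M) (X Y : TangentSpace (𝓡 d) p) : ℝ :=
  γ.inner p (curvature γ p X Y Y) X /
    (γ.inner p X X * γ.inner p Y Y - γ.inner p X Y ^ 2)

/-- The metric has nonnegative sectional curvature. -/
def NonnegSectionalCurvature : Prop :=
  ∀ (p : M) (X Y : TangentSpace (𝓡 d) p), LinearIndependent ℝ ![X, Y] →
    0 ≤ sectionalCurvature γ p X Y

/-- The metric is flat. -/
def IsFlat : Prop :=
  ∀ (p : M) (X Y Z : TangentSpace (𝓡 d) p), curvature γ p X Y Z = 0

end Curvature

section Submanifolds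

variable {d m : ℕ} {M : Type*} [TopologicalSpace M] [ChartedSpace (Euc d) M]
  [IsManifold (𝓡 d) ∞ M]

/-- Isometric immersions between Riemannian manifolds: smooth maps that pull the metric of the
target back to the metric of the source (this forces the differentials to be injective). -/
def IsIsometricImmersion {N : Type*} [TopologicalSpace N] [ChartedSpace (Euc m) N]
    [IsManifold (𝓡 m) ∞ N] (γM : Metric d M) (γN : Metric m N) (φ : M → N) : Prop :=
  ContMDiff (𝓡 d) (𝓡 m) ∞ φ ∧
  ∀ (p : M) (X Y : TangentSpace (𝓡 d) p),
    γN.inner (φ p) (mfderiv (𝓡 d) (𝓡 m) φ p X) (mfderiv (𝓡 d) (𝓡 m) φ p Y) = γM.inner p X Y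

/-- The differential at `p` of a map into Euclidean space. -/
def differential (f : M → Euc m) (p : M) : TangentSpace (𝓡 d) p →L[ℝ] Euc m :=
  mfderiv (𝓡 d) (𝓡 m) f p

/-- Isometric immersions of a Riemannian manifold into Euclidean space. -/
def IsEuclideanImmersion (γ : Metric d M) (f : M → Euc m) : Prop :=
  ContMDiff (𝓡 d) (𝓡 m) ∞ f ∧
  ∀ (p : M) (X Y : TangentSpace (𝓡 d) p),
    ⟪differential f p X, differential f p Y⟫ = γ.inner p X Y

/-- The tangent space of the immersion `f` at `p`, as a subspace of the ambient space. -/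
def tangentPlane (f : M → Euc m) (p : M) : Submodule ℝ (Euc m) :=
  LinearMap.range (differential (d := d) f p).toLinearMap

/-- The normal space of the immersion `f` at `p`. -/
def normalSpace (f : M → Euc m) (p : M) : Submodule ℝ (Euc m) :=
  (tangentPlane (d := d) f p)ᗮ

/-- The second fundamental form `α(X, Y)` of the immersion `f` at `p`: the component normal to `f`
of the second derivative of `f` in a chart at `p`. -/
def secondFundamentalForm (f : M → Euc m) (p : M) :
    TangentSpace (𝓡 d) p →L[ℝ] TangentSpace (𝓡 d) p →L[ℝ] Euc m :=
  ((ContinuousLinearMap.compL ℝ (Euc d) (Euc m) (Euc m)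
      (normalSpace (d := d) f p).starProjection).comp
    (fderiv ℝ (fderiv ℝ (f ∘ (extChartAt (𝓡 d) p).symm)) (extChartAt (𝓡 d) p p)) :
      Euc d →L[ℝ] Euc d →L[ℝ] Euc m)

/-- The relative nullity `{X | α(X, Y) = 0 for all Y}` of `f` at `p`. -/
def relativeNullity (f : M → Euc m) (p : M) : Submodule ℝ (TangentSpace (𝓡 d) p) :=
  LinearMap.ker (secondFundamentalForm (d := d) f p).toLinearMap

/-- The index of relative nullity of `f` at `p`. -/
def indexOfRelativeNullity (f : M → Euc m) (p : M) : ℕ :=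
  finrank ℝ (relativeNullity (d := d) f p)

/-- `A` is the shape operator of `f` at `p` in the normal direction `ξ`. -/
def IsShapeOperator (γ : Metric d M) (f : M → Euc m) (p : M) (ξ : Euc m)
    (A : TangentSpace (𝓡 d) p →ₗ[ℝ] TangentSpace (𝓡 d) p) : Prop :=
  ∀ X Y : TangentSpace (𝓡 d) p,
    γ.inner p (A X) Y = ⟪secondFundamentalForm (d := d) f p X Y, ξ⟫

/-- `{ξ, η}` is an orthonormal basis of the normal space at `p` of the codimension two immersion
`f`, and its shape operators `A = A_ξ` and `B = A_η` are positive semidefinite. -/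
structure IsNonnegFrame (γ : Metric d M) (f : M → Euc (d + 2)) (p : M) (ξ η : Euc (d + 2))
    (A B : TangentSpace (𝓡 d) p →ₗ[ℝ] TangentSpace (𝓡 d) p) : Prop where
  orthonormal : Orthonormal ℝ ![ξ, η]
  normal_left : ξ ∈ normalSpace (d := d) f p
  normal_right : η ∈ normalSpace (d := d) f p
  shape_left : IsShapeOperator γ f p ξ A
  shape_right : IsShapeOperator γ f p η B
  nonneg_left : ∀ X, 0 ≤ γ.inner p (A X) X
  nonneg_right : ∀ X, 0 ≤ γ.inner p (B X) X

/-- The codimension two immersion `f` is locally wide: at every point, and for the nonnegative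
shape operators `A`, `B` of an orthonormal normal basis as above, either the kernels of `A` and
`B` intersect, or the tangent space is their direct sum and `A` and `B` do not vanish. -/
def IsLocallyWide (γ : Metric d M) (f : M → Euc (d + 2)) : Prop :=
  ∀ (p : M) (ξ η : Euc (d + 2)) (A B : TangentSpace (𝓡 d) p →ₗ[ℝ] TangentSpace (𝓡 d) p),
    IsNonnegFrame γ f p ξ η A B →
      LinearMap.ker A ⊓ LinearMap.ker B ≠ ⊥ ∨
      (IsCompl (LinearMap.ker A) (LinearMap.ker B) ∧ A ≠ 0 ∧ B ≠ 0)

/-- The set `U_k` of the points at which the nonnegative shape operators `A`, `B` as above satisfy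
`rank A = d - k`, `rank B = k` and `ker A ∩ ker B = 0`. -/
def stratum (γ : Metric d M) (f : M → Euc (d + 2)) (k : ℕ) : Set M :=
  {p | ∃ (ξ η : Euc (d + 2)) (A B : TangentSpace (𝓡 d) p →ₗ[ℝ] TangentSpace (𝓡 d) p),
    IsNonnegFrame γ f p ξ η A B ∧
    finrank ℝ (LinearMap.range A) = d - k ∧ finrank ℝ (LinearMap.range B) = k ∧
    LinearMap.ker A ⊓ LinearMap.ker B = ⊥}

/-- The hypersurface `g` is convex: its second fundamental form is positive semidefinite with
respect to a smooth unit normal field. -/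
def IsConvexHypersurface (g : M → Euc (d + 1)) : Prop :=
  ∃ ν : M → Euc (d + 1), ContMDiff (𝓡 d) (𝓡 (d + 1)) ∞ ν ∧
    (∀ p, ‖ν p‖ = 1 ∧ ν p ∈ normalSpace (d := d) g p) ∧
    ∀ (p : M) (X : TangentSpace (𝓡 d) p),
      0 ≤ ⟪secondFundamentalForm (d := d) g p X X, ν p⟫

end Submanifolds

/-- The immersion `f` in codimension two is a composition of the hypersurface `g`: there are a flat
Riemannian manifold `N` of dimension `d + 1`, an isometric embedding `g'` of `M` into `N`, and
isometric immersions `j`, `h` of `N` into Euclidean spaces with `g = j ∘ g'` and `f = h ∘ g'`. -/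
def IsComposition {d : ℕ} {M : Type u} [TopologicalSpace M] [ChartedSpace (Euc d) M]
    [IsManifold (𝓡 d) ∞ M] (γ : Metric d M) (g : M → Euc (d + 1)) (f : M → Euc (d + 2)) : Prop :=
  ∃ (N : Type u) (_ : TopologicalSpace N) (_ : T2Space N) (_ : SecondCountableTopology N)
    (_ : ChartedSpace (Euc (d + 1)) N) (_ : IsManifold (𝓡 (d + 1)) ∞ N)
    (γN : Metric (d + 1) N) (g' : M → N) (j : N → Euc (d + 1)) (h : N → Euc (d + 2)),
    IsFlat γN ∧
    (IsIsometricImmersion γ γN g' ∧ Topology.IsEmbedding g') ∧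
    IsEuclideanImmersion γN j ∧
    IsEuclideanImmersion γN h ∧
    g = j ∘ g' ∧
    f = h ∘ g'

/-- `ρ` is the universal cover of the (possibly disconnected) space `Y`: a covering map that
restricts over each connected component of `Y` to a simply connected covering space. -/
def IsUniversalCover {X Y : Type*} [TopologicalSpace X] [TopologicalSpace Y] (ρ : X → Y) : Prop :=
  IsCoveringMap ρ ∧ ∀ y : Y, SimplyConnectedSpace (ρ ⁻¹' connectedComponent y)

end WideImmersion

end

/-! Write `F` for `f ∘ ρ`, with normal frame `ξ`, `η`, where `A = A_ξ` has corank one, `B = A_η` has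
rank one and `A` is definite on `ker B`.

The heart is the Codazzi equation. Let `ψ(X) = ⟪ξ, dη X⟫` be the normal connection form. On `ker B`
it gives `ψ(Y) ⟪A Z, X⟫ = ψ(Z) ⟪A Y, X⟫`. As `dim ker B = n - 1 ≥ 2`, some `Z ≠ 0` in `ker B` has
`ψ(Z) = 0`, and `X = Z` forces `ψ = 0` on `ker B`. Hence `dη` vanishes on `ker B` and has rank one
(`fderiv_normal_eq_zero`). This needs a smooth frame, which is automatic: a Ricci type contraction
of the second fundamental form sees only `A` and determines `ker A` smoothly (`contDiffAt_frame`).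

So `η` is locally a function of one parameter, and the bundle `η⊥`, with the connection induced from
`ℝⁿ⁺²`, is flat. Concretely, `dΦ = Φ (η ∧ dη)` reduces to a linear ODE with orthogonal solutions,
unique up to constant left factors, so a global solution exists over simply connected components
(`exists_global_of_local`). Then `Φ η` is locally constant, and forgetting that direction leaves `Ψ
: ℝⁿ⁺² → ℝⁿ⁺¹`, isometric and parallel on `η⊥`. Since `dF` is orthogonal to `η`, the form `Ψ dF` is
closed: its derivative is the symmetric `Ψ D²F`. A primitive `g` is an isometric immersion with unit
normal `Ψ ξ` and second fundamental form that of `A`. This gives convexity and relative nullity of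
dimension one.

For the composition, let `T` be the part of `ξ` orthogonal to the range of `dη`. Then `T ⊥ η`, and
differentiating this gives `dT ⊥ η` because `⟪dη, T⟫ = 0`. The ruled maps `h = F + t T` and `j = g +
t Ψ T` on `U × ℝ` thus satisfy `dj = Ψ dh` with `dh ⊥ η`, so they induce the same bilinear form.
Near `t = 0` this form is a metric, because `T` is nowhere tangent to `F`, and it is flat because
`j` is then a local diffeomorphism into `ℝⁿ⁺¹`. A neighbourhood of the zero section is the required
`N`. -/

noncomputable section

namespace WideImmersion

/-! ### Gluing local group valued functions by covering theory -/

/-- The discrete principal bundle with transition functions `φ i x * (φ j x)⁻¹`. -/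
def cocycleBundle {X G : Type*} [TopologicalSpace X] [Group G] [TopologicalSpace G]
    [DiscreteTopology G] (V : X → Set X) (hVo : ∀ i, IsOpen (V i)) (hV : ∀ i, i ∈ V i)
    (φ : X → X → G)
    (hφ : ∀ i j x, x ∈ V i → x ∈ V j →
      ∀ᶠ y in 𝓝 x, φ i y * (φ j y)⁻¹ = φ i x * (φ j x)⁻¹) : FiberBundleCore X X G where
  baseSet := V
  isOpen_baseSet := hVo
  indexAt := id
  mem_baseSet_at := hV
  -- The coordinate `q` over `V i` stands for the germ `q * φ i`. Right multiplication by `φ i * (φ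
  -- j)⁻¹` keeps this germ when passing to `V j`.
  coordChange i j x q := q * (φ i x * (φ j x)⁻¹)
  coordChange_self i x _ v := by simp
  continuousOn_coordChange i j := by
    rintro ⟨x, q⟩ ⟨⟨hi, hj⟩, -⟩
    have h : ∀ᶠ z : X × G in 𝓝 (x, q),
        q * (φ i x * (φ j x)⁻¹) = z.2 * (φ i z.1 * (φ j z.1)⁻¹) := by
      have h2 : ∀ᶠ z : G in 𝓝 q, z = q := by
        rw [nhds_discrete]; simp
      rw [nhds_prod_eq]
      filter_upwards [(hφ i j x hi hj).prod_mk h2] with z hz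
      rw [hz.1, hz.2]
    exact (tendsto_const_nhds.congr' h).mono_left nhdsWithin_le_nhds
  coordChange_comp i j k x _ v := by simp [mul_assoc]

/-- Over a space with simply connected components, local group valued functions that differ by
locally constant left factors are the restrictions, up to constant left factors, of a global one. -/
theorem exists_global_of_local {X G : Type*} [TopologicalSpace X] [LocallyPathConnectedSpace X]
    [Group G] (hX : ∀ x : X, SimplyConnectedSpace (connectedComponent x))
    (V : X → Set X) (hVo : ∀ i, IsOpen (V i)) (hV : ∀ i, i ∈ V i) (φ : X → X → G)
    (hφ : ∀ i j x, x ∈ V i → x ∈ V j →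
      ∀ᶠ y in 𝓝 x, φ i y * (φ j y)⁻¹ = φ i x * (φ j x)⁻¹) :
    ∃ Φ : X → G, ∀ x, ∃ q, ∀ᶠ y in 𝓝 x, Φ y = q * φ x y := by
  let _ : TopologicalSpace G := ⊥
  have : DiscreteTopology G := ⟨rfl⟩
  let Z := cocycleBundle V hVo hV φ hφ
  have hcov : IsCoveringMap (π G Z.Fiber) := FiberBundle.isCoveringMap (F := G) (E := Z.Fiber)
  have hlift : ∀ c : X, ∃ S : C(connectedComponent c, TotalSpace G Z.Fiber),
      ∀ y, (S y).1 = y.1 := by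
    intro c
    have := hX c
    have : LocallyPathConnectedSpace (connectedComponent c) :=
      isOpen_connectedComponent.locallyPathConnectedSpace
    -- The inclusion of a simply connected, locally path connected component lifts through the
    -- covering, which gives a continuous section.
    obtain ⟨S, hS, -⟩ := hcov.existsUnique_continuousMap_lifts
      (⟨Subtype.val, continuous_subtype_val⟩ : C(connectedComponent c, X))
      ⟨c, mem_connectedComponent⟩ (⟨c, (1 : G)⟩ : TotalSpace G Z.Fiber) rfl
    exact ⟨S, fun y => congrFun hS.2 y⟩
  -- One section per component, so that points of the same component use the same one.
  choose S hS using fun C : ConnectedComponents X => hlift (Quotient.out C)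
  have hmem : ∀ x : X, x ∈ connectedComponent (Quotient.out (x : ConnectedComponents X)) := by
    intro x
    have h : ((Quotient.out (x : ConnectedComponents X) : X) : ConnectedComponents X) = x :=
      Quotient.out_eq _
    rw [ConnectedComponents.coe_eq_coe] at h
    rw [h]
    exact mem_connectedComponent
  have hcomp : ∀ {x y : X}, y ∈ connectedComponent x →
      (y : ConnectedComponents X) = (x : ConnectedComponents X) := fun h => by
    rw [ConnectedComponents.coe_eq_coe]; exact (connectedComponent_eq h).symm
  -- The value at a point of the germ represented by an element of the bundle; the fibre coordinate
  -- over `x` refers to the index `x` itself.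
  let val : TotalSpace G Z.Fiber → G := fun z => (show G from z.2) * φ z.1 z.1
  refine ⟨fun x => val (S (x : ConnectedComponents X) ⟨x, hmem x⟩), fun x => ?_⟩
  obtain ⟨c, hc⟩ : ∃ c, c = (x : ConnectedComponents X) := ⟨_, rfl⟩
  have hmc : x ∈ connectedComponent (Quotient.out c) := hc ▸ hmem x
  have hxo : connectedComponent (Quotient.out c) ∈ 𝓝 x := isOpen_connectedComponent.mem_nhds hmc
  -- Read in the trivialization at `x`, the section takes values in a discrete group and is locally
  -- constant; its value at `x` is the factor `q`.
  let s : connectedComponent (Quotient.out c) → G := fun y => (Z.localTriv x (S c y)).2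
  have hs : ContinuousAt s ⟨x, hmc⟩ := by
    have h1 : ContinuousAt (Z.localTriv x) (S c ⟨x, hmc⟩) := by
      apply (Z.localTriv x).continuousOn.continuousAt
      apply (Z.localTriv x).open_source.mem_nhds
      rw [Z.mem_localTriv_source, hS]
      exact hV x
    exact (h1.comp (S c).continuous.continuousAt).snd
  have hs' : ∀ᶠ y in 𝓝 (⟨x, hmc⟩ : connectedComponent (Quotient.out c)),
      s y = s ⟨x, hmc⟩ :=
    hs (by rw [nhds_discrete]; exact rfl : {s ⟨x, hmc⟩} ∈ 𝓝 (s ⟨x, hmc⟩))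
  refine ⟨s ⟨x, hmc⟩, ?_⟩
  rw [nhds_subtype_eq_comap, Filter.eventually_comap] at hs'
  filter_upwards [hs', hxo] with y hy hyc
  have hyc' : (y : ConnectedComponents X) = (x : ConnectedComponents X) :=
    (hcomp hyc).trans ((Quotient.out_eq c).trans hc)
  have h3 := hy ⟨y, hyc⟩ rfl
  rw [← h3]
  have h4 : ∀ (d : ConnectedComponents X) (hd : y ∈ connectedComponent (Quotient.out d)),
      d = (x : ConnectedComponents X) → val (S d ⟨y, hd⟩) = s ⟨y, hyc⟩ * φ x y := by
    intro d hd hdc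
    obtain rfl : d = c := hdc.trans hc.symm
    have h5 : s ⟨y, hyc⟩ = (show G from (S d ⟨y, hd⟩).2) *
        (φ (S d ⟨y, hd⟩).1 (S d ⟨y, hd⟩).1 * (φ x (S d ⟨y, hd⟩).1)⁻¹) := rfl
    rw [h5]
    have h6 : (S d ⟨y, hd⟩).1 = y := hS _ _
    simp only [val]
    rw [h6]
    exact (by intros; group : ∀ v a b : G, v * a = v * (a * b⁻¹) * b) _ _ _
  exact h4 _ _ hyc'

/-! ### Maps of rank one and local orthogonal frames -/

/-- Linear time dependent equations with `C¹` coefficients are locally solvable. -/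
theorem exists_linear_ode_solution {A : Type*} [NormedRing A] [NormedAlgebra ℝ A]
    [CompleteSpace A] {K : ℝ → A} {s₀ : ℝ} (hK : ContDiffAt ℝ 1 K s₀) :
    ∃ P : ℝ → A, P s₀ = 1 ∧ ∀ᶠ s in 𝓝 s₀, HasDerivAt P (P s * K s) s := by
  -- Time becomes an unknown, so that the system `(t, P)' = (1, P K(t))` is autonomous.
  have hv : ContDiffAt ℝ 1 (fun p : ℝ × A => ((1 : ℝ), p.2 * K p.1)) (s₀, (1 : A)) := by
    have h1 : ContDiffAt ℝ 1 (fun p : ℝ × A => K p.1) (s₀, (1 : A)) :=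
      ContDiffAt.comp (s₀, (1 : A)) (f := Prod.fst) (g := K) hK contDiffAt_fst
    exact contDiffAt_const.prodMk (contDiffAt_snd.mul h1)
  obtain ⟨α, h0, ε, hε, hα⟩ :=
    hv.exists_forall_mem_closedBall_exists_eq_forall_mem_Ioo_hasDerivAt₀ s₀
  have hα1 : ∀ t ∈ Set.Ioo (s₀ - ε) (s₀ + ε), HasDerivAt (fun t => (α t).1) 1 t := fun t ht =>
    ((hasFDerivAt_fst (p := α t)).comp_hasDerivAt t (hα t ht) :)
  have hα2 : ∀ t ∈ Set.Ioo (s₀ - ε) (s₀ + ε),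
      HasDerivAt (fun t => (α t).2) ((α t).2 * K (α t).1) t := fun t ht =>
    ((hasFDerivAt_snd (p := α t)).comp_hasDerivAt t (hα t ht) :)
  have hmem : s₀ ∈ Set.Ioo (s₀ - ε) (s₀ + ε) := ⟨by linarith, by linarith⟩
  have htime : ∀ t ∈ Set.Ioo (s₀ - ε) (s₀ + ε), (α t).1 = t := by
    intro t ht
    have := isOpen_Ioo.eqOn_of_deriv_eq (s := Set.Ioo (s₀ - ε) (s₀ + ε))
      isPreconnected_Ioo (f := fun t => (α t).1) (g := fun t => t)
      (fun t ht => (hα1 t ht).differentiableAt.differentiableWithinAt)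
      differentiableOn_id (fun t ht => by rw [(hα1 t ht).deriv]; simp) hmem (by simp [h0]) ht
    exact this
  refine ⟨fun t => (α t).2, by simp [h0], ?_⟩
  filter_upwards [isOpen_Ioo.mem_nhds hmem] with t ht
  have := hα2 t ht
  rwa [htime t ht] at this

section

variable {V E : Type*} [NormedAddCommGroup V] [NormedSpace ℝ V] [NormedAddCommGroup E]
  [InnerProductSpace ℝ E]

/-- A map whose differential has rank at most one, and does not vanish at a given point, factors
there through a function. -/
theorem exists_factor_through_real [CompleteSpace V] {η : V → E} {y₀ : V} (hη : ContDiffAt ℝ 2 η y₀)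
    (hrank : ∀ᶠ y in 𝓝 y₀, ∃ (l : V →L[ℝ] ℝ) (w : E), ∀ X, fderiv ℝ η y X = l X • w)
    (hne : fderiv ℝ η y₀ ≠ 0) :
    ∃ (s : V → ℝ) (c : ℝ → E), ContDiffAt ℝ 2 s y₀ ∧ ContDiffAt ℝ 2 c (s y₀) ∧
      ∀ᶠ y in 𝓝 y₀, η y = c (s y) := by
  obtain ⟨W₀, hW₀⟩ : ∃ W, fderiv ℝ η y₀ W ≠ 0 := by
    by_contra! h
    exact hne (ContinuousLinearMap.ext h)
  set e := fderiv ℝ η y₀ W₀ with he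
  let s : V → ℝ := fun y => ⟪e, η y⟫
  have hs : ContDiffAt ℝ 2 s y₀ := contDiffAt_const.inner ℝ hη
  have hηd : ∀ᶠ y in 𝓝 y₀, DifferentiableAt ℝ η y :=
    (hη.eventually (by simp)).mono fun y hy => hy.differentiableAt (by simp)
  have hsd : ∀ y, DifferentiableAt ℝ η y → HasFDerivAt s (innerSL ℝ e ∘L fderiv ℝ η y) y :=
    fun y hy => (innerSL ℝ e).hasFDerivAt.comp y hy.hasFDerivAt
  set κ : ℝ := ⟪e, e⟫ with hκ
  have hκ0 : κ ≠ 0 := inner_self_ne_zero.2 hW₀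
  let lam : V →L[ℝ] ℝ := κ⁻¹ • (innerSL ℝ e ∘L fderiv ℝ η y₀)
  have hlam : lam W₀ = 1 := inv_mul_cancel₀ hκ0
  -- This coordinate change straightens `s`: its derivative at `y₀` is the identity and `κ * lam (ψ
  -- y) = s y`, so level sets of `s` become level sets of the linear form `lam`.
  let ψ : V → V := fun y => y + (κ⁻¹ * s y - lam y) • W₀
  have hψ : ContDiffAt ℝ 2 ψ y₀ :=
    contDiffAt_id.add (((contDiffAt_const.mul hs).sub lam.contDiff.contDiffAt).smul
      contDiffAt_const)
  have hψ' : HasFDerivAt ψ ((ContinuousLinearEquiv.refl ℝ V : V ≃L[ℝ] V) : V →L[ℝ] V) y₀ := by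
    have h1 := (hasFDerivAt_id y₀).add ((((hsd y₀ hηd.self_of_nhds).const_mul κ⁻¹).sub
      lam.hasFDerivAt).smul_const W₀)
    refine h1.congr_fderiv ?_
    ext X
    simp [lam]
  let Θ := hψ.toOpenPartialHomeomorph ψ hψ' (by simp)
  have hΘ : ∀ y, Θ y = ψ y := fun y => rfl
  have hy₀ : y₀ ∈ Θ.source := hψ.mem_toOpenPartialHomeomorph_source hψ' (by simp)
  set z₀ := ψ y₀ with hz₀
  have hz₀t : z₀ ∈ Θ.target := Θ.map_source hy₀
  have hθ0 : Θ.symm z₀ = y₀ := Θ.left_inv hy₀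
  have hθ : ContDiffAt ℝ 2 Θ.symm z₀ := hψ.to_localInverse hψ' (by simp)
  have hlamψ : ∀ y, κ * lam (ψ y) = s y := by
    intro y
    simp only [ψ, map_add, map_smul, hlam, smul_eq_mul, mul_one]
    field_simp
    ring
  -- the derivative of `s` does not vanish near `y₀`
  have hsne : ∀ᶠ y in 𝓝 y₀, ⟪e, fderiv ℝ η y W₀⟫ ≠ 0 := by
    have hc : ContinuousAt (fun y => ⟪e, fderiv ℝ η y W₀⟫) y₀ := by
      have : ContinuousAt (fderiv ℝ η) y₀ := (hη.fderiv_right (m := 1) (by norm_num)).continuousAt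
      exact continuousAt_const.inner (𝕜 := ℝ) (this.clm_apply continuousAt_const)
    exact hc.eventually_ne hκ0
  -- As `dη` has rank one and `ds ≠ 0`, the kernels of `ds` and `dη` agree, and `η` cannot vary
  -- along the level sets of `s`.
  have hker : ∀ᶠ y in 𝓝 y₀, DifferentiableAt ℝ η y ∧
      ∀ X, ⟪e, fderiv ℝ η y X⟫ = 0 → fderiv ℝ η y X = 0 := by
    filter_upwards [hrank, hsne, hηd] with y ⟨l, w, hl⟩ hy hd
    refine ⟨hd, fun X hX => ?_⟩
    rw [hl, inner_smul_right] at hX hy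
    rw [hl]
    rw [(mul_eq_zero.1 hX).resolve_right (right_ne_zero_of_mul hy), zero_smul]
  have hgood : ∀ᶠ z in 𝓝 z₀, z ∈ Θ.target ∧ DifferentiableAt ℝ Θ.symm z ∧
      DifferentiableAt ℝ η (Θ.symm z) ∧
      ∀ X, ⟪e, fderiv ℝ η (Θ.symm z) X⟫ = 0 → fderiv ℝ η (Θ.symm z) X = 0 := by
    have h1 : Filter.Tendsto Θ.symm (𝓝 z₀) (𝓝 y₀) := by
      simpa [ContinuousAt, hθ0] using hθ.continuousAt
    filter_upwards [Θ.open_target.mem_nhds hz₀t, hθ.eventually (by simp), h1.eventually hker]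
      with z hz1 hz2 hz3
    exact ⟨hz1, hz2.differentiableAt (by simp), hz3⟩
  obtain ⟨r, hr, hball⟩ := Metric.eventually_nhds_iff_ball.1 hgood
  have hconst : ∀ z ∈ Metric.ball z₀ r, ∀ X, lam X = 0 →
      fderiv ℝ (fun z => η (Θ.symm z)) z X = 0 := by
    intro z hz X hX
    obtain ⟨hzt, hd, hηz, hk⟩ := hball z hz
    have hcomp : HasFDerivAt (fun z => η (Θ.symm z))
      (fderiv ℝ η (Θ.symm z) ∘L fderiv ℝ Θ.symm z) z :=
      hηz.hasFDerivAt.comp z hd.hasFDerivAt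
    rw [hcomp.fderiv]
    apply hk
    have h2 : HasFDerivAt (fun z => s (Θ.symm z))
      ((innerSL ℝ e ∘L fderiv ℝ η (Θ.symm z)) ∘L fderiv ℝ Θ.symm z) z :=
      (hsd _ hηz).comp z hd.hasFDerivAt
    have h3 : HasFDerivAt (fun z => s (Θ.symm z)) (κ • lam) z := by
      refine (lam.hasFDerivAt.const_mul κ).congr_of_eventuallyEq ?_
      filter_upwards [Θ.open_target.mem_nhds hzt] with z' hz'
      rw [← hlamψ, ← hΘ, Θ.right_inv hz']
    have h4 := congrArg (fun L : V →L[ℝ] ℝ => L X) (h2.unique h3)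
    simpa [hX] using h4
  -- The argument of `Θ.symm` is the point on the line through `z₀` in direction `W₀` where `κ *
  -- lam` equals `t`.
  let c : ℝ → E := fun t => η (Θ.symm (z₀ + (κ⁻¹ * t - lam z₀) • W₀))
  have hbase : z₀ + (κ⁻¹ * s y₀ - lam z₀) • W₀ = z₀ := by
    rw [← hlamψ, ← mul_assoc, inv_mul_cancel₀ hκ0, one_mul, hz₀, sub_self, zero_smul, add_zero]
  refine ⟨s, c, hs, ?_, ?_⟩
  · have h1 : ContDiffAt ℝ 2 (fun t : ℝ => z₀ + (κ⁻¹ * t - lam z₀) • W₀) (s y₀) := by fun_prop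
    have h2 : ContDiffAt ℝ 2 Θ.symm (z₀ + (κ⁻¹ * s y₀ - lam z₀) • W₀) := by rwa [hbase]
    have h3 : ContDiffAt ℝ 2 η (Θ.symm (z₀ + (κ⁻¹ * s y₀ - lam z₀) • W₀)) := by
      rwa [hbase, hθ0]
    exact h3.comp (s y₀) (h2.comp (s y₀) h1)
  · have hψc : ContinuousAt ψ y₀ := hψ.continuousAt
    have h1 : ∀ᶠ y in 𝓝 y₀, ψ y ∈ Metric.ball z₀ r := hψc (Metric.ball_mem_nhds _ hr)
    have h2 : ∀ᶠ y in 𝓝 y₀, z₀ + (κ⁻¹ * s y - lam z₀) • W₀ ∈ Metric.ball z₀ r := by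
      have : ContinuousAt (fun y => z₀ + (κ⁻¹ * s y - lam z₀) • W₀) y₀ :=
        continuousAt_const.add (((continuousAt_const.mul hs.continuousAt).sub
          continuousAt_const).smul continuousAt_const)
      apply this
      show _ ∈ 𝓝 (z₀ + (κ⁻¹ * s y₀ - lam z₀) • W₀)
      rw [hbase]
      exact Metric.ball_mem_nhds _ hr
    filter_upwards [h1, h2, Θ.open_source.mem_nhds hy₀] with y hy1 hy2 hys
    set p := ψ y with hp
    set q := z₀ + (κ⁻¹ * s y - lam z₀) • W₀ with hq
    have hlq : lam (p - q) = 0 := by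
      have := hlamψ y
      simp only [map_sub, hq, map_add, map_smul, hlam, smul_eq_mul, ← this]
      field_simp
      ring
    have hseg : ∀ t ∈ Set.Icc (0 : ℝ) 1, q + t • (p - q) ∈ Metric.ball z₀ r := by
      intro t ht
      exact (convex_ball z₀ r).add_smul_sub_mem hy2 hy1 ht
    have hη' : η y = η (Θ.symm p) := by rw [hp, ← hΘ, Θ.left_inv hys]
    rw [hη']
    have hder : ∀ t ∈ Set.Icc (0 : ℝ) 1,
        HasDerivAt (fun t : ℝ => η (Θ.symm (q + t • (p - q)))) 0 t := by
      intro t ht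
      obtain ⟨hzt, hd, hηz, hk⟩ := hball _ (hseg t ht)
      have hd1 : DifferentiableAt ℝ (fun z => η (Θ.symm z)) (q + t • (p - q)) :=
        DifferentiableAt.comp (g := η) _ hηz hd
      have hl : HasDerivAt (fun t : ℝ => q + t • (p - q)) (p - q) t := by
        simpa using ((hasDerivAt_id t).smul_const (p - q)).const_add q
      have := hd1.hasFDerivAt.comp_hasDerivAt t hl
      rwa [hconst _ (hseg t ht) _ hlq] at this
    have := constant_of_has_deriv_right_zero (f := fun t : ℝ => η (Θ.symm (q + t • (p - q))))
      (a := 0) (b := 1)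
      (fun t ht => (hder t ht).continuousAt.continuousWithinAt)
      (fun t ht => (hder t ⟨ht.1, ht.2.le⟩).hasDerivWithinAt) 1 ⟨zero_le_one, le_rfl⟩
    simp only [one_smul, zero_smul, add_zero, add_sub_cancel] at this
    exact this

/-- The inner product of a real inner product space as a continuous bilinear map. -/
def innerBilin (E : Type*) [NormedAddCommGroup E] [InnerProductSpace ℝ E] : E →L[ℝ] E →L[ℝ] ℝ :=
  innerSL ℝ

theorem innerBilin_apply (u v : E) : innerBilin E u v = ⟪u, v⟫ := rfl

/-- The infinitesimal rotation `u ↦ ⟪v, u⟫ e - ⟪e, u⟫ v`, as a bilinear function of `e`, `v`. -/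
def wedge (E : Type*) [NormedAddCommGroup E] [InnerProductSpace ℝ E] :
    E →L[ℝ] E →L[ℝ] (E →L[ℝ] E) :=
  ((ContinuousLinearMap.smulRightL ℝ E E).comp (innerBilin E)).flip -
    (ContinuousLinearMap.smulRightL ℝ E E).comp (innerBilin E)

theorem wedge_apply (e v u : E) : wedge E e v u = ⟪v, u⟫ • e - ⟪e, u⟫ • v := by
  simp [wedge, innerBilin_apply]

theorem star_wedge [CompleteSpace E] (e v : E) : star (wedge E e v) = -wedge E e v := by
  rw [ContinuousLinearMap.star_eq_adjoint]
  symm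
  rw [ContinuousLinearMap.eq_adjoint_iff]
  intro x y
  simp only [neg_apply, wedge_apply, inner_neg_left, inner_sub_left, inner_sub_right,
    inner_smul_left, inner_smul_right, RCLike.conj_to_real]
  rw [real_inner_comm x e, real_inner_comm x v]
  ring

/-- The right hand side of the equation `dΦ = Φ (η ∧ dη)`. -/
def frameForm (Q : E →L[ℝ] E) (e : E) : E →L[ℝ] (E →L[ℝ] E) :=
  (ContinuousLinearMap.mul ℝ (E →L[ℝ] E) Q) ∘L (wedge E e)

theorem frameForm_apply (Q : E →L[ℝ] E) (e v : E) : frameForm Q e v = Q * wedge E e v := rfl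

/-- In finite dimension a one-sided inverse is two-sided. -/
theorem mem_unitary_of_mul_star [FiniteDimensional ℝ E] [CompleteSpace E] {Q : E →L[ℝ] E}
    (h : Q * star Q = 1) : Q ∈ unitary (E →L[ℝ] E) := by
  refine ⟨?_, h⟩
  have h1 : (Q.toLinearMap * (star Q).toLinearMap : E →ₗ[ℝ] E) = 1 :=
    congrArg ContinuousLinearMap.toLinearMap h
  have h2 := mul_eq_one_comm.1 h1
  ext x
  exact LinearMap.congr_fun h2 x

/-- If the differential of `η` has rank one, then the equation `dΦ = Φ (η ∧ dη)` is locally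
solvable by orthogonal maps. -/
theorem exists_local_frame [CompleteSpace V] [FiniteDimensional ℝ E] [CompleteSpace E]
    {η : V → E} {y₀ : V}
    (hη : ContDiffAt ℝ 2 η y₀)
    (hrank : ∀ᶠ y in 𝓝 y₀, ∃ (l : V →L[ℝ] ℝ) (w : E), ∀ X, fderiv ℝ η y X = l X • w)
    (hne : fderiv ℝ η y₀ ≠ 0) :
    ∃ Φ : V → unitary (E →L[ℝ] E), ∀ᶠ y in 𝓝 y₀,
      HasFDerivAt (fun y => (Φ y : E →L[ℝ] E)) (frameForm (Φ y) (η y) ∘L fderiv ℝ η y) y := by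
  -- With `η = c ∘ s` the equation is pulled back from a curve, where no integrability condition
  -- remains: `Φ = P ∘ s` with `P' = P (c ∧ c')`.
  obtain ⟨s, c, hs, hc, hsc⟩ := exists_factor_through_real hη hrank hne
  have hK : ContDiffAt ℝ 1 (fun t => wedge E (c t) (deriv c t)) (s y₀) := by
    have h1 : ContDiffAt ℝ 1 (deriv c) (s y₀) := by
      have : ContDiffAt ℝ 1 (fderiv ℝ c) (s y₀) := hc.fderiv_right (by norm_num)
      exact this.clm_apply contDiffAt_const
    exact (contDiffAt_const.clm_apply (hc.of_le (by norm_num))).clm_apply h1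
  obtain ⟨P, hP0, hP⟩ := exists_linear_ode_solution hK
  have hPP : ∀ᶠ t in 𝓝 (s y₀), P t * star (P t) = 1 := by
    obtain ⟨r, hr, hball⟩ := Metric.eventually_nhds_iff_ball.1 hP
    -- The coefficient is skew adjoint, so `P P*` keeps its initial value `1`.
    have hd : ∀ t ∈ Metric.ball (s y₀) r, HasDerivAt (fun t => P t * star (P t)) 0 t := by
      intro t ht
      have h1 := (hball t ht).mul (hball t ht).star
      refine HasDerivAt.congr_deriv h1 ?_
      rw [star_mul, star_wedge]
      noncomm_ring
    filter_upwards [Metric.ball_mem_nhds (s y₀) hr] with t ht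
    have := (convex_ball (s y₀) r).is_const_of_fderivWithin_eq_zero (𝕜 := ℝ)
      (f := fun t => P t * star (P t))
      (fun t ht => (hd t ht).differentiableAt.differentiableWithinAt)
      (fun t ht => by
        rw [fderivWithin_of_isOpen Metric.isOpen_ball ht, (hd t ht).hasFDerivAt.fderiv]
        ext; simp) ht (Metric.mem_ball_self hr)
    simpa [hP0] using this
  classical
  -- Near `y₀` the condition holds; the value `1` elsewhere is immaterial.
  let Φ : V → unitary (E →L[ℝ] E) := fun y =>
    if h : P (s y) * star (P (s y)) = 1 then ⟨P (s y), mem_unitary_of_mul_star h⟩ else 1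
  have hΦ : ∀ᶠ y in 𝓝 y₀, (Φ y : E →L[ℝ] E) = P (s y) := by
    filter_upwards [hs.continuousAt.eventually hPP] with y hy
    simp only [Φ, dif_pos hy]
  refine ⟨Φ, ?_⟩
  filter_upwards [hΦ.eventually_nhds, hsc.eventually_nhds, hs.eventually (by simp),
    hs.continuousAt.eventually hP, hs.continuousAt.eventually (hc.eventually (by simp))]
    with y h1 h2 h3 h4 h5
  have hsd : HasFDerivAt s (fderiv ℝ s y) y := (h3.differentiableAt (by simp)).hasFDerivAt
  have hcd : HasDerivAt c (deriv c (s y)) (s y) := (h5.differentiableAt (by simp)).hasDerivAt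
  have hηy : HasFDerivAt η ((fderiv ℝ s y).smulRight (deriv c (s y))) y :=
    (hcd.hasFDerivAt.comp y hsd |>.congr_of_eventuallyEq h2).congr_fderiv (by ext; simp)
  rw [hηy.fderiv]
  refine ((h4.hasFDerivAt.comp y hsd).congr_of_eventuallyEq h1).congr_fderiv ?_
  ext X u
  rw [h1.self_of_nhds, h2.self_of_nhds]
  simp [frameForm_apply]

end

/-! ### Positive semidefinite forms and split normal frames -/

section

variable {V : Type*} [NormedAddCommGroup V] [NormedSpace ℝ V]

/-- A symmetric positive semidefinite form vanishes on the isotropic vectors. -/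
theorem psd_apply_eq_zero {q : V →L[ℝ] V →L[ℝ] ℝ} (hs : ∀ X Y, q X Y = q Y X)
    (hq : ∀ X, 0 ≤ q X X) {X : V} (hX : q X X = 0) (Y : V) : q X Y = 0 := by
  by_contra h
  -- The coefficient `t` of `X` is chosen so that `q Y Y + 2 t q X Y = -1`.
  have h1 := hq (Y + (-(q Y Y + 1) / (2 * q X Y)) • X)
  simp only [map_add, map_smul, add_apply, smul_apply, smul_eq_mul, hX, hs Y X] at h1
  have h2 : -(q Y Y + 1) / (2 * q X Y) * q X Y = -(q Y Y + 1) / 2 := by field_simp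
  rw [h2] at h1
  linarith

/-- The kernel of a bilinear form. -/
def formKer (q : V →L[ℝ] V →L[ℝ] ℝ) : Submodule ℝ V := LinearMap.ker q.toLinearMap

theorem mem_formKer {q : V →L[ℝ] V →L[ℝ] ℝ} {X : V} : X ∈ formKer q ↔ ∀ Y, q X Y = 0 := by
  rw [formKer, LinearMap.mem_ker]
  exact ⟨fun h Y => congrArg (fun l : V →L[ℝ] ℝ => l Y) h, fun h => ContinuousLinearMap.ext h⟩

/-- The kernel has codimension one, so it is complemented by any `W` outside it, and such a `W` is
not isotropic because the form is semidefinite. -/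
theorem psd_rank_one [FiniteDimensional ℝ V] {q : V →L[ℝ] V →L[ℝ] ℝ}
    (hs : ∀ X Y, q X Y = q Y X) (hq : ∀ X, 0 ≤ q X X)
    (hk : finrank ℝ (formKer q) + 1 = finrank ℝ V) :
    ∃ W, 0 < q W W ∧ ∀ X Y, q X Y * q W W = q X W * q Y W := by
  obtain ⟨W, hW⟩ : ∃ W, W ∉ formKer q := by
    by_contra! h
    rw [(Submodule.eq_top_iff' (p := formKer q)).2 h, finrank_top] at hk
    omega
  have hWW : 0 < q W W := by
    refine lt_of_le_of_ne (hq W) fun h => hW (mem_formKer.2 (psd_apply_eq_zero hs hq h.symm))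
  refine ⟨W, hWW, fun X Y => ?_⟩
  have htop : formKer q ⊔ ℝ ∙ W = ⊤ := by
    apply Submodule.eq_top_of_finrank_eq
    have h1 : formKer q < formKer q ⊔ ℝ ∙ W :=
      left_lt_sup.2 fun h => hW ((Submodule.span_singleton_le_iff_mem _ _).1 h)
    have h2 := Submodule.finrank_lt_finrank_of_lt h1
    have h3 := Submodule.finrank_le (formKer q ⊔ ℝ ∙ W)
    omega
  obtain ⟨k, hk, z, hz, rfl⟩ := Submodule.mem_sup.1 (htop ▸ Submodule.mem_top : X ∈ _)
  obtain ⟨t, rfl⟩ := Submodule.mem_span_singleton.1 hz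
  rw [mem_formKer] at hk
  simp only [map_add, map_smul, add_apply, smul_apply, smul_eq_mul, hk, hs Y W]
  ring

/-- A nonzero psd form isotropic modulo kernel in each Cauchy-Schwarz defect has small rank. -/
theorem psd_mem_ker_of_defect [FiniteDimensional ℝ V] {q : V →L[ℝ] V →L[ℝ] ℝ}
    (hs : ∀ X Y, q X Y = q Y X) (hq : ∀ X, 0 ≤ q X X) (hk : finrank ℝ (formKer q) = 1)
    (hV : 3 ≤ finrank ℝ V) {ι : Type*} (e : Basis ι ℝ V) {X : V}
    (hX : ∀ i, q (e i) (e i) * q X X = q (e i) X ^ 2) : X ∈ formKer q := by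
  by_contra hXk
  have hXX : q X X ≠ 0 := fun h => hXk (mem_formKer.2 (psd_apply_eq_zero hs hq h))
  -- Equality in Cauchy–Schwarz makes each `e i` a multiple of `X` modulo the kernel. The kernel
  -- line and `X` would then span `V`, whose dimension is at least three.
  have htop : formKer q ⊔ ℝ ∙ X = ⊤ := by
    rw [eq_top_iff, ← e.span_eq, Submodule.span_le]
    rintro _ ⟨i, rfl⟩
    have h1 : e i - (q (e i) X / q X X) • X ∈ formKer q := by
      refine mem_formKer.2 (psd_apply_eq_zero hs hq ?_)
      simp only [map_sub, map_smul, sub_apply, smul_apply, smul_eq_mul, hs X (e i)]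
      have := hX i
      field_simp
      linarith
    have h2 : (q (e i) X / q X X) • X ∈ ℝ ∙ X :=
      Submodule.smul_mem _ _ (Submodule.mem_span_singleton_self X)
    have := Submodule.add_mem_sup h1 h2
    rwa [sub_add_cancel] at this
  have h1 := Submodule.finrank_add_le_finrank_add_finrank (formKer q) (ℝ ∙ X)
  have h2 := finrank_span_singleton (K := ℝ) (fun h : X = 0 => hXk (h ▸ Submodule.zero_mem _))
  rw [htop, finrank_top] at h1
  omega

theorem psd_cauchy_schwarz {q : V →L[ℝ] V →L[ℝ] ℝ} (hs : ∀ X Y, q X Y = q Y X)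
    (hq : ∀ X, 0 ≤ q X X) (X Y : V) : q X Y ^ 2 ≤ q X X * q Y Y := by
  by_cases hX : q X X = 0
  · rw [psd_apply_eq_zero hs hq hX Y, hX]; simp
  · have h := hq (q X X • Y - q X Y • X)
    simp only [map_sub, map_smul, sub_apply, smul_apply, smul_eq_mul, hs Y X] at h
    have hpos : 0 < q X X := lt_of_le_of_ne (hq X) (Ne.symm hX)
    have h2 : 0 ≤ q X X * (q X X * q Y Y - q X Y ^ 2) := by nlinarith
    have := nonneg_of_mul_nonneg_right h2 hpos
    linarith

variable {E : Type*} [NormedAddCommGroup E] [InnerProductSpace ℝ E]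

/-- The component of a vector valued bilinear map in a given direction. -/
def component (H : V →L[ℝ] V →L[ℝ] E) (ζ : E) : V →L[ℝ] V →L[ℝ] ℝ :=
  (ContinuousLinearMap.compL ℝ V E ℝ (innerBilin E ζ)).comp H

theorem component_apply (H : V →L[ℝ] V →L[ℝ] E) (ζ : E) (X Y : V) :
    component H ζ X Y = ⟪ζ, H X Y⟫ := rfl

/-- An injective map `L` and a symmetric bilinear map `H`, to be thought of as the first and second
derivatives of a codimension two immersion in coordinates, whose second fundamental form splits in
the orthonormal normal frame `ξ`, `η` into positive semidefinite forms of corank and rank one with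
transversal kernels. -/
structure SplitFrame (L : V →L[ℝ] E) (H : V →L[ℝ] V →L[ℝ] E) (ξ η : E) : Prop where
  inj : Function.Injective L
  symm : ∀ X Y, H X Y = H Y X
  norm_left : ⟪ξ, ξ⟫ = 1
  norm_right : ⟪η, η⟫ = 1
  orth : ⟪ξ, η⟫ = 0
  normal_left : ∀ X, ⟪ξ, L X⟫ = 0
  normal_right : ∀ X, ⟪η, L X⟫ = 0
  nonneg_left : ∀ X, 0 ≤ ⟪ξ, H X X⟫
  nonneg_right : ∀ X, 0 ≤ ⟪η, H X X⟫
  ker_left : finrank ℝ (formKer (component H ξ)) = 1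
  ker_right : finrank ℝ (formKer (component H η)) + 1 = finrank ℝ V
  disj : ∀ X, (∀ Y, ⟪ξ, H X Y⟫ = 0) → (∀ Y, ⟪η, H X Y⟫ = 0) → X = 0

namespace SplitFrame

variable {L : V →L[ℝ] E} {H : V →L[ℝ] V →L[ℝ] E} {ξ η : E}

theorem component_symm (h : SplitFrame L H ξ η) (ζ : E) (X Y : V) :
    component H ζ X Y = component H ζ Y X := by
  rw [component_apply, component_apply, h.symm]

theorem orth' (h : SplitFrame L H ξ η) : ⟪η, ξ⟫ = 0 := by rw [real_inner_comm, h.orth]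

theorem rank_one [FiniteDimensional ℝ V] (h : SplitFrame L H ξ η) :
    ∃ W, 0 < ⟪η, H W W⟫ ∧ ∀ X Y, ⟪η, H X Y⟫ * ⟪η, H W W⟫ = ⟪η, H X W⟫ * ⟪η, H Y W⟫ :=
  psd_rank_one (h.component_symm η) h.nonneg_right h.ker_right

/-- The minors of order two of the rank one form vanish. -/
theorem minor [FiniteDimensional ℝ V] (h : SplitFrame L H ξ η) (X Y Z : V) :
    ⟪η, H X Y⟫ * ⟪η, H Z Z⟫ = ⟪η, H X Z⟫ * ⟪η, H Y Z⟫ := by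
  obtain ⟨W, hW, hb⟩ := h.rank_one
  have h1 := hb X Y
  have h2 := hb Z Z
  have h3 := hb X Z
  have h4 := hb Y Z
  have hne := hW.ne'
  have : (⟪η, H X Y⟫ * ⟪η, H W W⟫) * (⟪η, H Z Z⟫ * ⟪η, H W W⟫) =
      (⟪η, H X Z⟫ * ⟪η, H W W⟫) * (⟪η, H Y Z⟫ * ⟪η, H W W⟫) := by
    rw [h1, h2, h3, h4]; ring
  have h5 : ⟪η, H W W⟫ ^ 2 * (⟪η, H X Y⟫ * ⟪η, H Z Z⟫) =
      ⟪η, H W W⟫ ^ 2 * (⟪η, H X Z⟫ * ⟪η, H Y Z⟫) := by linarith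
  exact mul_left_cancel₀ (pow_ne_zero 2 hne) h5

/-- Isotropic vectors of a semidefinite form lie in its kernel, and the two kernels meet only in
zero; so each form is definite on the kernel of the other. -/
theorem left_pos (h : SplitFrame L H ξ η) {X : V} (hX : ∀ Y, ⟪η, H X Y⟫ = 0) (h0 : X ≠ 0) :
    0 < ⟪ξ, H X X⟫ :=
  lt_of_le_of_ne (h.nonneg_left X) fun hXX => h0 <| h.disj X
    (psd_apply_eq_zero (q := component H ξ) (h.component_symm ξ) h.nonneg_left hXX.symm) hX

theorem right_pos (h : SplitFrame L H ξ η) {X : V} (hX : ∀ Y, ⟪ξ, H X Y⟫ = 0) (h0 : X ≠ 0) :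
    0 < ⟪η, H X X⟫ :=
  lt_of_le_of_ne (h.nonneg_right X) fun hXX => h0 <| h.disj X hX
    (psd_apply_eq_zero (q := component H η) (h.component_symm η) h.nonneg_right hXX.symm)

/-- The tangent space and the normal frame span the ambient space. -/
theorem exists_decomp [FiniteDimensional ℝ V] [FiniteDimensional ℝ E] (h : SplitFrame L H ξ η)
    (hE : finrank ℝ E = finrank ℝ V + 2) (v : E) :
    ∃ X, v = L X + ⟪ξ, v⟫ • ξ + ⟪η, v⟫ • η := by
  let f : V × ℝ × ℝ →ₗ[ℝ] E :=
    L.toLinearMap.coprod ((LinearMap.toSpanSingleton ℝ E ξ).coprod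
      (LinearMap.toSpanSingleton ℝ E η))
  have hf : ∀ X s t, f (X, s, t) = L X + s • ξ + t • η := fun X s t => by
    simp [f, add_assoc]
  have hξ : ∀ X s t, ⟪ξ, f (X, s, t)⟫ = s := fun X s t => by
    simp only [hf, inner_add_right, inner_smul_right, h.normal_left, h.norm_left, h.orth]; ring
  have hη : ∀ X s t, ⟪η, f (X, s, t)⟫ = t := fun X s t => by
    simp only [hf, inner_add_right, inner_smul_right, h.normal_right, h.norm_right, h.orth']; ring
  have hinj : Function.Injective f := by
    rw [← LinearMap.ker_eq_bot, LinearMap.ker_eq_bot']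
    rintro ⟨X, s, t⟩ h0
    have hs := hξ X s t
    have ht := hη X s t
    rw [h0, inner_zero_right] at hs ht
    subst hs ht
    rw [hf] at h0
    simp only [zero_smul, add_zero] at h0
    have : X = 0 := h.inj (by rw [h0, map_zero])
    rw [this]; rfl
  have hsurj : Function.Surjective f :=
    (LinearMap.injective_iff_surjective_of_finrank_eq_finrank (by simp [hE])).1 hinj
  obtain ⟨⟨X, s, t⟩, rfl⟩ := hsurj v
  exact ⟨X, by rw [hξ, hη, hf]⟩

theorem eq_zero_of_inner [FiniteDimensional ℝ V] [FiniteDimensional ℝ E] (h : SplitFrame L H ξ η)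
    (hE : finrank ℝ E = finrank ℝ V + 2) {v : E} (hξ : ⟪ξ, v⟫ = 0) (hη : ⟪η, v⟫ = 0)
    (hL : ∀ X, ⟪v, L X⟫ = 0) : v = 0 := by
  obtain ⟨X, hX⟩ := h.exists_decomp hE v
  rw [hξ, hη, zero_smul, zero_smul, add_zero, add_zero] at hX
  have := hL X
  rw [← hX] at this
  exact inner_self_eq_zero.1 this

/-- Split frames are invariant under changes of coordinates. -/
theorem comp {V' : Type*} [NormedAddCommGroup V'] [NormedSpace ℝ V'] [FiniteDimensional ℝ V]
    (h : SplitFrame L H ξ η) (S : V' ≃L[ℝ] V) (Q : V' → V' → V) {L' : V' →L[ℝ] E}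
    {H' : V' →L[ℝ] V' →L[ℝ] E} (hL : ∀ X, L' X = L (S X))
    (hH : ∀ X Y, H' X Y = H (S X) (S Y) + L (Q X Y)) (hs : ∀ X Y, H' X Y = H' Y X) :
    SplitFrame L' H' ξ η := by
  -- The correction `L (Q X Y)` of the second derivative is tangential and invisible to normal
  -- vectors.
  have hHξ : ∀ X Y, ⟪ξ, H' X Y⟫ = ⟪ξ, H (S X) (S Y)⟫ := fun X Y => by
    rw [hH, inner_add_right, h.normal_left, add_zero]
  have hHη : ∀ X Y, ⟪η, H' X Y⟫ = ⟪η, H (S X) (S Y)⟫ := fun X Y => by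
    rw [hH, inner_add_right, h.normal_right, add_zero]
  have hker : ∀ ζ : E, (∀ X Y, ⟪ζ, H' X Y⟫ = ⟪ζ, H (S X) (S Y)⟫) →
      finrank ℝ (formKer (component H' ζ)) = finrank ℝ (formKer (component H ζ)) := by
    intro ζ hζ
    have : formKer (component H' ζ) =
        (formKer (component H ζ)).map (S.symm.toLinearEquiv : V →ₗ[ℝ] V') := by
      ext X
      rw [mem_formKer, Submodule.mem_map]
      constructor
      · intro hX
        refine ⟨S X, mem_formKer.2 fun Y => ?_, by simp⟩
        have := hX (S.symm Y)
        rwa [component_apply, hζ, ContinuousLinearEquiv.apply_symm_apply] at this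
      · rintro ⟨Z, hZ, rfl⟩ Y
        rw [component_apply, hζ]
        have := mem_formKer.1 hZ (S Y)
        simpa [component_apply] using this
    rw [this]
    exact LinearEquiv.finrank_map_eq S.symm.toLinearEquiv _
  exact
    { inj := fun X Y hXY => S.injective (h.inj (by rw [← hL, ← hL, hXY]))
      symm := hs
      norm_left := h.norm_left
      norm_right := h.norm_right
      orth := h.orth
      normal_left := fun X => by rw [hL, h.normal_left]
      normal_right := fun X => by rw [hL, h.normal_right]
      nonneg_left := fun X => by rw [hHξ]; exact h.nonneg_left _
      nonneg_right := fun X => by rw [hHη]; exact h.nonneg_right _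
      ker_left := by rw [hker ξ hHξ, h.ker_left]
      ker_right := by rw [hker η hHη, h.ker_right, S.toLinearEquiv.finrank_eq]
      disj := fun X h1 h2 => by
        have : S X = 0 := h.disj (S X)
          (fun Y => by rw [← S.apply_symm_apply Y, ← hHξ, h1])
          (fun Y => by rw [← S.apply_symm_apply Y, ← hHη, h2])
        simpa using this }

end SplitFrame

end

/-! ### Smoothness of the normal frame -/

section

variable {V E : Type*} [NormedAddCommGroup V] [NormedSpace ℝ V] [NormedAddCommGroup E]
  [InnerProductSpace ℝ E]

/-- The functionals `X ↦ ⟪v, L X⟫`. -/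
def flat (L : V →L[ℝ] E) : E →L[ℝ] V →L[ℝ] ℝ :=
  ((ContinuousLinearMap.compL ℝ V E ℝ).flip L).comp (innerBilin E)

theorem flat_apply (L : V →L[ℝ] E) (v : E) (X : V) : flat L v X = ⟪v, L X⟫ := rfl

/-- The orthogonal projection to the orthogonal complement of the range of an injective map. -/
def normProj (L : V →L[ℝ] E) : E →L[ℝ] E :=
  -- This is `1 - L (LᵀL)⁻¹ Lᵀ`, a formula from which smooth dependence on `L` can be read off.
  ContinuousLinearMap.id ℝ E - (L.comp ((flat L).comp L).inverse).comp (flat L)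

/-- An injective bilinear form on a finite dimensional space is invertible. -/
theorem exists_equiv_of_injective [FiniteDimensional ℝ V] {q : V →L[ℝ] V →L[ℝ] ℝ}
    (hq : ∀ X, q X = 0 → X = 0) : ∃ e : V ≃L[ℝ] (V →L[ℝ] ℝ), (e : V →L[ℝ] V →L[ℝ] ℝ) = q := by
  have hdim : finrank ℝ V = finrank ℝ (V →L[ℝ] ℝ) := by
    rw [← (LinearMap.toContinuousLinearMap (𝕜 := ℝ) (E := V) (F' := ℝ)).finrank_eq]
    exact (Subspace.dual_finrank_eq (K := ℝ) (V := V)).symm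
  have hinj : Function.Injective q.toLinearMap :=
    LinearMap.ker_eq_bot.1 (LinearMap.ker_eq_bot'.2 hq)
  refine ⟨(LinearEquiv.ofInjectiveOfFinrankEq q.toLinearMap hinj hdim).toContinuousLinearEquiv, ?_⟩
  ext X Y
  rfl

theorem inverse_apply_self [FiniteDimensional ℝ V] {q : V →L[ℝ] V →L[ℝ] ℝ}
    (hq : ∀ X, q X = 0 → X = 0) (X : V) : q.inverse (q X) = X := by
  obtain ⟨e, rfl⟩ := exists_equiv_of_injective hq
  simp

theorem contDiffAt_inverse_form [FiniteDimensional ℝ V] {q : V → V →L[ℝ] V →L[ℝ] ℝ} {y : V}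
    (h : ContDiffAt ℝ ∞ q y) (hq : ∀ X, q y X = 0 → X = 0) :
    ContDiffAt ℝ ∞ (fun z => (q z).inverse) y := by
  obtain ⟨e, he⟩ := exists_equiv_of_injective hq
  have := contDiffAt_map_inverse (𝕜 := ℝ) (n := ∞) e
  rw [he] at this
  exact this.comp y h

theorem gram_injective {L : V →L[ℝ] E} (hL : Function.Injective L) (X : V)
    (h : ((flat L).comp L) X = 0) : X = 0 := by
  have h1 : ⟪L X, L X⟫ = 0 := congrArg (fun l : V →L[ℝ] ℝ => l X) h
  exact hL (by rw [inner_self_eq_zero.1 h1, map_zero])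

theorem normProj_of_normal {L : V →L[ℝ] E} {v : E} (h : ∀ X, ⟪v, L X⟫ = 0) : normProj L v = v := by
  have : flat L v = 0 := ContinuousLinearMap.ext h
  simp [normProj, this]

theorem normProj_range [FiniteDimensional ℝ V] {L : V →L[ℝ] E} (hL : Function.Injective L) (X : V) :
    normProj L (L X) = 0 := by
  have := inverse_apply_self (gram_injective hL) X
  simp only [ContinuousLinearMap.comp_apply] at this
  simp [normProj, this]

set_option synthInstance.maxHeartbeats 200000 in
theorem contDiffAt_flat {L : V → V →L[ℝ] E} {y : V} (h : ContDiffAt ℝ ∞ L y) :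
    ContDiffAt ℝ ∞ (fun z => flat (L z)) y :=
  (contDiffAt_const.clm_apply h).clm_comp contDiffAt_const

theorem contDiffAt_normProj [FiniteDimensional ℝ V] {L : V → V →L[ℝ] E} {y : V}
    (h : ContDiffAt ℝ ∞ L y) (hL : Function.Injective (L y)) :
    ContDiffAt ℝ ∞ (fun z => normProj (L z)) y :=
  contDiffAt_const.sub ((h.clm_comp (contDiffAt_inverse_form ((contDiffAt_flat h).clm_comp h)
    (gram_injective hL))).clm_comp (contDiffAt_flat h))

/-- The normal part of `H`. -/
def normalPart (L : V →L[ℝ] E) (H : V →L[ℝ] V →L[ℝ] E) : V →L[ℝ] V →L[ℝ] E :=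
  (ContinuousLinearMap.compL ℝ V E E (normProj L)).comp H

theorem normalPart_apply (L : V →L[ℝ] E) (H : V →L[ℝ] V →L[ℝ] E) (X Y : V) :
    normalPart L H X Y = normProj L (H X Y) := rfl

/-- The Ricci type contraction of the Gauss equation. -/
def ricciForm [FiniteDimensional ℝ V] (α : V →L[ℝ] V →L[ℝ] E) : V →L[ℝ] V →L[ℝ] ℝ :=
  -- The summand is `⟪α(eᵢ, eᵢ), α(X, Y)⟫ - ⟪α(eᵢ, X), α(eᵢ, Y)⟫`. It does not involve the frame,
  -- and the `η` part drops out because the minors of order two of a rank one form vanish. The basis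
  -- need not be orthonormal.
  ∑ i, (component α (α (finBasis ℝ V i) (finBasis ℝ V i)) -
    (flat (α (finBasis ℝ V i))).comp (α (finBasis ℝ V i)))

set_option synthInstance.maxHeartbeats 200000 in
theorem contDiffAt_ricciForm [FiniteDimensional ℝ V] {α : V → V →L[ℝ] V →L[ℝ] E} {y : V}
    (h : ContDiffAt ℝ ∞ α y) : ContDiffAt ℝ ∞ (fun z => ricciForm (α z)) y := by
  refine ContDiffAt.sum fun i _ => ?_
  have h1 : ContDiffAt ℝ ∞ (fun z => α z (finBasis ℝ V i)) y := h.clm_apply contDiffAt_const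
  have h2 := h1.clm_apply (contDiffAt_const (c := finBasis ℝ V i))
  exact ((contDiffAt_const.clm_apply (contDiffAt_const.clm_apply h2)).clm_comp h).sub
    ((contDiffAt_flat h1).clm_comp h1)

namespace SplitFrame

variable {L : V →L[ℝ] E} {H : V →L[ℝ] V →L[ℝ] E} {ξ η : E}

theorem normalPart_eq [FiniteDimensional ℝ V] [FiniteDimensional ℝ E] (h : SplitFrame L H ξ η)
    (hE : finrank ℝ E = finrank ℝ V + 2) (X Y : V) :
    normalPart L H X Y = ⟪ξ, H X Y⟫ • ξ + ⟪η, H X Y⟫ • η := by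
  obtain ⟨Z, hZ⟩ := h.exists_decomp hE (H X Y)
  rw [normalPart_apply]
  conv_lhs => rw [hZ]
  rw [map_add, map_add, map_smul, map_smul, normProj_range h.inj,
    normProj_of_normal h.normal_left, normProj_of_normal h.normal_right, zero_add]

theorem ricciForm_eq [FiniteDimensional ℝ V] [FiniteDimensional ℝ E] (h : SplitFrame L H ξ η)
    (hE : finrank ℝ E = finrank ℝ V + 2) (X Y : V) :
    ricciForm (normalPart L H) X Y = ∑ i, (⟪ξ, H (finBasis ℝ V i) (finBasis ℝ V i)⟫ * ⟪ξ, H X Y⟫ -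
      ⟪ξ, H (finBasis ℝ V i) X⟫ * ⟪ξ, H (finBasis ℝ V i) Y⟫) := by
  rw [ricciForm, sum_apply, sum_apply]
  refine Finset.sum_congr rfl fun i _ => ?_
  simp only [sub_apply, component_apply, ContinuousLinearMap.comp_apply, flat_apply,
    h.normalPart_eq hE, inner_add_left, inner_add_right, inner_smul_left, inner_smul_right,
    h.norm_left, h.norm_right, h.orth, h.orth', RCLike.conj_to_real]
  have := h.minor X Y (finBasis ℝ V i)
  rw [h.symm X (finBasis ℝ V i), h.symm Y (finBasis ℝ V i)] at this
  linarith

theorem ricciForm_of_mem [FiniteDimensional ℝ V] [FiniteDimensional ℝ E] (h : SplitFrame L H ξ η)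
    (hE : finrank ℝ E = finrank ℝ V + 2) {X : V} (hX : ∀ Y, ⟪ξ, H X Y⟫ = 0) (Y : V) :
    ricciForm (normalPart L H) X Y = 0 := by
  rw [h.ricciForm_eq hE]
  refine Finset.sum_eq_zero fun i _ => ?_
  rw [hX, h.symm _ X, hX]
  ring

theorem ricciForm_nonneg [FiniteDimensional ℝ V] [FiniteDimensional ℝ E] (h : SplitFrame L H ξ η)
    (hE : finrank ℝ E = finrank ℝ V + 2) (X : V) : 0 ≤ ricciForm (normalPart L H) X X := by
  rw [h.ricciForm_eq hE]
  refine Finset.sum_nonneg fun i _ => ?_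
  have := psd_cauchy_schwarz (q := component H ξ) (h.component_symm ξ) h.nonneg_left
    (finBasis ℝ V i) X
  simp only [component_apply] at this
  nlinarith

theorem mem_of_ricciForm [FiniteDimensional ℝ V] [FiniteDimensional ℝ E] (h : SplitFrame L H ξ η)
    (hE : finrank ℝ E = finrank ℝ V + 2) (hV : 3 ≤ finrank ℝ V) {X : V}
    (hX : ricciForm (normalPart L H) X X = 0) : X ∈ formKer (component H ξ) := by
  -- The contraction is a sum of nonnegative Cauchy–Schwarz defects of the `ξ` form, so each defect
  -- vanishes.
  refine psd_mem_ker_of_defect (h.component_symm ξ) h.nonneg_left h.ker_left hV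
    (finBasis ℝ V) fun i => ?_
  rw [h.ricciForm_eq hE] at hX
  have := (Finset.sum_eq_zero_iff_of_nonneg fun i _ => by
    have := psd_cauchy_schwarz (q := component H ξ) (h.component_symm ξ) h.nonneg_left
      (finBasis ℝ V i) X
    simp only [component_apply] at this
    nlinarith).1 hX i (Finset.mem_univ i)
  simp only [component_apply]
  linarith

/-- The Ricci form, corrected by a functional that does not vanish on its kernel, is injective. -/
theorem corrected_injective [FiniteDimensional ℝ V] [FiniteDimensional ℝ E]
    (h : SplitFrame L H ξ η) (hE : finrank ℝ E = finrank ℝ V + 2) (hV : 3 ≤ finrank ℝ V)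
    {l : V →L[ℝ] ℝ} {v : V} (hv : v ∈ formKer (component H ξ)) (hl : l v ≠ 0) (X : V)
    (hX : (ricciForm (normalPart L H) + l.smulRight l) X = 0) : X = 0 := by
  -- Both summands are nonnegative, hence zero. The first puts `X` on the kernel line spanned by
  -- `v`, the second excludes multiples of `v` other than zero.
  have h1 : ricciForm (normalPart L H) X X + l X * l X = 0 :=
    congrArg (fun m : V →L[ℝ] ℝ => m X) hX
  have h2 := h.ricciForm_nonneg hE X
  have h3 := mul_self_nonneg (l X)
  have hX1 := h.mem_of_ricciForm hE hV (X := X) (by linarith)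
  have hX2 : l X = 0 := mul_self_eq_zero.1 (by linarith)
  have hv0 : v ≠ 0 := fun h => hl (by rw [h, map_zero])
  obtain ⟨c, hc⟩ := (finrank_eq_one_iff_of_nonzero' (⟨v, hv⟩ : formKer (component H ξ))
    (by simpa using hv0)).1 h.ker_left ⟨X, hX1⟩
  have hc' : c • v = X := congrArg Subtype.val hc
  rw [← hc', map_smul, smul_eq_mul] at hX2
  rw [← hc', (mul_eq_zero.1 hX2).resolve_right hl, zero_smul]

/-- The kernel vector of the corrected Ricci form. -/
theorem inverse_mem [FiniteDimensional ℝ V] [FiniteDimensional ℝ E]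
    (h : SplitFrame L H ξ η) (hE : finrank ℝ E = finrank ℝ V + 2) {l : V →L[ℝ] ℝ}
    (hinj : ∀ X, (ricciForm (normalPart L H) + l.smulRight l) X = 0 → X = 0) :
    (ricciForm (normalPart L H) + l.smulRight l).inverse l ≠ 0 ∧
      ∀ Y, ⟪ξ, H ((ricciForm (normalPart L H) + l.smulRight l).inverse l) Y⟫ = 0 := by
  have hpos : 0 < finrank ℝ (formKer (component H ξ)) := by rw [h.ker_left]; exact one_pos
  obtain ⟨u, hu0⟩ := Module.finrank_pos_iff_exists_ne_zero.1 hpos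
  have hu := mem_formKer.1 u.2
  -- A kernel vector `u` is sent to `l u • l`, so the inverse image of `l` is `u / l u`: a kernel
  -- vector given by a formula smooth in the data.
  have h1 : (ricciForm (normalPart L H) + l.smulRight l) (u : V) = l u • l := by
    ext Y
    have := h.ricciForm_of_mem hE hu Y
    simp [this]
  have hlu : l u ≠ 0 := by
    intro h0
    rw [h0, zero_smul] at h1
    exact hu0 (Subtype.ext (hinj _ h1))
  have h2 := inverse_apply_self hinj (u : V)
  rw [h1, map_smul] at h2
  have h3 : (ricciForm (normalPart L H) + l.smulRight l).inverse l = (l u)⁻¹ • (u : V) := by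
    rw [eq_inv_smul_iff₀ hlu]; exact h2
  rw [h3]
  refine ⟨smul_ne_zero (inv_ne_zero hlu) (by simpa using hu0), fun Y => ?_⟩
  have := hu Y
  rw [component_apply] at this
  rw [map_smul, smul_apply, inner_smul_right, this, mul_zero]

end SplitFrame

theorem contDiffAt_normalize {w : V → E} {y : V} (h : ContDiffAt ℝ ∞ w y) (h0 : w y ≠ 0) :
    ContDiffAt ℝ ∞ (fun z => ‖w z‖⁻¹ • w z) y :=
  ((h.norm ℝ h0).inv (norm_ne_zero_iff.2 h0)).smul h

theorem normalize_pos_smul {t : ℝ} (ht : 0 < t) {v : E} (hv : ⟪v, v⟫ = 1) :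
    ‖t • v‖⁻¹ • (t • v) = v := by
  have : ‖v‖ = 1 := by
    rw [real_inner_self_eq_norm_sq] at hv
    nlinarith [norm_nonneg v]
  rw [norm_smul, this, Real.norm_of_nonneg ht.le, mul_one, smul_smul, inv_mul_cancel₀ ht.ne',
    one_smul]

/-- The frame of an immersion with split second fundamental form is smooth. -/
theorem contDiffAt_frame [FiniteDimensional ℝ V] [FiniteDimensional ℝ E] {F ξ η : V → E} {y₀ : V}
    (hE : finrank ℝ E = finrank ℝ V + 2) (hV : 3 ≤ finrank ℝ V) (hF : ContDiffAt ℝ ∞ F y₀)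
    (hfr : ∀ᶠ y in 𝓝 y₀, SplitFrame (fderiv ℝ F y) (fderiv ℝ (fderiv ℝ F) y) (ξ y) (η y)) :
    ContDiffAt ℝ ∞ ξ y₀ ∧ ContDiffAt ℝ ∞ η y₀ := by
  have hL : ContDiffAt ℝ ∞ (fderiv ℝ F) y₀ := hF.fderiv_right (by simp)
  have hH : ContDiffAt ℝ ∞ (fderiv ℝ (fderiv ℝ F)) y₀ := hL.fderiv_right (by simp)
  have hN := contDiffAt_normProj hL hfr.self_of_nhds.inj
  set α : V → V →L[ℝ] V →L[ℝ] E := fun y => normalPart (fderiv ℝ F y) (fderiv ℝ (fderiv ℝ F) y)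
    with hα
  have hαs : ContDiffAt ℝ ∞ α y₀ := (contDiffAt_const.clm_apply hN).clm_comp hH
  have h₀ := hfr.self_of_nhds
  have hpos : 0 < finrank ℝ (formKer (component (fderiv ℝ (fderiv ℝ F) y₀) (ξ y₀))) := by
    rw [h₀.ker_left]; exact one_pos
  obtain ⟨v, hv0⟩ := Module.finrank_pos_iff_exists_ne_zero.1 hpos
  obtain ⟨l, hl⟩ : ∃ l : V →L[ℝ] ℝ, l v ≠ 0 := by
    obtain ⟨l, -, hl⟩ := exists_dual_vector ℝ (v : V) (by simpa using hv0)
    refine ⟨l, ?_⟩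
    rw [hl]
    simpa using hv0
  set q : V → V →L[ℝ] V →L[ℝ] ℝ := fun y => ricciForm (α y) + l.smulRight l with hq
  have hqs : ContDiffAt ℝ ∞ q y₀ := (contDiffAt_ricciForm hαs).add contDiffAt_const
  have hq0 : ∀ X, q y₀ X = 0 → X = 0 := h₀.corrected_injective hE hV v.2 hl
  have hqinj : ∀ᶠ y in 𝓝 y₀, ∀ X, q y X = 0 → X = 0 := by
    obtain ⟨e, he⟩ := exists_equiv_of_injective hq0
    have h1 := e.nhds
    rw [he] at h1
    filter_upwards [hqs.continuousAt h1] with y hy X hX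
    obtain ⟨e', he'⟩ := hy
    rw [← he'] at hX
    simpa using hX
  set k : V → V := fun y => (q y).inverse l with hk
  have hks : ContDiffAt ℝ ∞ k y₀ := (contDiffAt_inverse_form hqs hq0).clm_apply contDiffAt_const
  -- Since `k y` spans the kernel of the `ξ` form, `α(k, k)` is a positive multiple of `η`, and `η`
  -- is recovered by normalizing it.
  have hw : ∀ y, SplitFrame (fderiv ℝ F y) (fderiv ℝ (fderiv ℝ F) y) (ξ y) (η y) →
      (∀ X, q y X = 0 → X = 0) → ∃ t : ℝ, 0 < t ∧ α y (k y) (k y) = t • η y := by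
    intro y hy hyq
    obtain ⟨h1, h2⟩ := hy.inverse_mem hE hyq
    refine ⟨_, hy.right_pos h2 h1, ?_⟩
    simp only [hα]
    rw [hy.normalPart_eq hE, h2, zero_smul, zero_add]
  have hηs : ContDiffAt ℝ ∞ η y₀ := by
    have h1 : ContDiffAt ℝ ∞ (fun y => α y (k y) (k y)) y₀ := (hαs.clm_apply hks).clm_apply hks
    obtain ⟨t, ht, ht'⟩ := hw y₀ h₀ hq0
    refine (contDiffAt_normalize h1 ?_).congr_of_eventuallyEq ?_
    · rw [ht']
      exact smul_ne_zero ht.ne' fun h0 => by simpa [h0] using h₀.norm_right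
    · filter_upwards [hfr, hqinj] with y hy1 hy2
      obtain ⟨t, ht, ht'⟩ := hw y hy1 hy2
      rw [ht', normalize_pos_smul ht hy1.norm_right]
  refine ⟨?_, hηs⟩
  set b := finBasis ℝ V
  have h1 : ContDiffAt ℝ ∞ (fun y => ∑ i, α y (b i) (b i)) y₀ :=
    ContDiffAt.sum fun i _ => (hαs.clm_apply contDiffAt_const).clm_apply contDiffAt_const
  -- Once `η` is smooth, `ξ` is recovered from the sum of the `α(bᵢ, bᵢ)` without its `η` component.
  -- The coefficient of `ξ` is positive, as otherwise the `ξ` form would vanish.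
  have h2 : ContDiffAt ℝ ∞ (fun y => (∑ i, α y (b i) (b i)) -
      ⟪η y, ∑ i, α y (b i) (b i)⟫ • η y) y₀ := h1.sub ((hηs.inner ℝ h1).smul hηs)
  have h3 : ∀ y, SplitFrame (fderiv ℝ F y) (fderiv ℝ (fderiv ℝ F) y) (ξ y) (η y) →
      ∃ t : ℝ, 0 < t ∧ (∑ i, α y (b i) (b i)) - ⟪η y, ∑ i, α y (b i) (b i)⟫ • η y = t • ξ y := by
    intro y hy
    refine ⟨∑ i, ⟪ξ y, fderiv ℝ (fderiv ℝ F) y (b i) (b i)⟫, ?_, ?_⟩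
    · refine lt_of_le_of_ne (Finset.sum_nonneg fun i _ => hy.nonneg_left _) fun h0 => ?_
      have h4 := (Finset.sum_eq_zero_iff_of_nonneg fun i _ => hy.nonneg_left (b i)).1 h0.symm
      have h5 : formKer (component (fderiv ℝ (fderiv ℝ F) y) (ξ y)) = ⊤ := by
        rw [eq_top_iff, ← b.span_eq, Submodule.span_le]
        rintro _ ⟨i, rfl⟩
        exact mem_formKer.2 (psd_apply_eq_zero (hy.component_symm _) hy.nonneg_left
          (h4 i (Finset.mem_univ i)))
      have h6 := hy.ker_left
      rw [h5, finrank_top] at h6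
      omega
    · simp only [hα, hy.normalPart_eq hE, Finset.sum_add_distrib, ← Finset.sum_smul,
        inner_add_right, inner_smul_right, hy.orth', hy.norm_right]
      simp
  obtain ⟨t, ht, ht'⟩ := h3 y₀ h₀
  refine (contDiffAt_normalize h2 ?_).congr_of_eventuallyEq ?_
  · rw [ht']
    exact smul_ne_zero ht.ne' fun h0 => by simpa [h0] using h₀.norm_left
  · filter_upwards [hfr] with y hy
    obtain ⟨t, ht, ht'⟩ := h3 y hy
    rw [ht', normalize_pos_smul ht hy.norm_left]

end

/-! ### The Codazzi equation: the differential of `η` has rank one -/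

section

variable {V E : Type*} [NormedAddCommGroup V] [NormedSpace ℝ V]
  [NormedAddCommGroup E] [InnerProductSpace ℝ E] {F ξ η : V → E} {y₀ : V}

theorem two_le_infty : (2 : ℕ∞ω) ≤ ∞ :=
  WithTop.coe_le_coe.2 (le_top : (2 : ℕ∞) ≤ ⊤)

/-- `η` is differentiable with tangential part given by the form `⟪η, D²F⟫`. -/
theorem inner_fderiv_normal (hF : ContDiffAt ℝ 2 F y₀) (hη : DifferentiableAt ℝ η y₀)
    (hn : ∀ᶠ y in 𝓝 y₀, ∀ X, ⟪η y, fderiv ℝ F y X⟫ = 0) (X Y : V) :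
    ⟪fderiv ℝ η y₀ X, fderiv ℝ F y₀ Y⟫ = -⟪η y₀, fderiv ℝ (fderiv ℝ F) y₀ X Y⟫ := by
  have hL : ContDiffAt ℝ 1 (fderiv ℝ F) y₀ := hF.fderiv_right (by norm_num)
  have h1 : HasFDerivAt (fun y => fderiv ℝ F y Y) ((fderiv ℝ (fderiv ℝ F) y₀).flip Y) y₀ :=
    ((hL.differentiableAt (by simp)).hasFDerivAt.clm_apply (hasFDerivAt_const Y y₀)).congr_fderiv
      (by ext; simp)
  have h2 := hη.hasFDerivAt.inner ℝ h1
  have h3 : HasFDerivAt (fun y => ⟪η y, fderiv ℝ F y Y⟫) (0 : V →L[ℝ] ℝ) y₀ :=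
    (hasFDerivAt_const (0 : ℝ) y₀).congr_of_eventuallyEq (hn.mono fun y hy => hy Y)
  have h4 := congrArg (fun l : V →L[ℝ] ℝ => l X) (h2.unique h3)
  simp [fderivInnerCLM_apply] at h4
  linarith

theorem inner_fderiv_unit (hη : DifferentiableAt ℝ η y₀) (hn : ∀ᶠ y in 𝓝 y₀, ⟪η y, η y⟫ = 1)
    (X : V) : ⟪η y₀, fderiv ℝ η y₀ X⟫ = 0 := by
  have h2 := hη.hasFDerivAt.inner ℝ hη.hasFDerivAt
  have h3 : HasFDerivAt (fun y => ⟪η y, η y⟫) (0 : V →L[ℝ] ℝ) y₀ :=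
    (hasFDerivAt_const (1 : ℝ) y₀).congr_of_eventuallyEq hn
  have h4 := congrArg (fun l : V →L[ℝ] ℝ => l X) (h2.unique h3)
  simp [fderivInnerCLM_apply] at h4
  rw [real_inner_comm (η y₀)] at h4
  linarith

variable [FiniteDimensional ℝ V]

/-- The kernel of the rank one form is parallel along itself: the Codazzi equation. -/
theorem fderiv_normal_eq_zero [FiniteDimensional ℝ E]
    (hE : finrank ℝ E = finrank ℝ V + 2) (hV : 3 ≤ finrank ℝ V)
    (hF : ContDiffAt ℝ ∞ F y₀)
    (hfr : ∀ᶠ y in 𝓝 y₀, SplitFrame (fderiv ℝ F y) (fderiv ℝ (fderiv ℝ F) y) (ξ y) (η y))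
    {Y : V} (hY : ∀ Z, ⟪η y₀, fderiv ℝ (fderiv ℝ F) y₀ Y Z⟫ = 0) : fderiv ℝ η y₀ Y = 0 := by
  have hη : ContDiffAt ℝ ∞ η y₀ := (contDiffAt_frame hE hV hF hfr).2
  have hL : ContDiffAt ℝ ∞ (fderiv ℝ F) y₀ := hF.fderiv_right (by simp)
  have hH : ContDiffAt ℝ ∞ (fderiv ℝ (fderiv ℝ F)) y₀ := hL.fderiv_right (by simp)
  have hDη : ContDiffAt ℝ ∞ (fderiv ℝ η) y₀ := hη.fderiv_right (by simp)
  have h₀ := hfr.self_of_nhds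
  have hηd : ∀ᶠ y in 𝓝 y₀, DifferentiableAt ℝ η y :=
    ((hη.of_le (m := 1) (by exact_mod_cast le_top)).eventually (by simp)).mono
      fun y hy => hy.differentiableAt (by simp)
  have hFe : ∀ᶠ y in 𝓝 y₀, ContDiffAt ℝ 2 F y :=
    (hF.of_le (m := 2) two_le_infty).eventually (by simp)
  set b : V → V → V → ℝ := fun y X Y => ⟪η y, fderiv ℝ (fderiv ℝ F) y X Y⟫ with hb
  have hbd : ∀ X Y, DifferentiableAt ℝ (fun y => b y X Y) y₀ := fun X Y =>
    ((hη.inner ℝ ((hH.clm_apply contDiffAt_const).clm_apply contDiffAt_const)).differentiableAt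
      (by simp))
  -- the derivative of the rank one form vanishes on its kernel
  have hbder : ∀ X Y, (∀ Z, b y₀ X Z = 0) → (∀ Z, b y₀ Y Z = 0) →
      fderiv ℝ (fun y => b y X Y) y₀ = 0 := by
    intro X Y hX hY
    obtain ⟨W, hW, -⟩ := h₀.rank_one
    -- Differentiating `b(X, Y) b(W, W) = b(X, W) b(Y, W)` leaves only `b(W, W) db(X, Y) = 0`,
    -- because the other values of `b` vanish at `y₀`.
    have h1 := (hbd X Y).hasFDerivAt.mul (hbd W W).hasFDerivAt
    have h2 := (hbd X W).hasFDerivAt.mul (hbd Y W).hasFDerivAt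
    have h3 := h1.congr_of_eventuallyEq (f₁ := fun y => b y X W * b y Y W)
      (hfr.mono fun y hy => (hy.minor X Y W).symm)
    have h4 := h3.unique h2
    rw [hX, hX, hY, zero_smul, zero_smul, zero_smul, zero_add, zero_add] at h4
    exact (smul_eq_zero.1 h4).resolve_left hW.ne'
  have hfirst : ∀ X Z, ∀ᶠ y in 𝓝 y₀, ⟪fderiv ℝ η y Z, fderiv ℝ F y X⟫ = -b y Z X := by
    intro X Z
    have hn : ∀ᶠ y in 𝓝 y₀, ∀ X, ⟪η y, fderiv ℝ F y X⟫ = 0 := hfr.mono fun y hy => hy.normal_right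
    filter_upwards [hn.eventually_nhds, hηd, hFe] with y h1 h2 h3
    exact inner_fderiv_normal h3 h2 h1 Z X
  -- On the kernel `dη` has no tangential part, and none along the unit vector `η`; only the normal
  -- connection form remains.
  have hψ : ∀ Z, (∀ X, b y₀ Z X = 0) → fderiv ℝ η y₀ Z = ⟪ξ y₀, fderiv ℝ η y₀ Z⟫ • ξ y₀ := by
    intro Z hZ
    rw [← sub_eq_zero]
    refine h₀.eq_zero_of_inner hE ?_ ?_ fun X => ?_
    · rw [inner_sub_right, inner_smul_right, h₀.norm_left]; ring
    · rw [inner_sub_right, inner_smul_right, h₀.orth',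
        inner_fderiv_unit hηd.self_of_nhds (hfr.mono fun y hy => hy.norm_right)]
      ring
    · rw [inner_sub_left, inner_smul_left, h₀.normal_left, (hfirst X Z).self_of_nhds, hZ]
      simp
  have hsymm : ∀ X Z, fderiv ℝ (fderiv ℝ η) y₀ X Z = fderiv ℝ (fderiv ℝ η) y₀ Z X := fun X Z =>
    (hη.isSymmSndFDerivAt (by simpa using two_le_infty)).eq X Z
  have hsecond : ∀ X Y Z, (∀ W, b y₀ X W = 0) → (∀ W, b y₀ Y W = 0) →
      ⟪fderiv ℝ (fderiv ℝ η) y₀ Z Y, fderiv ℝ F y₀ X⟫ =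
        -⟪fderiv ℝ η y₀ Y, fderiv ℝ (fderiv ℝ F) y₀ Z X⟫ := by
    intro X Y Z hX hY
    have h1 : HasFDerivAt (fun y => fderiv ℝ η y Y) ((fderiv ℝ (fderiv ℝ η) y₀).flip Y) y₀ :=
      ((hDη.differentiableAt (by simp)).hasFDerivAt.clm_apply (hasFDerivAt_const Y y₀)).congr_fderiv
        (by ext; simp)
    have h2 : HasFDerivAt (fun y => fderiv ℝ F y X) ((fderiv ℝ (fderiv ℝ F) y₀).flip X) y₀ :=
      ((hL.differentiableAt (by simp)).hasFDerivAt.clm_apply (hasFDerivAt_const X y₀)).congr_fderiv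
        (by ext; simp)
    have h3 := h1.inner ℝ h2
    have h4 := (hbd Y X).hasFDerivAt.neg
    have h5 := h4.congr_of_eventuallyEq (hfirst X Y)
    have h6 := congrArg (fun l : V →L[ℝ] ℝ => l Z) (h3.unique h5)
    rw [hbder Y X hY hX] at h6
    simp [fderivInnerCLM_apply] at h6
    linarith
  -- The symmetry of `D²η` turns `hsecond` into the Codazzi equation on the kernel.
  have hcod : ∀ X Y Z, (∀ W, b y₀ X W = 0) → (∀ W, b y₀ Y W = 0) → (∀ W, b y₀ Z W = 0) →
      ⟪ξ y₀, fderiv ℝ η y₀ Y⟫ * ⟪ξ y₀, fderiv ℝ (fderiv ℝ F) y₀ Z X⟫ =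
        ⟪ξ y₀, fderiv ℝ η y₀ Z⟫ * ⟪ξ y₀, fderiv ℝ (fderiv ℝ F) y₀ Y X⟫ := by
    intro X Y Z hX hY hZ
    have h1 := hsecond X Y Z hX hY
    have h2 := hsecond X Z Y hX hZ
    rw [hsymm Y Z, h1, hψ Y hY, hψ Z hZ, inner_smul_left, inner_smul_left] at h2
    simpa using h2
  -- a kernel vector on which the normal connection form vanishes
  set K := formKer (component (fderiv ℝ (fderiv ℝ F) y₀) (η y₀)) with hK
  obtain ⟨Z, hZ0, hZ⟩ : ∃ Z : K, Z ≠ 0 ∧ ⟪ξ y₀, fderiv ℝ η y₀ Z⟫ = 0 := by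
    -- A linear form on a space of dimension `n - 1 ≥ 2` has a nontrivial kernel.
    let m : K →ₗ[ℝ] ℝ := (innerBilin E (ξ y₀) ∘L fderiv ℝ η y₀).toLinearMap ∘ₗ K.subtype
    have h1 := LinearMap.finrank_range_add_finrank_ker m
    have h2 := Submodule.finrank_le (LinearMap.range m)
    have h3 : finrank ℝ K + 1 = finrank ℝ V := h₀.ker_right
    rw [finrank_self] at h2
    have h4 : 0 < finrank ℝ (LinearMap.ker m) := by omega
    obtain ⟨u, hu⟩ := Module.finrank_pos_iff_exists_ne_zero.1 h4
    exact ⟨u, by simpa using hu, u.2⟩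
  have hZk := mem_formKer.1 Z.2
  -- With `X = Z` the right hand side vanishes, while the `ξ` form is positive at `Z`.
  have h1 := hcod Z Y Z hZk hY hZk
  rw [hZ, zero_mul] at h1
  have h2 := h₀.left_pos hZk (by simpa using hZ0)
  rw [hψ Y hY, (mul_eq_zero.1 h1).resolve_right h2.ne', zero_smul]

/-- The differential of `η` has rank one. -/
theorem exists_fderiv_normal_eq [FiniteDimensional ℝ E]
    (hE : finrank ℝ E = finrank ℝ V + 2) (hV : 3 ≤ finrank ℝ V)
    (hF : ContDiffAt ℝ ∞ F y₀)
    (hfr : ∀ᶠ y in 𝓝 y₀, SplitFrame (fderiv ℝ F y) (fderiv ℝ (fderiv ℝ F) y) (ξ y) (η y)) :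
    ∃ (l : V →L[ℝ] ℝ) (W : V), ⟪fderiv ℝ η y₀ W, fderiv ℝ F y₀ W⟫ < 0 ∧
      ∀ X, fderiv ℝ η y₀ X = l X • fderiv ℝ η y₀ W := by
  have hη : ContDiffAt ℝ ∞ η y₀ := (contDiffAt_frame hE hV hF hfr).2
  have h₀ := hfr.self_of_nhds
  obtain ⟨W, hW, hb⟩ := h₀.rank_one
  -- With `l = b(W, ·) / b(W, W)`, the vector `X - l(X) W` lies in the kernel of the rank one form
  -- `b`.
  refine ⟨(⟪η y₀, fderiv ℝ (fderiv ℝ F) y₀ W W⟫)⁻¹ •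
    component (fderiv ℝ (fderiv ℝ F) y₀) (η y₀) W, W, ?_, fun X => ?_⟩
  · rw [inner_fderiv_normal (hF.of_le two_le_infty) (hη.differentiableAt (by simp))
      (hfr.mono fun y hy => hy.normal_right)]
    linarith
  · rw [← sub_eq_zero, ← map_smul, ← map_sub]
    refine fderiv_normal_eq_zero hE hV hF hfr fun Z => ?_
    rw [map_sub, map_smul, sub_apply, smul_apply, inner_sub_right, inner_smul_right, smul_apply,
      component_apply, smul_eq_mul, h₀.symm W X, h₀.symm W Z]
    have := hb X Z
    field_simp
    linarith

/-! ### The direction of the flat extension -/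

/-- The part of `ξ` orthogonal to the range of `D`. -/
def transversal (D : V →L[ℝ] E) (ξ : E) : E := ξ - (LinearMap.range D.toLinearMap).starProjection ξ

theorem inner_transversal (D : V →L[ℝ] E) (ξ : E) (X : V) : ⟪transversal D ξ, D X⟫ = 0 := by
  have := Submodule.sub_starProjection_mem_orthogonal (K := LinearMap.range D.toLinearMap) ξ
  rw [real_inner_comm]
  exact (Submodule.mem_orthogonal _ _).1 this _ ⟨X, rfl⟩

theorem transversal_eq_of_rank_one {D : V →L[ℝ] E} {w : E} (hw : ∃ X, D X = w)
    (hD : ∀ X, ∃ t : ℝ, D X = t • w) (ξ : E) :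
    transversal D ξ = ξ - (⟪w, ξ⟫ / (‖w‖ ^ 2)) • w := by
  have : LinearMap.range D.toLinearMap = ℝ ∙ w := by
    apply le_antisymm
    · rintro _ ⟨X, rfl⟩
      obtain ⟨t, ht⟩ := hD X
      exact Submodule.mem_span_singleton.2 ⟨t, ht.symm⟩
    · rw [Submodule.span_singleton_le_iff_mem]
      obtain ⟨X, hX⟩ := hw
      exact ⟨X, hX⟩
  rw [transversal]
  congr 1
  simp only [this]
  rw [Submodule.starProjection_singleton]
  simp

/-- A single coordinate vector `W` serves near `y₀`: the range of `dη` is the line through the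
smooth nonvanishing `dη W`, and projection to this line is explicit. -/
theorem contDiffAt_transversal [FiniteDimensional ℝ E]
    (hE : finrank ℝ E = finrank ℝ V + 2) (hV : 3 ≤ finrank ℝ V)
    (hF : ∀ᶠ y in 𝓝 y₀, ContDiffAt ℝ ∞ F y)
    (hfr : ∀ᶠ y in 𝓝 y₀, SplitFrame (fderiv ℝ F y) (fderiv ℝ (fderiv ℝ F) y) (ξ y) (η y)) :
    ContDiffAt ℝ ∞ (fun y => transversal (fderiv ℝ η y) (ξ y)) y₀ := by
  obtain ⟨hξ, hη⟩ := contDiffAt_frame hE hV hF.self_of_nhds hfr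
  obtain ⟨l, W, hW, hl⟩ := exists_fderiv_normal_eq hE hV hF.self_of_nhds hfr
  have hw : ContDiffAt ℝ ∞ (fun y => fderiv ℝ η y W) y₀ :=
    (hη.fderiv_right (m := ∞) (by simp)).clm_apply contDiffAt_const
  have hw0 : fderiv ℝ η y₀ W ≠ 0 := fun h => by rw [h, inner_zero_left] at hW; exact hW.false
  have h1 : ContDiffAt ℝ ∞ (fun y => ξ y -
      (⟪fderiv ℝ η y W, ξ y⟫ / (‖fderiv ℝ η y W‖ ^ 2)) • fderiv ℝ η y W) y₀ :=
    hξ.sub (((hw.inner ℝ hξ).div (hw.norm_sq ℝ) (by simpa using hw0)).smul hw)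
  refine h1.congr_of_eventuallyEq ?_
  filter_upwards [hF, hfr.eventually_nhds, hw.continuousAt.eventually_ne hw0] with y h2 h3 h4
  refine transversal_eq_of_rank_one ⟨W, rfl⟩ (fun X => ?_) _
  obtain ⟨l', W', -, hl'⟩ := exists_fderiv_normal_eq hE hV h2 h3
  have h5 : l' W ≠ 0 := fun h => h4 (by rw [hl', h, zero_smul])
  refine ⟨l' X / l' W, ?_⟩
  rw [hl' X, hl' W, smul_smul, div_mul_cancel₀ _ h5]

/-- The transversal part `T` satisfies `⟪ξ, T⟫ = ⟪T, T⟫`, so it is not tangent unless it is zero. It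
is not zero: since `⟪D W, L W⟫ ≠ 0`, no nonzero vector in the range of `D` is normal, whereas `ξ`
is. This makes the ruled extension an immersion along the zero section. -/
theorem SplitFrame.transversal_ne {L D : V →L[ℝ] E} {H : V →L[ℝ] V →L[ℝ] E} {ξ η : E}
    (h : SplitFrame L H ξ η) {l : V →L[ℝ] ℝ} {W : V} (hW : ⟪D W, L W⟫ < 0)
    (hl : ∀ X, D X = l X • D W) {X : V} {t : ℝ} (h0 : L X + t • transversal D ξ = 0) :
    X = 0 ∧ t = 0 := by
  have hT : ⟪transversal D ξ, transversal D ξ⟫ = ⟪ξ, transversal D ξ⟫ := by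
    have h1 : ξ - transversal D ξ ∈ LinearMap.range D.toLinearMap := by
      rw [transversal, sub_sub_cancel]
      exact Submodule.starProjection_apply_mem _ _
    obtain ⟨Z, hZ⟩ := h1
    have h2 := inner_transversal D ξ Z
    rw [show D Z = ξ - transversal D ξ from hZ, inner_sub_right] at h2
    rw [real_inner_comm _ ξ]
    linarith
  have hT0 : transversal D ξ ≠ 0 := by
    intro h1
    rw [transversal, sub_eq_zero] at h1
    have h2 : ξ ∈ LinearMap.range D.toLinearMap := by
      rw [h1]; exact Submodule.starProjection_apply_mem _ _
    obtain ⟨Z, hZ⟩ := h2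
    have hZ' : ξ = l Z • D W := by rw [← hl]; exact hZ.symm
    have h3 := h.normal_left W
    have h4 := h.norm_left
    rw [hZ', inner_smul_left] at h3
    have h5 : l Z = 0 := by simpa using (mul_eq_zero.1 h3).resolve_right hW.ne
    rw [hZ', h5, zero_smul, inner_zero_left] at h4
    exact zero_ne_one h4
  have h1 : t = 0 := by
    have h2 := congrArg (fun v => ⟪ξ, v⟫) h0
    simp only [inner_add_right, inner_smul_right, h.normal_left, inner_zero_right, zero_add,
      ← hT] at h2
    exact (mul_eq_zero.1 h2).resolve_right (inner_self_ne_zero.2 hT0)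
  rw [h1, zero_smul, add_zero] at h0
  exact ⟨h.inj (by rw [h0, map_zero]), h1⟩

end

/-! ### Calculus in the preferred charts -/

section

variable {n : ℕ} {U : Type*} [TopologicalSpace U] [ChartedSpace (Euc n) U]
  {W : Type*}

/-- A function read in the preferred chart at `c`. -/
def inChart (f : U → W) (c : U) : Euc n → W := f ∘ (extChartAt (𝓡 n) c).symm

theorem inChart_apply (f : U → W) (c : U) (y : Euc n) :
    inChart f c y = f ((extChartAt (𝓡 n) c).symm y) := rfl

theorem inChart_extChartAt (f : U → W) {c x : U} (hx : x ∈ (extChartAt (𝓡 n) c).source) :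
    inChart f c (extChartAt (𝓡 n) c x) = f x := by
  rw [inChart_apply, (extChartAt (𝓡 n) c).left_inv hx]

theorem eventually_chart {c x : U} (hx : x ∈ (extChartAt (𝓡 n) c).source) {p : U → Prop}
    (hp : ∀ᶠ z in 𝓝 x, p z) :
    ∀ᶠ y in 𝓝 (extChartAt (𝓡 n) c x), y ∈ (extChartAt (𝓡 n) c).target ∧
      p ((extChartAt (𝓡 n) c).symm y) := by
  have h1 := (isOpen_extChartAt_target (I := 𝓡 n) c).mem_nhds ((extChartAt (𝓡 n) c).map_source hx)
  have h2 := continuousAt_extChartAt_symm' (I := 𝓡 n) hx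
  rw [ContinuousAt, (extChartAt (𝓡 n) c).left_inv hx] at h2
  filter_upwards [h1, h2.eventually hp] with y hy1 hy2
  exact ⟨hy1, hy2⟩

theorem eventually_of_chart {c x : U} (hx : x ∈ (extChartAt (𝓡 n) c).source) {p : Euc n → Prop}
    (hp : ∀ᶠ y in 𝓝 (extChartAt (𝓡 n) c x), p y) :
    ∀ᶠ z in 𝓝 x, z ∈ (extChartAt (𝓡 n) c).source ∧ p (extChartAt (𝓡 n) c z) := by
  have h1 := (isOpen_extChartAt_source (I := 𝓡 n) c).mem_nhds hx
  filter_upwards [h1, (continuousAt_extChartAt' (I := 𝓡 n) hx).eventually hp] with z hz1 hz2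
  exact ⟨hz1, hz2⟩

/-- The change of coordinates between two preferred charts. -/
def coordChange (a b : U) : Euc n → Euc n := extChartAt (𝓡 n) b ∘ (extChartAt (𝓡 n) a).symm

theorem coordChange_apply {a b x : U} (ha : x ∈ (extChartAt (𝓡 n) a).source) :
    coordChange a b (extChartAt (𝓡 n) a x) = extChartAt (𝓡 n) b x := by
  rw [coordChange, Function.comp_apply, (extChartAt (𝓡 n) a).left_inv ha]

theorem inChart_eventuallyEq (f : U → W) {a b x : U} (ha : x ∈ (extChartAt (𝓡 n) a).source)
    (hb : x ∈ (extChartAt (𝓡 n) b).source) :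
    inChart f a =ᶠ[𝓝 (extChartAt (𝓡 n) a x)] inChart f b ∘ coordChange a b := by
  filter_upwards [eventually_chart ha ((isOpen_extChartAt_source (I := 𝓡 n) b).mem_nhds hb)]
    with y hy
  rw [Function.comp_apply, coordChange, Function.comp_apply, inChart_extChartAt f hy.2]
  rfl

theorem coordChange_comp_eventuallyEq {a b x : U} (ha : x ∈ (extChartAt (𝓡 n) a).source)
    (hb : x ∈ (extChartAt (𝓡 n) b).source) :
    coordChange b a ∘ coordChange a b =ᶠ[𝓝 (extChartAt (𝓡 n) a x)] id := by
  filter_upwards [eventually_chart ha ((isOpen_extChartAt_source (I := 𝓡 n) b).mem_nhds hb)]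
    with y hy
  simp only [Function.comp_apply, coordChange, id]
  rw [(extChartAt (𝓡 n) b).left_inv hy.2, (extChartAt (𝓡 n) a).right_inv hy.1]

variable [IsManifold (𝓡 n) ∞ U] [NormedAddCommGroup W] [NormedSpace ℝ W]

theorem contDiffAt_coordChange {a b x : U} (ha : x ∈ (extChartAt (𝓡 n) a).source)
    (hb : x ∈ (extChartAt (𝓡 n) b).source) :
    ContDiffAt ℝ ∞ (coordChange a b) (extChartAt (𝓡 n) a x) := by
  have h := contDiffWithinAt_ext_coord_change (I := 𝓡 n) (n := ∞) b a
    (y := extChartAt (𝓡 n) a x) (by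
      rw [PartialEquiv.trans_source]
      refine ⟨(extChartAt (𝓡 n) a).map_source ha, ?_⟩
      rw [Set.mem_preimage, (extChartAt (𝓡 n) a).left_inv ha]
      exact hb)
  rwa [ModelWithCorners.range_eq_univ, contDiffWithinAt_univ] at h

theorem contDiffAt_inChart {f : U → W} {a b x : U} (ha : x ∈ (extChartAt (𝓡 n) a).source)
    (hb : x ∈ (extChartAt (𝓡 n) b).source)
    (hf : ContDiffAt ℝ ∞ (inChart f b) (extChartAt (𝓡 n) b x)) :
    ContDiffAt ℝ ∞ (inChart f a) (extChartAt (𝓡 n) a x) := by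
  rw [← coordChange_apply (b := b) ha] at hf
  exact (hf.comp _ (contDiffAt_coordChange ha hb)).congr_of_eventuallyEq
    (inChart_eventuallyEq f ha hb)

/-- The differential of a change of coordinates. -/
def coordEquiv {a b x : U} (ha : x ∈ (extChartAt (𝓡 n) a).source)
    (hb : x ∈ (extChartAt (𝓡 n) b).source) : Euc n ≃L[ℝ] Euc n :=
  have key : ∀ {a b : U} (_ : x ∈ (extChartAt (𝓡 n) a).source)
      (_ : x ∈ (extChartAt (𝓡 n) b).source) (X : Euc n),
      fderiv ℝ (coordChange b a) (extChartAt (𝓡 n) b x)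
        (fderiv ℝ (coordChange a b) (extChartAt (𝓡 n) a x) X) = X := fun {a b} ha hb X => by
    have h1 := ((contDiffAt_coordChange ha hb).differentiableAt (by simp)).hasFDerivAt
    have h2 := ((contDiffAt_coordChange hb ha).differentiableAt (by simp)).hasFDerivAt
    rw [← coordChange_apply (b := b) ha] at h2
    have h3 := (h2.comp _ h1).congr_of_eventuallyEq (coordChange_comp_eventuallyEq ha hb).symm
    have h4 := congrArg (fun l : Euc n →L[ℝ] Euc n => l X) (h3.unique (hasFDerivAt_id _))
    rw [coordChange_apply (b := b) ha] at h4
    exact h4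
  ContinuousLinearEquiv.equivOfInverse (fderiv ℝ (coordChange a b) (extChartAt (𝓡 n) a x))
    (fderiv ℝ (coordChange b a) (extChartAt (𝓡 n) b x)) (key ha hb) (key hb ha)

theorem hasFDerivAt_coordChange {a b x : U} (ha : x ∈ (extChartAt (𝓡 n) a).source)
    (hb : x ∈ (extChartAt (𝓡 n) b).source) :
    HasFDerivAt (coordChange a b) (coordEquiv ha hb : Euc n →L[ℝ] Euc n)
      (extChartAt (𝓡 n) a x) :=
  ((contDiffAt_coordChange ha hb).differentiableAt (by simp)).hasFDerivAt

theorem HasFDerivAt.inChart_change {f : U → W} {D : Euc n →L[ℝ] W} {a b x : U}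
    (ha : x ∈ (extChartAt (𝓡 n) a).source) (hb : x ∈ (extChartAt (𝓡 n) b).source)
    (hf : HasFDerivAt (inChart f b) D (extChartAt (𝓡 n) b x)) :
    HasFDerivAt (inChart f a) (D ∘L (coordEquiv ha hb : Euc n →L[ℝ] Euc n))
      (extChartAt (𝓡 n) a x) := by
  rw [← coordChange_apply (b := b) ha] at hf
  exact (hf.comp _ (hasFDerivAt_coordChange ha hb)).congr_of_eventuallyEq
    (inChart_eventuallyEq f ha hb)

theorem fderiv_inChart_change {f : U → W} {a b x : U}
    (ha : x ∈ (extChartAt (𝓡 n) a).source) (hb : x ∈ (extChartAt (𝓡 n) b).source)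
    (hf : ContDiffAt ℝ ∞ (inChart f b) (extChartAt (𝓡 n) b x)) :
    fderiv ℝ (inChart f a) (extChartAt (𝓡 n) a x) =
      fderiv ℝ (inChart f b) (extChartAt (𝓡 n) b x) ∘L (coordEquiv ha hb : Euc n →L[ℝ] Euc n) :=
  (HasFDerivAt.inChart_change ha hb (hf.differentiableAt (by simp)).hasFDerivAt).fderiv

/-- Total differential equations `dg = B df` may be verified in any chart. -/
theorem hasFDerivAt_comp_change {W' : Type*} [NormedAddCommGroup W'] [NormedSpace ℝ W']
    {f : U → W} {g : U → W'} {B : W →L[ℝ] W'} {a b x : U}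
    (ha : x ∈ (extChartAt (𝓡 n) a).source) (hb : x ∈ (extChartAt (𝓡 n) b).source)
    (hf : ContDiffAt ℝ ∞ (inChart f b) (extChartAt (𝓡 n) b x))
    (hg : HasFDerivAt (inChart g b) (B ∘L fderiv ℝ (inChart f b) (extChartAt (𝓡 n) b x))
      (extChartAt (𝓡 n) b x)) :
    HasFDerivAt (inChart g a) (B ∘L fderiv ℝ (inChart f a) (extChartAt (𝓡 n) a x))
      (extChartAt (𝓡 n) a x) := by
  rw [fderiv_inChart_change ha hb hf]
  exact HasFDerivAt.inChart_change ha hb hg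

/-- Smooth functions on a manifold, in terms of the preferred charts. -/
def SmoothInCharts (n : ℕ) {U : Type*} [TopologicalSpace U] [ChartedSpace (Euc n) U]
    {W : Type*} [NormedAddCommGroup W] [NormedSpace ℝ W] (f : U → W) : Prop :=
  ∀ c x : U, x ∈ (extChartAt (𝓡 n) c).source →
    ContDiffAt ℝ ∞ (inChart f c) (extChartAt (𝓡 n) c x)

theorem smoothInCharts_of {f : U → W}
    (h : ∀ x : U, ContDiffAt ℝ ∞ (inChart f x) (extChartAt (𝓡 n) x x)) : SmoothInCharts n f :=
  fun _ x hx => contDiffAt_inChart hx (mem_extChartAt_source x) (h x)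

theorem smoothInCharts_of_contMDiff {f : U → W} (h : ContMDiff (𝓡 n) 𝓘(ℝ, W) ∞ f) :
    SmoothInCharts n f := smoothInCharts_of fun x => by
  have := (contMDiffAt_iff.1 (h x)).2
  rw [ModelWithCorners.range_eq_univ, contDiffWithinAt_univ] at this
  exact this

omit [IsManifold (𝓡 n) ∞ U] in
theorem SmoothInCharts.continuous {f : U → W} (h : SmoothInCharts n f) : Continuous f := by
  rw [continuous_iff_continuousAt]
  intro x
  have h1 := (h x x (mem_extChartAt_source x)).continuousAt.comp
    (continuousAt_extChartAt (I := 𝓡 n) x)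
  refine h1.congr ?_
  filter_upwards [extChartAt_source_mem_nhds (I := 𝓡 n) x] with z hz
  exact inChart_extChartAt f hz

omit [IsManifold (𝓡 n) ∞ U] in
theorem SmoothInCharts.contMDiff {f : U → W} (h : SmoothInCharts n f) :
    ContMDiff (𝓡 n) 𝓘(ℝ, W) ∞ f := fun x => by
  rw [contMDiffAt_iff]
  refine ⟨h.continuous.continuousAt, ?_⟩
  rw [ModelWithCorners.range_eq_univ, contDiffWithinAt_univ]
  exact h x x (mem_extChartAt_source x)

omit [IsManifold (𝓡 n) ∞ U] in
theorem SmoothInCharts.contDiffOn {f : U → W} (h : SmoothInCharts n f) (c : U) :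
    ContDiffOn ℝ ∞ (inChart f c) (extChartAt (𝓡 n) c).target := fun y hy => by
  have := h c _ ((extChartAt (𝓡 n) c).map_target hy)
  rw [(extChartAt (𝓡 n) c).right_inv hy] at this
  exact this.contDiffWithinAt

omit [IsManifold (𝓡 n) ∞ U] in
theorem SmoothInCharts.contDiffAt {f : U → W} (h : SmoothInCharts n f) {c : U} {y : Euc n}
    (hy : y ∈ (extChartAt (𝓡 n) c).target) : ContDiffAt ℝ ∞ (inChart f c) y :=
  (h.contDiffOn c).contDiffAt ((isOpen_extChartAt_target (I := 𝓡 n) c).mem_nhds hy)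

omit [IsManifold (𝓡 n) ∞ U] in
theorem differential_eq_fderiv {m : ℕ} {f : U → Euc m} (h : ContMDiff (𝓡 n) (𝓡 m) ∞ f) (p : U) :
    differential (d := n) f p = fderiv ℝ (inChart f p) (extChartAt (𝓡 n) p p) := by
  rw [differential, MDifferentiableAt.mfderiv ((h p).mdifferentiableAt (by simp)),
    ModelWithCorners.range_eq_univ, fderivWithin_univ]
  rfl

end

/-! ### Global solutions of total differential equations -/

/-- A local condition on group valued functions, whose local solutions exist and are unique up to
constant left factors, has a global solution over a space with simply connected components. -/
theorem exists_global_solution {X G : Type*} [TopologicalSpace X] [LocallyPathConnectedSpace X]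
    [Group G] (hX : ∀ x : X, SimplyConnectedSpace (connectedComponent x))
    (P : (X → G) → X → Prop) (hloc : ∀ i, ∃ f, ∀ᶠ x in 𝓝 i, P f x)
    (htrans : ∀ f₁ f₂ x, (∀ᶠ z in 𝓝 x, P f₁ z) → (∀ᶠ z in 𝓝 x, P f₂ z) →
      ∀ᶠ z in 𝓝 x, f₁ z * (f₂ z)⁻¹ = f₁ x * (f₂ x)⁻¹)
    (hinv : ∀ (q : G) (f Φ : X → G) (x : X), P f x → (∀ᶠ z in 𝓝 x, Φ z = q * f z) → P Φ x) :
    ∃ Φ, ∀ x, P Φ x := by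
  choose f hf using hloc
  choose V hV hVo hVm using fun i => eventually_nhds_iff.1 (hf i)
  obtain ⟨Φ, hΦ⟩ := exists_global_of_local hX V hVo hVm f fun i j x hi hj =>
    htrans _ _ x (Filter.mem_of_superset ((hVo i).mem_nhds hi) (hV i))
      (Filter.mem_of_superset ((hVo j).mem_nhds hj) (hV j))
  refine ⟨Φ, fun x => ?_⟩
  obtain ⟨q, hq⟩ := hΦ x
  exact hinv q (f x) Φ x ((hf x).self_of_nhds) hq

section

variable {V E : Type*} [NormedAddCommGroup V] [NormedSpace ℝ V] [NormedAddCommGroup E]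
  [InnerProductSpace ℝ E]

theorem eventually_eq_of_hasFDerivAt_zero {W : Type*} [NormedAddCommGroup W] [NormedSpace ℝ W]
    {f : V → W} {y₀ : V} (h : ∀ᶠ y in 𝓝 y₀, HasFDerivAt f (0 : V →L[ℝ] W) y) :
    ∀ᶠ y in 𝓝 y₀, f y = f y₀ := by
  obtain ⟨r, hr, hball⟩ := Metric.eventually_nhds_iff_ball.1 h
  filter_upwards [Metric.ball_mem_nhds y₀ hr] with y hy
  exact (convex_ball y₀ r).is_const_of_fderivWithin_eq_zero (𝕜 := ℝ)
    (fun z hz => (hball z hz).differentiableAt.differentiableWithinAt)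
    (fun z hz => by rw [fderivWithin_of_isOpen Metric.isOpen_ball hz, (hball z hz).fderiv])
    hy (Metric.mem_ball_self hr)

/-- With `ω = η ∧ D` the derivative of `A₁ A₂*` is `A₁ (ω + ω*) A₂*`, which vanishes because `ω` is
skew adjoint. -/
theorem frame_transition [CompleteSpace E] {A₁ A₂ : V → unitary (E →L[ℝ] E)} {η : V → E}
    {D : V → V →L[ℝ] E} {y₀ : V}
    (h₁ : ∀ᶠ y in 𝓝 y₀, HasFDerivAt (fun y => (A₁ y : E →L[ℝ] E))
      (frameForm (A₁ y) (η y) ∘L D y) y)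
    (h₂ : ∀ᶠ y in 𝓝 y₀, HasFDerivAt (fun y => (A₂ y : E →L[ℝ] E))
      (frameForm (A₂ y) (η y) ∘L D y) y) :
    ∀ᶠ y in 𝓝 y₀, A₁ y * (A₂ y)⁻¹ = A₁ y₀ * (A₂ y₀)⁻¹ := by
  have h : ∀ᶠ y in 𝓝 y₀, HasFDerivAt (fun y => (A₁ y : E →L[ℝ] E) * star (A₂ y : E →L[ℝ] E))
      (0 : V →L[ℝ] (E →L[ℝ] E)) y := by
    filter_upwards [h₁, h₂] with y hy₁ hy₂
    refine (hy₁.mul' hy₂.star).congr_fderiv ?_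
    refine ContinuousLinearMap.ext fun X => ?_
    have : (A₁ y : E →L[ℝ] E) * star ((A₂ y : E →L[ℝ] E) * wedge E (η y) (D y X)) +
        (A₁ y : E →L[ℝ] E) * wedge E (η y) (D y X) * star (A₂ y : E →L[ℝ] E) = 0 := by
      rw [star_mul, star_wedge]
      noncomm_ring
    exact this
  filter_upwards [eventually_eq_of_hasFDerivAt_zero h] with y hy
  exact Subtype.ext hy

end

/-! ### Split immersions and their global orthogonal frame -/

section

variable {n : ℕ} {U : Type*} [TopologicalSpace U] [ChartedSpace (Euc n) U]
  {E : Type*} [NormedAddCommGroup E] [InnerProductSpace ℝ E]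

/-- An immersion of codimension two with split second fundamental form and frame `ξ`, `η`. -/
structure SplitImmersion (n : ℕ) {U : Type*} [TopologicalSpace U] [ChartedSpace (Euc n) U]
    {E : Type*} [NormedAddCommGroup E] [InnerProductSpace ℝ E] (F ξ η : U → E) : Prop where
  smooth : SmoothInCharts n F
  frame : ∀ c : U, ∀ y ∈ (extChartAt (𝓡 n) c).target,
    SplitFrame (fderiv ℝ (inChart F c) y) (fderiv ℝ (fderiv ℝ (inChart F c)) y)
      (inChart ξ c y) (inChart η c y)

namespace SplitImmersion

variable {F ξ η : U → E}

theorem eventually_frame (h : SplitImmersion n F ξ η) {c : U} {y : Euc n}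
    (hy : y ∈ (extChartAt (𝓡 n) c).target) : ∀ᶠ y in 𝓝 y,
    SplitFrame (fderiv ℝ (inChart F c) y) (fderiv ℝ (fderiv ℝ (inChart F c)) y)
      (inChart ξ c y) (inChart η c y) :=
  Filter.mem_of_superset ((isOpen_extChartAt_target (I := 𝓡 n) c).mem_nhds hy) (h.frame c)

variable [IsManifold (𝓡 n) ∞ U] [FiniteDimensional ℝ E]

theorem smooth_frame (h : SplitImmersion n F ξ η) (hn : 3 ≤ n) (hE : finrank ℝ E = n + 2) :
    SmoothInCharts n ξ ∧ SmoothInCharts n η := by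
  have key := fun x : U => contDiffAt_frame (V := Euc n) (by simpa using hE) (by simpa using hn)
    (h.smooth x x (mem_extChartAt_source x)) (h.eventually_frame (mem_extChartAt_target x))
  exact ⟨smoothInCharts_of fun x => (key x).1, smoothInCharts_of fun x => (key x).2⟩

omit [IsManifold (𝓡 n) ∞ U] in
theorem exists_fderiv_normal (h : SplitImmersion n F ξ η) (hn : 3 ≤ n) (hE : finrank ℝ E = n + 2)
    {c : U} {y : Euc n} (hy : y ∈ (extChartAt (𝓡 n) c).target) :
    ∃ (l : Euc n →L[ℝ] ℝ) (W : Euc n),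
      ⟪fderiv ℝ (inChart η c) y W, fderiv ℝ (inChart F c) y W⟫ < 0 ∧
      ∀ X, fderiv ℝ (inChart η c) y X = l X • fderiv ℝ (inChart η c) y W :=
  exists_fderiv_normal_eq (V := Euc n) (by simpa using hE) (by simpa using hn)
    (h.smooth.contDiffAt hy) (h.eventually_frame hy)

omit [IsManifold (𝓡 n) ∞ U] [FiniteDimensional ℝ E] in
theorem inner_fderiv_self (h : SplitImmersion n F ξ η) (hη : SmoothInCharts n η)
    {c : U} {y : Euc n} (hy : y ∈ (extChartAt (𝓡 n) c).target) (X : Euc n) :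
    ⟪inChart η c y, fderiv ℝ (inChart η c) y X⟫ = 0 :=
  inner_fderiv_unit ((hη.contDiffAt hy).differentiableAt (by simp))
    ((h.eventually_frame hy).mono fun _ hy => hy.norm_right) X

variable [CompleteSpace E]

/-- The parallel orthogonal frames exist globally. -/
theorem exists_global_frame (h : SplitImmersion n F ξ η) (hn : 3 ≤ n) (hE : finrank ℝ E = n + 2)
    (hU : ∀ x : U, SimplyConnectedSpace (connectedComponent x)) :
    ∃ Φ : U → unitary (E →L[ℝ] E), ∀ x : U,
      HasFDerivAt (inChart (fun z => (Φ z : E →L[ℝ] E)) x)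
        (frameForm (Φ x) (η x) ∘L fderiv ℝ (inChart η x) (extChartAt (𝓡 n) x x))
        (extChartAt (𝓡 n) x x) := by
  have : LocallyPathConnectedSpace U := ChartedSpace.locallyPathConnectedSpace (Euc n) U
  have hη := (h.smooth_frame hn hE).2
  -- The equation at `x` is posed in the preferred chart at `x`. Having the form `dΦ = B dη`, it may
  -- be checked in any chart, so a solution in one chart serves all nearby points.
  refine exists_global_solution hU _ (fun i => ?_) (fun f₁ f₂ x h₁ h₂ => ?_)
    (fun q f Φ x hf hq => ?_)
  · have hy := mem_extChartAt_target (I := 𝓡 n) i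
    obtain ⟨Φ, hΦ⟩ := exists_local_frame ((hη i i (mem_extChartAt_source i)).of_le two_le_infty)
      (by
        filter_upwards [(isOpen_extChartAt_target (I := 𝓡 n) i).mem_nhds hy] with y hy
        obtain ⟨l, W, -, hl⟩ := h.exists_fderiv_normal hn hE hy
        exact ⟨l, _, hl⟩)
      (by
        obtain ⟨l, W, hW, -⟩ := h.exists_fderiv_normal hn hE hy
        intro h0
        rw [h0] at hW
        simp at hW)
    refine ⟨Φ ∘ extChartAt (𝓡 n) i, ?_⟩
    filter_upwards [eventually_of_chart (mem_extChartAt_source i) hΦ.eventually_nhds]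
      with x ⟨hx, hΦx⟩
    refine hasFDerivAt_comp_change (mem_extChartAt_source x) hx (hη i x hx) ?_
    have h1 := hΦx.self_of_nhds
    rw [inChart_extChartAt η hx] at h1
    refine h1.congr_of_eventuallyEq ?_
    filter_upwards [(isOpen_extChartAt_target (I := 𝓡 n) i).mem_nhds
      ((extChartAt (𝓡 n) i).map_source hx)] with y hy
    rw [inChart_apply, Function.comp_apply, (extChartAt (𝓡 n) i).right_inv hy]
  · have hx := mem_extChartAt_source (I := 𝓡 n) x
    have key : ∀ f : U → unitary (E →L[ℝ] E), (∀ᶠ z in 𝓝 x,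
        HasFDerivAt (inChart (fun w => (f w : E →L[ℝ] E)) z)
        (frameForm (f z) (η z) ∘L fderiv ℝ (inChart η z) (extChartAt (𝓡 n) z z))
        (extChartAt (𝓡 n) z z)) → ∀ᶠ y in 𝓝 (extChartAt (𝓡 n) x x),
        HasFDerivAt (fun y => (f ((extChartAt (𝓡 n) x).symm y) : E →L[ℝ] E))
        (frameForm (f ((extChartAt (𝓡 n) x).symm y)) (inChart η x y) ∘L
          fderiv ℝ (inChart η x) y) y := by
      intro f hf
      filter_upwards [eventually_chart hx hf] with y ⟨hy, hfy⟩
      have hys := (extChartAt (𝓡 n) x).map_target hy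
      have := hasFDerivAt_comp_change hys (mem_extChartAt_source _)
        (hη _ _ (mem_extChartAt_source _)) hfy
      rw [(extChartAt (𝓡 n) x).right_inv hy] at this
      exact this
    have h3 := frame_transition (key f₁ h₁) (key f₂ h₂)
    filter_upwards [eventually_of_chart hx h3] with z ⟨hz, hz'⟩
    rwa [(extChartAt (𝓡 n) x).left_inv hz, (extChartAt (𝓡 n) x).left_inv hx] at hz'
  · have hx := mem_extChartAt_source (I := 𝓡 n) x
    have h1 := (ContinuousLinearMap.mul ℝ (E →L[ℝ] E) (q : E →L[ℝ] E)).hasFDerivAt.comp _ hf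
    refine (h1.congr_of_eventuallyEq ?_).congr_fderiv ?_
    · filter_upwards [eventually_chart hx hq] with y ⟨hy, hqy⟩
      rw [inChart_apply, hqy]
      rfl
    · rw [hq.self_of_nhds]
      refine ContinuousLinearMap.ext fun X => ?_
      exact (mul_assoc (q : E →L[ℝ] E) (f x : E →L[ℝ] E) _).symm

end SplitImmersion

end

/-! ### Development into Euclidean space of one dimension less -/

section

variable {E W : Type*} [NormedAddCommGroup E] [InnerProductSpace ℝ E]
  [NormedAddCommGroup W] [InnerProductSpace ℝ W]

/-- A linear map that forgets the direction `w` and preserves the geometry of its complement. -/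
theorem exists_isometric_along [FiniteDimensional ℝ E] [FiniteDimensional ℝ W]
    (hEW : finrank ℝ E = finrank ℝ W + 1) {w : E} (hw : ⟪w, w⟫ = 1) :
    ∃ R : E →L[ℝ] W, ∀ u v : E, ⟪R u, R v⟫ = ⟪u, v⟫ - ⟪w, u⟫ * ⟪w, v⟫ := by
  have hw1 : ‖w‖ = 1 := by
    rw [real_inner_self_eq_norm_sq] at hw
    exact (pow_eq_one_iff_of_nonneg (norm_nonneg w) two_ne_zero).1 hw
  have hw0 : w ≠ 0 := by
    rintro rfl
    simp at hw1
  have hdim : finrank ℝ ((ℝ ∙ w)ᗮ : Submodule ℝ E) = finrank ℝ W := by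
    have h1 := (ℝ ∙ w).finrank_add_finrank_orthogonal
    rw [finrank_span_singleton hw0] at h1
    omega
  let e : ((ℝ ∙ w)ᗮ : Submodule ℝ E) ≃ₗᵢ[ℝ] W :=
    (stdOrthonormalBasis ℝ _).equiv (stdOrthonormalBasis ℝ W) (finCongr hdim)
  refine ⟨(e : ((ℝ ∙ w)ᗮ : Submodule ℝ E) →L[ℝ] W) ∘L (ℝ ∙ w)ᗮ.orthogonalProjectionOnto,
    fun u v => ?_⟩
  have h2 : ∀ v : E, (((ℝ ∙ w)ᗮ.orthogonalProjectionOnto v : (ℝ ∙ w)ᗮ) : E) = v - ⟪w, v⟫ • w := by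
    intro v
    have := (ℝ ∙ w).starProjection_add_starProjection_orthogonal v
    rw [Submodule.starProjection_unit_singleton ℝ hw1] at this
    exact eq_sub_of_add_eq' this
  calc ⟪e ((ℝ ∙ w)ᗮ.orthogonalProjectionOnto u), e ((ℝ ∙ w)ᗮ.orthogonalProjectionOnto v)⟫
      = ⟪(ℝ ∙ w)ᗮ.orthogonalProjectionOnto u, (ℝ ∙ w)ᗮ.orthogonalProjectionOnto v⟫ :=
        e.inner_map_map _ _
    _ = ⟪u - ⟪w, u⟫ • w, v - ⟪w, v⟫ • w⟫ := by
        rw [Submodule.coe_inner, h2, h2]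
    _ = _ := by
        simp only [inner_sub_left, inner_sub_right, real_inner_smul_left, real_inner_smul_right, hw,
          real_inner_comm u w]
        ring

/-- The bilinear form `(v, u) ↦ -⟪e, u⟫ Q v`. -/
def devForm (e : E) (Q : E →L[ℝ] W) : E →L[ℝ] (E →L[ℝ] W) :=
  -- An equation `dΨ = devForm η Ψ (dη)` says that `Ψ` is parallel on the complement of `η`: its
  -- derivative vanishes on vectors orthogonal to `η`.
  -(ContinuousLinearMap.smulRightL ℝ E W (innerBilin E e) ∘L Q)

theorem devForm_apply (e : E) (Q : E →L[ℝ] W) (v u : E) :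
    devForm e Q v u = -(⟪e, u⟫ • Q v) := by
  simp [devForm, innerBilin_apply]

/-- Bootstrapping: the right hand side involves `Ψ` without derivatives, so `Ψ` gains one order of
differentiability at each step. -/
theorem contDiffOn_of_devForm [FiniteDimensional ℝ E] {V : Type*} [NormedAddCommGroup V]
    [NormedSpace ℝ V] [FiniteDimensional ℝ V] {Ω : Set V}
    (hΩ : IsOpen Ω) {η : V → E} {D : V → V →L[ℝ] E} {Ψ : V → E →L[ℝ] W}
    (hη : ContDiffOn ℝ ∞ η Ω) (hD : ContDiffOn ℝ ∞ D Ω)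
    (hΨ : ∀ y ∈ Ω, HasFDerivAt Ψ (devForm (η y) (Ψ y) ∘L D y) y) : ContDiffOn ℝ ∞ Ψ Ω := by
  rw [contDiffOn_infty]
  intro k
  induction k with
  | zero => exact contDiffOn_zero.2 fun y hy => (hΨ y hy).continuousAt.continuousWithinAt
  | succ k ih =>
    rw [Nat.cast_succ, contDiffOn_succ_iff_fderiv_of_isOpen hΩ]
    refine ⟨fun y hy => (hΨ y hy).differentiableAt.differentiableWithinAt, by simp, ?_⟩
    have hk : (k : ℕ∞ω) ≤ ∞ := by exact_mod_cast le_top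
    refine ContDiffOn.congr (contDiffOn_clm_apply.2 fun X => contDiffOn_clm_apply.2 fun u => ?_)
      fun y hy => (hΨ y hy).fderiv
    have h1 : ContDiffOn ℝ k (fun y => -(⟪η y, u⟫ • Ψ y (D y X))) Ω :=
      (((hη.of_le hk).inner ℝ contDiffOn_const).smul
        (ih.clm_apply ((hD.of_le hk).clm_apply contDiffOn_const))).neg
    exact h1.congr fun y _ => devForm_apply _ _ _ _

end

section

variable {n : ℕ} {U : Type*} [TopologicalSpace U] [ChartedSpace (Euc n) U]
  [IsManifold (𝓡 n) ∞ U]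

theorem SmoothInCharts.hasFDerivAt_of_comp {W W' : Type*} [NormedAddCommGroup W]
    [NormedSpace ℝ W] [NormedAddCommGroup W'] [NormedSpace ℝ W'] {f : U → W} {g : U → W'}
    (hf : SmoothInCharts n f) {B : U → W →L[ℝ] W'} {c x : U}
    (hg : HasFDerivAt (inChart g x) (B x ∘L fderiv ℝ (inChart f x) (extChartAt (𝓡 n) x x))
      (extChartAt (𝓡 n) x x)) (hx : x ∈ (extChartAt (𝓡 n) c).source) :
    HasFDerivAt (inChart g c) (B x ∘L fderiv ℝ (inChart f c) (extChartAt (𝓡 n) c x))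
      (extChartAt (𝓡 n) c x) :=
  hasFDerivAt_comp_change hx (mem_extChartAt_source x) (hf x x (mem_extChartAt_source x)) hg

theorem SmoothInCharts.hasFDerivAt_of_comp_target {W W' : Type*} [NormedAddCommGroup W]
    [NormedSpace ℝ W] [NormedAddCommGroup W'] [NormedSpace ℝ W'] {f : U → W} {g : U → W'}
    (hf : SmoothInCharts n f) {B : U → W →L[ℝ] W'} {c : U} {y : Euc n}
    (hg : ∀ x, HasFDerivAt (inChart g x) (B x ∘L fderiv ℝ (inChart f x) (extChartAt (𝓡 n) x x))
      (extChartAt (𝓡 n) x x)) (hy : y ∈ (extChartAt (𝓡 n) c).target) :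
    HasFDerivAt (inChart g c) (inChart B c y ∘L fderiv ℝ (inChart f c) y) y := by
  have := hf.hasFDerivAt_of_comp (hg _) ((extChartAt (𝓡 n) c).map_target hy)
  rwa [(extChartAt (𝓡 n) c).right_inv hy] at this

variable {E W : Type*} [NormedAddCommGroup E] [InnerProductSpace ℝ E]
  [NormedAddCommGroup W] [InnerProductSpace ℝ W] {F ξ η : U → E}

/-- Parallel identifications of the complement of `η` with a fixed space. -/
structure Development (n : ℕ) {U : Type*} [TopologicalSpace U] [ChartedSpace (Euc n) U]
    {E W : Type*} [NormedAddCommGroup E] [InnerProductSpace ℝ E]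
    [NormedAddCommGroup W] [InnerProductSpace ℝ W] (η : U → E) (Ψ : U → E →L[ℝ] W) : Prop where
  smooth : SmoothInCharts n Ψ
  inner_map : ∀ x u v, ⟪Ψ x u, Ψ x v⟫ = ⟪u, v⟫ - ⟪η x, u⟫ * ⟪η x, v⟫
  deriv : ∀ (c : U) (y : Euc n), y ∈ (extChartAt (𝓡 n) c).target → HasFDerivAt (inChart Ψ c)
    (devForm (inChart η c y) (inChart Ψ c y) ∘L fderiv ℝ (inChart η c) y) y

theorem SplitImmersion.exists_development [FiniteDimensional ℝ E] [CompleteSpace E]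
    [FiniteDimensional ℝ W] (h : SplitImmersion n F ξ η) (hn : 3 ≤ n)
    (hE : finrank ℝ E = n + 2) (hW : finrank ℝ W = n + 1)
    (hU : ∀ x : U, SimplyConnectedSpace (connectedComponent x)) :
    ∃ Ψ : U → E →L[ℝ] W, Development n η Ψ := by
  have hη := (h.smooth_frame hn hE).2
  obtain ⟨Φ, hΦ⟩ := h.exists_global_frame hn hE hU
  let Φ' : U → E →L[ℝ] E := fun z => Φ z
  have hinner : ∀ x u v, ⟪Φ' x u, Φ' x v⟫ = ⟪u, v⟫ := fun x u v => by
    rw [← ContinuousLinearMap.adjoint_inner_right, ← ContinuousLinearMap.star_eq_adjoint,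
      ← mul_apply_eq_comp, Unitary.coe_star_mul_self]
    rfl
  have hη1 : ∀ x, ⟪η x, η x⟫ = 1 := fun x => by
    have := (h.frame x _ (mem_extChartAt_target x)).norm_right
    rwa [inChart_extChartAt η (mem_extChartAt_source x)] at this
  -- Indeed `d(Φ η) = Φ dη + Φ (η ∧ dη) η = Φ dη - Φ dη = 0`.
  have hconst : ∀ x, ∀ᶠ z in 𝓝 x, Φ' z (η z) = Φ' x (η x) := by
    intro x
    have hx := mem_extChartAt_source (I := 𝓡 n) x
    have h0 : ∀ᶠ y in 𝓝 (extChartAt (𝓡 n) x x),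
        HasFDerivAt (fun y => inChart Φ' x y (inChart η x y)) (0 : Euc n →L[ℝ] E) y := by
      filter_upwards [(isOpen_extChartAt_target (I := 𝓡 n) x).mem_nhds
        (mem_extChartAt_target x)] with y hy
      have h1 : HasFDerivAt (inChart Φ' x) _ y :=
        hη.hasFDerivAt_of_comp_target (B := fun z => frameForm (Φ' z) (η z)) hΦ hy
      have h2 := ((hη.contDiffAt hy).differentiableAt (by simp)).hasFDerivAt
      refine (h1.clm_apply h2).congr_fderiv (ContinuousLinearMap.ext fun X => ?_)
      have h3 := h.inner_fderiv_self hη hy X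
      have h4 : ⟪inChart η x y, inChart η x y⟫ = 1 := hη1 _
      have h5 : inChart Φ' x y (fderiv ℝ (inChart η x) y X) + inChart Φ' x y
          (wedge E (inChart η x y) (fderiv ℝ (inChart η x) y X) (inChart η x y)) = 0 := by
        rw [wedge_apply, real_inner_comm, h3, h4]
        simp
      exact h5
    filter_upwards [eventually_of_chart hx (eventually_eq_of_hasFDerivAt_zero h0)] with z ⟨hz, hz'⟩
    rwa [inChart_extChartAt _ hz, inChart_extChartAt _ hz, inChart_extChartAt _ hx,
      inChart_extChartAt _ hx] at hz'
  -- `R` depends on `w` alone. For the locally constant `w = Φ η` it is locally constant too, so the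
  -- derivative of `R Φ` is `R dΦ`.
  choose R hR using fun (w : E) (hw : ⟪w, w⟫ = 1) =>
    exists_isometric_along (W := W) (by omega : finrank ℝ E = finrank ℝ W + 1) hw
  have hw : ∀ x, ⟪Φ' x (η x), Φ' x (η x)⟫ = 1 := fun x => (hinner _ _ _).trans (hη1 x)
  let Ψ : U → E →L[ℝ] W := fun x => R (Φ' x (η x)) (hw x) ∘L Φ' x
  have hderiv : ∀ x, HasFDerivAt (inChart Ψ x)
      (devForm (η x) (Ψ x) ∘L fderiv ℝ (inChart η x) (extChartAt (𝓡 n) x x))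
      (extChartAt (𝓡 n) x x) := by
    intro x
    have hx := mem_extChartAt_source (I := 𝓡 n) x
    have h1 := (ContinuousLinearMap.compL ℝ E E W (R _ (hw x))).hasFDerivAt.comp _ (hΦ x)
    refine (h1.congr_of_eventuallyEq ?_).congr_fderiv ?_
    · filter_upwards [eventually_chart hx (hconst x)] with y ⟨hy, hqy⟩
      have : ∀ (w w' : E) (hw : ⟪w, w⟫ = 1) (hw' : ⟪w', w'⟫ = 1), w = w' → R w hw = R w' hw' := by
        rintro w _ _ _ rfl
        rfl
      rw [inChart_apply]
      exact congrArg (· ∘L Φ' ((extChartAt (𝓡 n) x).symm y)) (this _ _ (hw _) (hw x) hqy)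
    · refine ContinuousLinearMap.ext fun X => ContinuousLinearMap.ext fun u => ?_
      -- As `Ψ` kills `η`, only the second term of the wedge survives.
      have h2 : ∀ v, ⟪η x, v⟫ = 0 → Ψ x (wedge E (η x) v u) = devForm (η x) (Ψ x) v u := by
        intro v hv
        have h3 : Ψ x (η x) = 0 := by
          have : ⟪Ψ x (η x), Ψ x (η x)⟫ = (0 : ℝ) := by
            refine (hR _ (hw x) _ _).trans ?_
            have h4 := hw x
            change ⟪Φ' x (η x), Φ' x (η x)⟫ -
              ⟪Φ' x (η x), Φ' x (η x)⟫ * ⟪Φ' x (η x), Φ' x (η x)⟫ = 0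
            rw [h4]
            norm_num
          exact inner_self_eq_zero.1 this
        rw [wedge_apply, devForm_apply, map_sub, map_smul, map_smul, h3, smul_zero, zero_sub]
      have h3 := h.inner_fderiv_self hη (mem_extChartAt_target x) X
      rw [inChart_extChartAt _ hx] at h3
      exact h2 _ h3
  have hderiv' : ∀ (c : U) (y : Euc n), y ∈ (extChartAt (𝓡 n) c).target → HasFDerivAt
      (inChart Ψ c) (devForm (inChart η c y) (inChart Ψ c y) ∘L fderiv ℝ (inChart η c) y) y :=
    fun c y hy => hη.hasFDerivAt_of_comp_target (B := fun z => devForm (η z) (Ψ z)) hderiv hy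
  refine ⟨Ψ, fun c x hx => ?_, fun x u v => ?_, hderiv'⟩
  · have hο := isOpen_extChartAt_target (I := 𝓡 n) c
    exact (contDiffOn_of_devForm hο (hη.contDiffOn c) ((hη.contDiffOn c).fderiv_of_isOpen hο
      (by simp)) (hderiv' c)).contDiffAt (hο.mem_nhds ((extChartAt (𝓡 n) c).map_source hx))
  · rw [← hinner x u v, ← hinner x (η x) u, ← hinner x (η x) v]
    exact hR _ (hw x) _ _

namespace Development

variable {Ψ : U → E →L[ℝ] W}

omit [IsManifold (𝓡 n) ∞ U] in
/-- Developing a map whose differential is orthogonal to `η`: the differential of `Ψ ∘ dF`. -/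
theorem hasFDerivAt_comp (hΨ : Development n η Ψ) {D : Euc n → Euc n →L[ℝ] E}
    {D' : Euc n →L[ℝ] Euc n →L[ℝ] E} {c : U} {y : Euc n}
    (hy : y ∈ (extChartAt (𝓡 n) c).target) (hD : HasFDerivAt D D' y)
    (hnormal : ∀ X, ⟪inChart η c y, D y X⟫ = 0) :
    HasFDerivAt (fun y => inChart Ψ c y ∘L D y)
      (ContinuousLinearMap.compL ℝ (Euc n) E W (inChart Ψ c y) ∘L D') y := by
  refine ((hΨ.deriv c y hy).clm_comp hD).congr_fderiv ?_
  refine ContinuousLinearMap.ext fun X => ContinuousLinearMap.ext fun Y => ?_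
  have h1 : inChart Ψ c y (D' X Y) + devForm (inChart η c y) (inChart Ψ c y)
      (fderiv ℝ (inChart η c) y X) (D y Y) = inChart Ψ c y (D' X Y) := by
    rw [devForm_apply, hnormal, zero_smul, neg_zero, add_zero]
  exact h1

theorem exists_primitive (hΨ : Development n η Ψ) (h : SplitImmersion n F ξ η) [CompleteSpace W]
    (hU : ∀ x : U, SimplyConnectedSpace (connectedComponent x)) :
    ∃ g : U → W, SmoothInCharts n g ∧ ∀ (c : U) (y : Euc n), y ∈ (extChartAt (𝓡 n) c).target →
      HasFDerivAt (inChart g c) (inChart Ψ c y ∘L fderiv ℝ (inChart F c) y) y := by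
  have : LocallyPathConnectedSpace U := ChartedSpace.locallyPathConnectedSpace (Euc n) U
  have hF := h.smooth
  have hω : ∀ c : U, ContDiffOn ℝ ∞ (fun y => inChart Ψ c y ∘L fderiv ℝ (inChart F c) y)
      (extChartAt (𝓡 n) c).target := fun c =>
    (hΨ.smooth.contDiffOn c).clm_comp ((hF.contDiffOn c).fderiv_of_isOpen
      (isOpen_extChartAt_target (I := 𝓡 n) c) (by simp))
  -- `dF` is orthogonal to `η`, where `Ψ` is parallel; the derivative of `Ψ dF` is therefore `Ψ
  -- D²F`, which is symmetric.
  have hclosed : ∀ (c : U), ∀ y ∈ (extChartAt (𝓡 n) c).target, ∀ X Y,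
      fderiv ℝ (fun y => inChart Ψ c y ∘L fderiv ℝ (inChart F c) y) y X Y =
      fderiv ℝ (fun y => inChart Ψ c y ∘L fderiv ℝ (inChart F c) y) y Y X := by
    intro c y hy X Y
    have h1 := ((hF.contDiffAt hy).fderiv_right (m := ∞) (by simp)).differentiableAt (by simp)
    rw [(hΨ.hasFDerivAt_comp hy h1.hasFDerivAt fun X => (h.frame c y hy).normal_right X).fderiv]
    exact congrArg (inChart Ψ c y : E →L[ℝ] W) ((h.frame c y hy).symm X Y)
  -- Local primitives differ by additive constants, so the gluing applies to `W` written as a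
  -- multiplicative group.
  obtain ⟨g, hg⟩ : ∃ g : U → Multiplicative W, ∀ x, HasFDerivAt
      (inChart (fun z => (g z).toAdd) x)
      (Ψ x ∘L fderiv ℝ (inChart F x) (extChartAt (𝓡 n) x x)) (extChartAt (𝓡 n) x x) := by
    refine exists_global_solution hU _ (fun i => ?_) (fun f₁ f₂ x h₁ h₂ => ?_)
      (fun q f Φ x hf hq => ?_)
    · obtain ⟨r, hr, hball⟩ := Metric.isOpen_iff.1 (isOpen_extChartAt_target (I := 𝓡 n) i) _
        (mem_extChartAt_target i)
      obtain ⟨g, hg⟩ := (convex_ball _ r).exists_forall_hasFDerivAt_of_fderiv_symmetric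
        Metric.isOpen_ball (((hω i).differentiableOn (by simp)).mono hball)
        fun y hy => hclosed i y (hball hy)
      refine ⟨fun z => .ofAdd (g (extChartAt (𝓡 n) i z)), ?_⟩
      filter_upwards [eventually_of_chart (n := n) (mem_extChartAt_source i)
        (Metric.ball_mem_nhds _ hr)]
        with x ⟨hx, hxb⟩
      refine hasFDerivAt_comp_change (mem_extChartAt_source x) hx (hF i x hx) ?_
      have h1 := hg _ hxb
      rw [inChart_extChartAt Ψ hx] at h1
      refine h1.congr_of_eventuallyEq ?_
      filter_upwards [(isOpen_extChartAt_target (I := 𝓡 n) i).mem_nhds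
        ((extChartAt (𝓡 n) i).map_source hx)] with y hy
      rw [inChart_apply, (extChartAt (𝓡 n) i).right_inv hy]
      rfl
    · have hx := mem_extChartAt_source (I := 𝓡 n) x
      have h3 : ∀ᶠ y in 𝓝 (extChartAt (𝓡 n) x x), HasFDerivAt (fun y =>
          inChart (fun z => (f₁ z).toAdd) x y - inChart (fun z => (f₂ z).toAdd) x y)
          (0 : Euc n →L[ℝ] W) y := by
        filter_upwards [eventually_chart hx h₁, eventually_chart hx h₂] with y ⟨hy, hy₁⟩ ⟨_, hy₂⟩
        have hys := (extChartAt (𝓡 n) x).map_target hy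
        have := (hF.hasFDerivAt_of_comp hy₁ hys).sub (hF.hasFDerivAt_of_comp hy₂ hys)
        rwa [(extChartAt (𝓡 n) x).right_inv hy, sub_self] at this
      filter_upwards [eventually_of_chart hx (eventually_eq_of_hasFDerivAt_zero h3)]
        with z ⟨hz, hz'⟩
      rw [inChart_extChartAt _ hz, inChart_extChartAt _ hz, inChart_extChartAt _ hx,
        inChart_extChartAt _ hx] at hz'
      apply Multiplicative.toAdd.injective
      simpa [sub_eq_add_neg] using hz'
    · have hx := mem_extChartAt_source (I := 𝓡 n) x
      refine (hf.const_add q.toAdd).congr_of_eventuallyEq ?_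
      filter_upwards [eventually_chart hx hq] with y ⟨hy, hqy⟩
      rw [inChart_apply, hqy]
      rfl
  have hd : ∀ (c : U) (y : Euc n), y ∈ (extChartAt (𝓡 n) c).target →
      HasFDerivAt (inChart (fun z => (g z).toAdd) c)
        (inChart Ψ c y ∘L fderiv ℝ (inChart F c) y) y :=
    fun c y hy => hF.hasFDerivAt_of_comp_target hg hy
  refine ⟨fun z => (g z).toAdd, fun c x hx => ?_, hd⟩
  have hο := isOpen_extChartAt_target (I := 𝓡 n) c
  refine ContDiffOn.contDiffAt ?_ (hο.mem_nhds ((extChartAt (𝓡 n) c).map_source hx))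
  exact (contDiffOn_infty_iff_fderiv_of_isOpen hο).2
    ⟨fun y hy => (hd c y hy).differentiableAt.differentiableWithinAt,
      (hω c).congr fun y hy => (hd c y hy).fderiv⟩

end Development

end

/-- The preimage of a component is simply connected, hence connected, so it is itself a component
upstairs. -/
theorem IsUniversalCover.simplyConnectedSpace_connectedComponent {X Y : Type*}
    [TopologicalSpace X] [TopologicalSpace Y] {ρ : X → Y} (h : IsUniversalCover ρ) (x : X) :
    SimplyConnectedSpace (connectedComponent x) := by
  have h1 := h.2 (ρ x)
  have h2 : ρ ⁻¹' connectedComponent (ρ x) = connectedComponent x := by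
    refine subset_antisymm ?_ fun z hz => h.1.continuous.mapsTo_connectedComponent x hz
    exact (isPreconnected_iff_preconnectedSpace.2 inferInstance).subset_connectedComponent
      mem_connectedComponent
  rwa [h2] at h1

/-! ### From the stratum to split immersions of the cover -/

section

variable {n m : ℕ} {M : Type*} [TopologicalSpace M] [ChartedSpace (Euc n) M]
  [IsManifold (𝓡 n) ∞ M] {γ : Metric n M} {f : M → Euc m}

theorem IsEuclideanImmersion.smoothInCharts (hf : IsEuclideanImmersion γ f) :
    SmoothInCharts n f := smoothInCharts_of_contMDiff hf.1

theorem IsEuclideanImmersion.inner_fderiv (hf : IsEuclideanImmersion γ f) (p : M) (X Y : Euc n) :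
    ⟪fderiv ℝ (inChart f p) (extChartAt (𝓡 n) p p) X,
      fderiv ℝ (inChart f p) (extChartAt (𝓡 n) p p) Y⟫ = γ.inner p X Y := by
  rw [← differential_eq_fderiv hf.1]
  exact hf.2 p X Y

theorem isEuclideanImmersion_of_inner_fderiv (hf : SmoothInCharts n f)
    (h : ∀ (p : M) (X Y : Euc n), ⟪fderiv ℝ (inChart f p) (extChartAt (𝓡 n) p p) X,
      fderiv ℝ (inChart f p) (extChartAt (𝓡 n) p p) Y⟫ = γ.inner p X Y) :
    IsEuclideanImmersion γ f := by
  refine ⟨hf.contMDiff, fun p X Y => ?_⟩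
  rw [differential_eq_fderiv hf.contMDiff]
  exact h p X Y

theorem IsEuclideanImmersion.injective_fderiv (hf : IsEuclideanImmersion γ f) {c : M} {y : Euc n}
    (hy : y ∈ (extChartAt (𝓡 n) c).target) : Function.Injective (fderiv ℝ (inChart f c) y) := by
  obtain ⟨x, hx, rfl⟩ : ∃ x ∈ (extChartAt (𝓡 n) c).source, extChartAt (𝓡 n) c x = y :=
    ⟨_, (extChartAt (𝓡 n) c).map_target hy, (extChartAt (𝓡 n) c).right_inv hy⟩
  have hxx := mem_extChartAt_source (I := 𝓡 n) x
  rw [fderiv_inChart_change hx hxx (hf.smoothInCharts x x hxx)]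
  rw [ContinuousLinearMap.coe_comp]
  refine Function.Injective.comp ?_ (coordEquiv hx hxx).injective
  refine (injective_iff_map_eq_zero _).2 fun X hX => ?_
  by_contra hne
  have h1 := γ.pos x X hne
  have h2 := hf.inner_fderiv x X X
  rw [hX, inner_zero_left] at h2
  exact h1.ne h2

theorem IsEuclideanImmersion.comp {k : ℕ} {N : Type*} [TopologicalSpace N]
    [ChartedSpace (Euc k) N] [IsManifold (𝓡 k) ∞ N] {γN : Metric k N}
    (hf : IsEuclideanImmersion γ f) {ρ : N → M} (hρ : IsIsometricImmersion γN γ ρ) :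
    IsEuclideanImmersion γN (f ∘ ρ) := by
  refine ⟨hf.1.comp hρ.1, fun p X Y => ?_⟩
  have h : mfderiv (𝓡 k) (𝓡 m) (f ∘ ρ) p =
      (mfderiv (𝓡 n) (𝓡 m) f (ρ p)).comp (mfderiv (𝓡 k) (𝓡 n) ρ p) :=
    mfderiv_comp p ((hf.1 _).mdifferentiableAt (by simp)) ((hρ.1 p).mdifferentiableAt (by simp))
  rw [← hρ.2, ← hf.2, differential, h]
  rfl

theorem fderiv_fderiv_symm {V W : Type*} [NormedAddCommGroup V] [NormedSpace ℝ V]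
    [NormedAddCommGroup W] [NormedSpace ℝ W] {F : V → W} {y : V} (hF : ContDiffAt ℝ ∞ F y)
    (X Y : V) : fderiv ℝ (fderiv ℝ F) y X Y = fderiv ℝ (fderiv ℝ F) y Y X :=
  hF.isSymmSndFDerivAt (by simpa using two_le_infty) X Y

omit [IsManifold (𝓡 n) ∞ M] in
theorem secondFundamentalForm_apply (f : M → Euc m) (p : M) (X Y : Euc n) :
    secondFundamentalForm (d := n) f p X Y = (normalSpace (d := n) f p).starProjection
      (fderiv ℝ (fderiv ℝ (inChart f p)) (extChartAt (𝓡 n) p p) X Y) := rfl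

omit [IsManifold (𝓡 n) ∞ M] in
theorem inner_secondFundamentalForm {p : M} {ζ : Euc m} (hζ : ζ ∈ normalSpace (d := n) f p)
    (X Y : Euc n) : ⟪secondFundamentalForm (d := n) f p X Y, ζ⟫ =
      ⟪ζ, fderiv ℝ (fderiv ℝ (inChart f p)) (extChartAt (𝓡 n) p p) X Y⟫ := by
  rw [secondFundamentalForm_apply, Submodule.inner_starProjection_left_eq_right,
    Submodule.starProjection_eq_self_iff.2 hζ, real_inner_comm]

omit [IsManifold (𝓡 n) ∞ M] in
theorem mem_normalSpace_iff (hf : ContMDiff (𝓡 n) (𝓡 m) ∞ f) {p : M} {ζ : Euc m} :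
    ζ ∈ normalSpace (d := n) f p ↔
      ∀ X, ⟪ζ, fderiv ℝ (inChart f p) (extChartAt (𝓡 n) p p) X⟫ = 0 := by
  rw [normalSpace, Submodule.mem_orthogonal', tangentPlane, differential_eq_fderiv hf]
  constructor
  · exact fun h X => h _ ⟨X, rfl⟩
  · rintro h _ ⟨X, rfl⟩
    exact h X

end

section

variable {n : ℕ} {M : Type*} [TopologicalSpace M] [ChartedSpace (Euc n) M]
  [IsManifold (𝓡 n) ∞ M] {γ : Metric n M} {f : M → Euc (n + 2)}

theorem IsNonnegFrame.splitFrame (hn : 1 ≤ n) (hf : IsEuclideanImmersion γ f) {p : M}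
    {ξ η : Euc (n + 2)} {A B : TangentSpace (𝓡 n) p →ₗ[ℝ] TangentSpace (𝓡 n) p}
    (h : IsNonnegFrame γ f p ξ η A B) (hA : finrank ℝ (LinearMap.range A) = n - 1)
    (hB : finrank ℝ (LinearMap.range B) = 1) (hAB : LinearMap.ker A ⊓ LinearMap.ker B = ⊥) :
    SplitFrame (fderiv ℝ (inChart f p) (extChartAt (𝓡 n) p p))
      (fderiv ℝ (fderiv ℝ (inChart f p)) (extChartAt (𝓡 n) p p)) ξ η := by
  have hη : ∀ {ζ : Euc (n + 2)} {A : TangentSpace (𝓡 n) p →ₗ[ℝ] TangentSpace (𝓡 n) p},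
      ζ ∈ normalSpace (d := n) f p → IsShapeOperator γ f p ζ A → ∀ X Y : Euc n,
      ⟪ζ, fderiv ℝ (fderiv ℝ (inChart f p)) (extChartAt (𝓡 n) p p) X Y⟫ = γ.inner p (A X) Y :=
    fun hζ hs X Y => by rw [hs X Y]; exact (inner_secondFundamentalForm hζ X Y).symm
  have hker : ∀ {ζ : Euc (n + 2)} {A : TangentSpace (𝓡 n) p →ₗ[ℝ] TangentSpace (𝓡 n) p},
      ζ ∈ normalSpace (d := n) f p → IsShapeOperator γ f p ζ A → ∀ X : Euc n,
      (∀ Y, ⟪ζ, fderiv ℝ (fderiv ℝ (inChart f p)) (extChartAt (𝓡 n) p p) X Y⟫ = 0) ↔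
      X ∈ LinearMap.ker A := by
    intro ζ A hζ hs X
    constructor
    · intro h0
      change A X = 0
      by_contra hne
      exact (γ.pos p _ hne).ne' ((hη hζ hs X (A X)).symm.trans (h0 _))
    · intro h0 Y
      refine (hη hζ hs X Y).trans
        ((congrArg (fun v => γ.inner p v Y) (show A X = 0 from h0)).trans ?_)
      rw [map_zero]
      rfl
  have hfr : ∀ {ζ : Euc (n + 2)} {A : TangentSpace (𝓡 n) p →ₗ[ℝ] TangentSpace (𝓡 n) p},
      ζ ∈ normalSpace (d := n) f p → IsShapeOperator γ f p ζ A →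
      finrank ℝ (LinearMap.range A) + finrank ℝ (formKer (component
        (fderiv ℝ (fderiv ℝ (inChart f p)) (extChartAt (𝓡 n) p p)) ζ)) = n := by
    intro ζ A hζ hs
    have h1 : formKer (component (fderiv ℝ (fderiv ℝ (inChart f p)) (extChartAt (𝓡 n) p p)) ζ) =
        LinearMap.ker A := Submodule.ext fun X => mem_formKer.trans (hker hζ hs X)
    rw [h1]
    have : FiniteDimensional ℝ (TangentSpace (𝓡 n) p) :=
      inferInstanceAs (FiniteDimensional ℝ (Euc n))
    exact A.finrank_range_add_finrank_ker.trans (finrank_euclideanSpace_fin (𝕜 := ℝ))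
  have ho := h.orthonormal
  have hξξ : ‖ξ‖ = 1 := ho.1 0
  have hηη : ‖η‖ = 1 := ho.1 1
  have hl := (mem_normalSpace_iff hf.1).1 h.normal_left
  have hr := (mem_normalSpace_iff hf.1).1 h.normal_right
  exact {
    inj := hf.injective_fderiv (mem_extChartAt_target p)
    symm := fderiv_fderiv_symm (hf.smoothInCharts p p (mem_extChartAt_source p))
    norm_left := by rw [real_inner_self_eq_norm_sq, hξξ, one_pow]
    norm_right := by rw [real_inner_self_eq_norm_sq, hηη, one_pow]
    orth := ho.2 (show (0 : Fin 2) ≠ 1 by decide)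
    normal_left := hl
    normal_right := hr
    nonneg_left := fun X => by
      rw [hη h.normal_left h.shape_left]
      exact h.nonneg_left X
    nonneg_right := fun X => by
      rw [hη h.normal_right h.shape_right]
      exact h.nonneg_right X
    ker_left := by
      have := hfr h.normal_left h.shape_left
      omega
    ker_right := by
      have := hfr h.normal_right h.shape_right
      rw [finrank_euclideanSpace_fin]
      omega
    disj := fun X h1 h2 => by
      have : X ∈ LinearMap.ker A ⊓ LinearMap.ker B :=
        ⟨(hker h.normal_left h.shape_left X).1 h1, (hker h.normal_right h.shape_right X).1 h2⟩
      rw [hAB] at this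
      exact this }

theorem exists_splitFrame_of_mem_stratum (hn : 1 ≤ n) (hf : IsEuclideanImmersion γ f) {p : M}
    (hp : p ∈ stratum γ f 1) : ∃ ξ η : Euc (n + 2),
    SplitFrame (fderiv ℝ (inChart f p) (extChartAt (𝓡 n) p p))
      (fderiv ℝ (fderiv ℝ (inChart f p)) (extChartAt (𝓡 n) p p)) ξ η := by
  obtain ⟨ξ, η, A, B, h, hA, hB, hAB⟩ := hp
  exact ⟨ξ, η, h.splitFrame hn hf hA hB hAB⟩

variable {U : Type*} [TopologicalSpace U] [ChartedSpace (Euc n) U] [IsManifold (𝓡 n) ∞ U]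
  {γU : Metric n U}

/-- The split frames of an immersion pull back under local isometries. -/
theorem splitFrame_comp (hf : IsEuclideanImmersion γ f) {ρ : U → M}
    (hρ : IsIsometricImmersion γU γ ρ) {c x : U} (hx : x ∈ (extChartAt (𝓡 n) c).source)
    {ξ η : Euc (n + 2)}
    (h : SplitFrame (fderiv ℝ (inChart f (ρ x)) (extChartAt (𝓡 n) (ρ x) (ρ x)))
      (fderiv ℝ (fderiv ℝ (inChart f (ρ x))) (extChartAt (𝓡 n) (ρ x) (ρ x))) ξ η) :
    SplitFrame (fderiv ℝ (inChart (f ∘ ρ) c) (extChartAt (𝓡 n) c x))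
      (fderiv ℝ (fderiv ℝ (inChart (f ∘ ρ) c)) (extChartAt (𝓡 n) c x)) ξ η := by
  let p := ρ x
  let θ : Euc n → Euc n := extChartAt (𝓡 n) p ∘ ρ ∘ (extChartAt (𝓡 n) c).symm
  have hθx : θ (extChartAt (𝓡 n) c x) = extChartAt (𝓡 n) p p := by
    simp only [θ, Function.comp_apply, (extChartAt (𝓡 n) c).left_inv hx]
    rfl
  have hpp := mem_extChartAt_source (I := 𝓡 n) p
  have hθ : ContDiffAt ℝ ∞ θ (extChartAt (𝓡 n) c x) := by
    have := ((contMDiffAt_iff_of_mem_source (x := c) (y := p) (by rwa [extChartAt_source] at hx)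
      (by rwa [extChartAt_source] at hpp)).1 (hρ.1 x)).2
    rwa [ModelWithCorners.range_eq_univ, contDiffWithinAt_univ] at this
  have hfp : ContDiffAt ℝ ∞ (inChart f p) (θ (extChartAt (𝓡 n) c x)) := by
    rw [hθx]
    exact hf.smoothInCharts p p hpp
  have heq : inChart (f ∘ ρ) c =ᶠ[𝓝 (extChartAt (𝓡 n) c x)] inChart f p ∘ θ := by
    have h1 := hρ.1.continuous.continuousAt (x := x) (extChartAt_source_mem_nhds (I := 𝓡 n) p)
    filter_upwards [eventually_chart hx h1] with y ⟨hy, hy'⟩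
    exact (inChart_extChartAt f hy').symm
  have hd : fderiv ℝ (inChart (f ∘ ρ) c) =ᶠ[𝓝 (extChartAt (𝓡 n) c x)]
      fun y => fderiv ℝ (inChart f p) (θ y) ∘L fderiv ℝ θ y := by
    filter_upwards [heq.eventuallyEq_nhds, (hθ.of_le two_le_infty).eventually (by simp),
      hθ.continuousAt.eventually ((hfp.of_le two_le_infty).eventually (by simp))] with y h1 h2 h3
    rw [h1.fderiv_eq]
    exact fderiv_comp y (h3.differentiableAt (by simp)) (h2.differentiableAt (by simp))
  have hg := hf.comp hρ
  have hy := (extChartAt (𝓡 n) c).map_source hx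
  have hinj : Function.Injective (fderiv ℝ θ (extChartAt (𝓡 n) c x)) := by
    have h1 := hg.injective_fderiv hy
    rw [hd.self_of_nhds] at h1
    exact Function.Injective.of_comp (f := fderiv ℝ (inChart f p) _) h1
  have hd2 : HasFDerivAt (fderiv ℝ (inChart (f ∘ ρ) c)) _ (extChartAt (𝓡 n) c x) :=
    HasFDerivAt.congr_of_eventuallyEq
      ((((hfp.fderiv_right (m := ∞) (by simp)).differentiableAt (by simp)).hasFDerivAt.comp _
        (hθ.differentiableAt (by simp)).hasFDerivAt).clm_comp
      ((hθ.fderiv_right (m := ∞) (by simp)).differentiableAt (by simp)).hasFDerivAt) hd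
  rw [← show θ (extChartAt (𝓡 n) c x) = extChartAt (𝓡 n) (ρ x) (ρ x) from hθx] at h
  -- In charts `f ∘ ρ` is `f ∘ θ`. Its second derivative is `D²f(θ' X, θ' Y) + Df(θ''(X, Y))`, a
  -- change of coordinates up to a tangential term.
  refine h.comp (LinearEquiv.ofInjectiveEndo
    (fderiv ℝ θ (extChartAt (𝓡 n) c x)).toLinearMap hinj).toContinuousLinearEquiv
    (fun X Y => fderiv ℝ (fderiv ℝ θ) (extChartAt (𝓡 n) c x) X Y) (fun X => ?_) (fun X Y => ?_)
    (fderiv_fderiv_symm (hg.smoothInCharts.contDiffAt hy))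
  · rw [hd.self_of_nhds]
    rfl
  · rw [hd2.fderiv]
    exact add_comm _ _

/-- The frames are chosen pointwise without any continuity: a frame splitting the second fundamental
form in this way is automatically smooth by `contDiffAt_frame`. -/
theorem exists_splitImmersion (hn : 1 ≤ n) (hf : IsEuclideanImmersion γ f) {ρ : U → M}
    (hρ : IsIsometricImmersion γU γ ρ) (hmem : ∀ x, ρ x ∈ stratum γ f 1) :
    ∃ ξ η : U → Euc (n + 2), SplitImmersion n (f ∘ ρ) ξ η := by
  choose ξ η h using fun x => exists_splitFrame_of_mem_stratum hn hf (hmem x)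
  refine ⟨ξ, η, (hf.comp hρ).smoothInCharts, fun c y hy => ?_⟩
  have := splitFrame_comp hf hρ ((extChartAt (𝓡 n) c).map_target hy) (h _)
  rwa [(extChartAt (𝓡 n) c).right_inv hy] at this

end

/-! ### Convexity and relative nullity of the developed hypersurface -/

section

variable {n m : ℕ} {U : Type*} [TopologicalSpace U] [ChartedSpace (Euc n) U]
  [IsManifold (𝓡 n) ∞ U] {γ : Metric n U}

/-- The normal space of a hypersurface is spanned by any unit normal vector. -/
theorem eq_zero_of_mem_normalSpace {g : U → Euc (n + 1)} (hg : IsEuclideanImmersion γ g) {p : U}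
    {ν w : Euc (n + 1)} (hν : ν ∈ normalSpace (d := n) g p) (h1 : ν ≠ 0)
    (hw : w ∈ normalSpace (d := n) g p) (h0 : ⟪w, ν⟫ = 0) : w = 0 := by
  have hfin : finrank ℝ (tangentPlane (d := n) g p) = n := by
    rw [tangentPlane, differential_eq_fderiv hg.1]
    exact (LinearMap.finrank_range_of_inj (hg.injective_fderiv (mem_extChartAt_target p))).trans
      finrank_euclideanSpace_fin
  have h2 : finrank ℝ (normalSpace (d := n) g p) = 1 := by
    have h3 := (tangentPlane (d := n) g p).finrank_add_finrank_orthogonal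
    rw [hfin, finrank_euclideanSpace_fin] at h3
    exact Nat.add_left_cancel h3
  obtain ⟨c, hc⟩ := (finrank_eq_one_iff_of_nonzero' (⟨ν, hν⟩ : normalSpace (d := n) g p)
    (fun h => h1 (congrArg Subtype.val h))).1 h2 ⟨w, hw⟩
  have hc' : c • ν = w := congrArg Subtype.val hc
  rw [← hc', real_inner_smul_left, mul_eq_zero, inner_self_eq_zero] at h0
  rw [← hc', h0.resolve_right h1, zero_smul]

omit [IsManifold (𝓡 n) ∞ U] in
theorem secondFundamentalForm_mem (f : U → Euc m) (p : U) (X Y : Euc n) :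
    secondFundamentalForm (d := n) f p X Y ∈ normalSpace (d := n) f p := by
  rw [secondFundamentalForm_apply]
  exact Submodule.starProjection_apply_mem _ _

end

section

variable {n : ℕ} {U : Type*} [TopologicalSpace U] [ChartedSpace (Euc n) U]
  [IsManifold (𝓡 n) ∞ U] {γ : Metric n U} {F ξ η : U → Euc (n + 2)}
  {Ψ : U → Euc (n + 2) →L[ℝ] Euc (n + 1)} {g : U → Euc (n + 1)}

/-- The hypersurface `g` is the development of the codimension two immersion `F` by `Ψ`. -/
structure IsDevelopment (γ : Metric n U) (F ξ η : U → Euc (n + 2))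
    (Ψ : U → Euc (n + 2) →L[ℝ] Euc (n + 1)) (g : U → Euc (n + 1)) : Prop where
  immersion : IsEuclideanImmersion γ F
  split : SplitImmersion n F ξ η
  smooth_left : SmoothInCharts n ξ
  smooth_right : SmoothInCharts n η
  parallel : Development n η Ψ
  smooth : SmoothInCharts n g
  deriv : ∀ (c : U) (y : Euc n), y ∈ (extChartAt (𝓡 n) c).target →
    HasFDerivAt (inChart g c) (inChart Ψ c y ∘L fderiv ℝ (inChart F c) y) y

namespace IsDevelopment

variable (h : IsDevelopment γ F ξ η Ψ g)
include h

theorem splitFrame (x : U) : SplitFrame (fderiv ℝ (inChart F x) (extChartAt (𝓡 n) x x))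
    (fderiv ℝ (fderiv ℝ (inChart F x)) (extChartAt (𝓡 n) x x)) (ξ x) (η x) := by
  have := h.split.frame x _ (mem_extChartAt_target x)
  rwa [inChart_extChartAt ξ (mem_extChartAt_source x),
    inChart_extChartAt η (mem_extChartAt_source x)] at this

theorem fderiv_apply (x : U) (X : Euc n) : fderiv ℝ (inChart g x) (extChartAt (𝓡 n) x x) X =
    Ψ x (fderiv ℝ (inChart F x) (extChartAt (𝓡 n) x x) X) := by
  rw [(h.deriv x _ (mem_extChartAt_target x)).fderiv,
    inChart_extChartAt Ψ (mem_extChartAt_source x)]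
  rfl

/-- The derivative of `Ψ` does not contribute, because `dF` takes values orthogonal to `η`. -/
theorem fderiv_fderiv_apply (x : U) (X Y : Euc n) :
    fderiv ℝ (fderiv ℝ (inChart g x)) (extChartAt (𝓡 n) x x) X Y =
    Ψ x (fderiv ℝ (fderiv ℝ (inChart F x)) (extChartAt (𝓡 n) x x) X Y) := by
  have hx := mem_extChartAt_target (I := 𝓡 n) x
  have h1 := (((h.split.smooth.contDiffAt hx).fderiv_right (m := ∞) (by simp)).differentiableAt
    (by simp)).hasFDerivAt
  have h2 := h.parallel.hasFDerivAt_comp hx h1 fun X => (h.split.frame x _ hx).normal_right X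
  have h3 : fderiv ℝ (inChart g x) =ᶠ[𝓝 (extChartAt (𝓡 n) x x)]
      fun y => inChart Ψ x y ∘L fderiv ℝ (inChart F x) y := by
    filter_upwards [(isOpen_extChartAt_target (I := 𝓡 n) x).mem_nhds hx] with y hy
    exact (h.deriv x y hy).fderiv
  rw [h3.fderiv_eq, h2.fderiv, inChart_extChartAt Ψ (mem_extChartAt_source x)]
  rfl

theorem isEuclideanImmersion : IsEuclideanImmersion γ g :=
  isEuclideanImmersion_of_inner_fderiv h.smooth fun x X Y => by
    rw [h.fderiv_apply, h.fderiv_apply, h.parallel.inner_map, (h.splitFrame x).normal_right,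
      zero_mul, sub_zero, h.immersion.inner_fderiv]

theorem inner_normal (x : U) (v : Euc (n + 2)) : ⟪Ψ x (ξ x), Ψ x v⟫ = ⟪ξ x, v⟫ := by
  rw [h.parallel.inner_map, (h.splitFrame x).orth', zero_mul, sub_zero]

theorem normal_mem (x : U) : Ψ x (ξ x) ∈ normalSpace (d := n) g x :=
  (mem_normalSpace_iff h.smooth.contMDiff).2 fun X => by
    rw [h.fderiv_apply, h.inner_normal, (h.splitFrame x).normal_left]

theorem norm_normal (x : U) : ‖Ψ x (ξ x)‖ = 1 := by
  have h1 := h.inner_normal x (ξ x)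
  rw [(h.splitFrame x).norm_left, real_inner_self_eq_norm_sq] at h1
  exact (pow_eq_one_iff_of_nonneg (norm_nonneg _) two_ne_zero).1 h1

/-- The second fundamental form of `g` is thus the `ξ` component of that of `F`; convexity and the
index of relative nullity are both read off from it. -/
theorem inner_secondFundamentalForm_normal (x : U) (X Y : Euc n) :
    ⟪secondFundamentalForm (d := n) g x X Y, Ψ x (ξ x)⟫ =
      ⟪ξ x, fderiv ℝ (fderiv ℝ (inChart F x)) (extChartAt (𝓡 n) x x) X Y⟫ := by
  rw [inner_secondFundamentalForm (h.normal_mem x), h.fderiv_fderiv_apply, h.inner_normal]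

theorem isConvexHypersurface : IsConvexHypersurface g := by
  refine ⟨fun x => Ψ x (ξ x), ?_, fun p => ⟨h.norm_normal p, h.normal_mem p⟩, fun p X => ?_⟩
  · exact SmoothInCharts.contMDiff fun c x hx =>
      (h.parallel.smooth c x hx).clm_apply (h.smooth_left c x hx)
  · exact (h.inner_secondFundamentalForm_normal p X X).symm ▸ (h.splitFrame p).nonneg_left X

theorem indexOfRelativeNullity_eq_one (x : U) : indexOfRelativeNullity (d := n) g x = 1 := by
  have h0 : Ψ x (ξ x) ≠ 0 := fun h0 => by simpa [h0] using h.norm_normal x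
  have h1 : relativeNullity (d := n) g x = formKer (component
      (fderiv ℝ (fderiv ℝ (inChart F x)) (extChartAt (𝓡 n) x x)) (ξ x)) := by
    refine Submodule.ext fun X => ?_
    refine Iff.trans ?_ (mem_formKer (V := Euc n) (X := X)).symm
    change secondFundamentalForm (d := n) g x X = 0 ↔ ∀ Y : Euc n, _
    constructor
    · intro hX Y
      refine (h.inner_secondFundamentalForm_normal x X Y).symm.trans ?_
      rw [hX]
      exact inner_zero_left _
    · intro hX
      refine ContinuousLinearMap.ext fun Y => eq_zero_of_mem_normalSpace h.isEuclideanImmersion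
        (h.normal_mem x) h0 (secondFundamentalForm_mem g x X Y) ?_
      exact (h.inner_secondFundamentalForm_normal x X Y).trans (hX Y)
  rw [indexOfRelativeNullity, h1]
  exact (h.splitFrame x).ker_left

end IsDevelopment

end

/-! ### Flat manifolds with a developing map -/

section

variable {d m : ℕ} {X : Type*} [TopologicalSpace X] {j : X → Euc d}

/-- The charts given by the local inverses of a local homeomorphism into a Euclidean space. -/
abbrev developingChartedSpace (hj : IsLocalHomeomorph j) : ChartedSpace (Euc d) X where
  atlas := {e | ⇑e = j}
  chartAt z := (hj z).choose
  mem_chart_source z := (hj z).choose_spec.1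
  chart_mem_atlas z := (hj z).choose_spec.2.symm

/-- All charts are restrictions of the one map `j`, so every transition map is an identity. -/
theorem isManifold_developing (hj : IsLocalHomeomorph j) :
    @IsManifold ℝ _ (Euc d) _ _ (Euc d) _ (𝓡 d) ∞ X _ (developingChartedSpace hj) := by
  let _ := developingChartedSpace hj
  refine isManifold_of_contDiffOn _ _ _ fun e e' he he' => ?_
  refine ContDiffOn.congr (f := id) contDiffOn_id fun y hy => ?_
  have h1 : ⇑e' = ⇑e := Eq.trans he' (Eq.symm he)
  have h2 : y ∈ e.target := hy.1.1
  change e' (e.symm y) = y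
  rw [h1, e.right_inv h2]

variable [ChartedSpace (Euc d) X] [IsManifold (𝓡 d) ∞ X]
  (hj : ∀ z : X, ⇑(chartAt (Euc d) z) = j)
include hj

omit [IsManifold (𝓡 d) ∞ X] in
theorem extChartAt_developing (z : X) : ⇑(extChartAt (𝓡 d) z) = j := by
  rw [extChartAt_coe, hj]
  rfl

omit [IsManifold (𝓡 d) ∞ X] in
theorem developing_symm {z : X} {y : Euc d} (hy : y ∈ (extChartAt (𝓡 d) z).target) :
    j ((extChartAt (𝓡 d) z).symm y) = y := by
  rw [← extChartAt_developing hj z, (extChartAt (𝓡 d) z).right_inv hy]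

omit [IsManifold (𝓡 d) ∞ X] in
theorem fderivWithin_developing {p q : X} {y : Euc d} (hy : y ∈ (extChartAt (𝓡 d) p).target) :
    fderivWithin ℝ (extChartAt (𝓡 d) q ∘ (extChartAt (𝓡 d) p).symm) (Set.range (𝓡 d)) y =
      ContinuousLinearMap.id ℝ (Euc d) := by
  rw [ModelWithCorners.range_eq_univ, fderivWithin_univ]
  have h1 : extChartAt (𝓡 d) q ∘ (extChartAt (𝓡 d) p).symm =ᶠ[𝓝 y] id := by
    filter_upwards [(isOpen_extChartAt_target (I := 𝓡 d) p).mem_nhds hy] with z hz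
    rw [Function.comp_apply, extChartAt_developing hj q, developing_symm hj hz]
    rfl
  rw [h1.fderiv_eq, fderiv_id]

/-- Since the chart changes are identities, so are the trivializations of the tangent bundle; the
standard inner product then has constant coefficients and is smooth. -/
theorem symmL_developing {p q : X} (hq : q ∈ (chartAt (Euc d) p).source) :
    (trivializationAt (Euc d) (TangentSpace (𝓡 d) : X → Type) p).symmL ℝ q =
      (ContinuousLinearMap.id ℝ (Euc d) : Euc d →L[ℝ] Euc d) := by
  rw [TangentBundle.symmL_trivializationAt_eq_core hq, tangentBundleCore_coordChange_achart]
  refine fderivWithin_developing hj ((extChartAt (𝓡 d) p).map_source ?_)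
  rwa [extChartAt_source]

theorem mfderiv_symm_developing {p : X} {y : Euc d} (hy : y ∈ (extChartAt (𝓡 d) p).target) :
    mfderiv (𝓡 d) (𝓡 d) (extChartAt (𝓡 d) p).symm y =
      (ContinuousLinearMap.id ℝ (Euc d) : Euc d →L[ℝ] Euc d) := by
  have h1 : ContMDiffAt (𝓡 d) (𝓡 d) ∞ (extChartAt (𝓡 d) p).symm y :=
    (contMDiffOn_extChartAt_symm p).contMDiffAt
      ((isOpen_extChartAt_target (I := 𝓡 d) p).mem_nhds hy)
  rw [(h1.mdifferentiableAt (by simp)).mfderiv]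
  exact fderivWithin_developing hj hy

omit hj [IsManifold (𝓡 d) ∞ X] in
/-- The standard inner product, as a bilinear form on the tangent spaces of a manifold. -/
def standardForm (b : X) : TangentSpace (𝓡 d) b →L[ℝ] TangentSpace (𝓡 d) b →L[ℝ] ℝ :=
  innerBilin (Euc d)

theorem contMDiff_standardForm : ContMDiff (𝓡 d) ((𝓡 d).prod 𝓘(ℝ, Euc d →L[ℝ] Euc d →L[ℝ] ℝ)) ∞
    (fun b : X => TotalSpace.mk' (E := fun b : X => TangentSpace (𝓡 d) b →L[ℝ]
      TangentSpace (𝓡 d) b →L[ℝ] ℝ) (Euc d →L[ℝ] Euc d →L[ℝ] ℝ) b (standardForm b)) := by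
  intro x
  refine (contMDiffAt_section x).2 ?_
  refine (contMDiffAt_const (c := innerBilin (Euc d))).congr_of_eventuallyEq ?_
  filter_upwards [(chartAt (Euc d) x).open_source.mem_nhds (mem_chart_source _ x)] with q hq
  have h1 := symmL_developing hj hq
  refine ContinuousLinearMap.ext fun v => ContinuousLinearMap.ext fun w => ?_
  have h2 : ∀ v : Euc d, (trivializationAt (Euc d) (TangentSpace (𝓡 d) : X → Type) x).symmL ℝ q v
      = v := fun v => congrArg (fun l : Euc d →L[ℝ] Euc d => l v) h1
  have h3 : ∀ ψ : TangentSpace (𝓡 d) q →L[ℝ] ℝ,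
      (trivializationAt (Euc d →L[ℝ] ℝ) (fun b : X => TangentSpace (𝓡 d) b →L[ℝ] ℝ) x
        ).continuousLinearMapAt ℝ q ψ w = ψ w := by
    intro ψ
    rw [Trivialization.continuousLinearMapAt_apply, Trivialization.linearMapAt_apply,
      if_pos (by simpa using hq), hom_trivializationAt_apply]
    simp only [ContinuousLinearMap.inCoordinates]
    have h4 := Bundle.Trivial.continuousLinearMapAt_trivialization ℝ X ℝ q
    exact (congrArg (fun l : ℝ →L[ℝ] ℝ => l _) h4).trans (congrArg ψ (h2 w))
  refine (h3 _).trans ?_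
  exact congrArg (fun v => ⟪v, w⟫) (h2 v)

/-- The flat metric in which the charts are isometries. -/
def developingMetric : Metric d X where
  inner b := standardForm b
  symm _ _ _ := real_inner_comm (F := Euc d) _ _
  pos _ _ hv := (real_inner_self_pos (F := Euc d)).2 hv
  isVonNBounded _ := (riemannianMetricVectorSpace (Euc d)).isVonNBounded 0
  contMDiff := contMDiff_standardForm hj

theorem gram_developing {p : X} {y : Euc d} (hy : y ∈ (extChartAt (𝓡 d) p).target)
    (a b : Fin d) : gram (developingMetric hj) p y a b = ⟪(stdVec a : Euc d), stdVec b⟫ := by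
  rw [gram, mfderiv_symm_developing hj hy]
  rfl

theorem christoffel_developing {p : X} {y : Euc d} (hy : y ∈ (extChartAt (𝓡 d) p).target)
    (k a b : Fin d) : christoffel (developingMetric hj) p y k a b = 0 := by
  have h1 : ∀ a b c, gramDeriv (developingMetric hj) p y a b c = 0 := by
    intro a b c
    have h2 : (fun z => gram (developingMetric hj) p z b c) =ᶠ[𝓝 y]
        fun _ => ⟪(stdVec b : Euc d), stdVec c⟫ := by
      filter_upwards [(isOpen_extChartAt_target (I := 𝓡 d) p).mem_nhds hy] with z hz
      exact gram_developing hj hz b c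
    rw [gramDeriv, h2.fderiv_eq, fderiv_const_apply]
    rfl
  simp [christoffel, h1]

/-- The metric coefficients are constant on the chart domain, so the Christoffel symbols vanish
identically there, together with their derivatives. -/
theorem isFlat_developing : IsFlat (developingMetric hj) := by
  intro p v w u
  have hp := mem_extChartAt_target (I := 𝓡 d) p
  have h1 : ∀ k a b, (fun y => christoffel (developingMetric hj) p y k a b)
      =ᶠ[𝓝 (extChartAt (𝓡 d) p p)] fun _ => 0 := by
    intro k a b
    filter_upwards [(isOpen_extChartAt_target (I := 𝓡 d) p).mem_nhds hp] with y hy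
    exact christoffel_developing hj hy k a b
  have h2 : ∀ l a b c, curvatureCoeff (developingMetric hj) p l a b c = 0 := by
    intro l a b c
    rw [curvatureCoeff, (h1 _ _ _).fderiv_eq, (h1 _ _ _).fderiv_eq]
    simp only [christoffel_developing hj hp, fderiv_const_apply, mul_zero, sub_zero,
      Finset.sum_const_zero, add_zero, zero_apply]
  simp only [curvature, h2, mul_zero, Finset.sum_const_zero, zero_smul]
  rfl

/-- In the charts `j` the map `h` reads as `φ`, and the metric as the standard inner product. -/
theorem isEuclideanImmersion_of_factor {h : X → Euc m} (hh : ∀ z : X, ∃ φ : Euc d → Euc m,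
    ContDiffAt ℝ ∞ φ (j z) ∧ h =ᶠ[𝓝 z] φ ∘ j ∧
    ∀ v w, ⟪fderiv ℝ φ (j z) v, fderiv ℝ φ (j z) w⟫ = ⟪v, w⟫) :
    IsEuclideanImmersion (developingMetric hj) h := by
  have key : ∀ z : X, ∃ φ : Euc d → Euc m, ContDiffAt ℝ ∞ φ (extChartAt (𝓡 d) z z) ∧
      inChart h z =ᶠ[𝓝 (extChartAt (𝓡 d) z z)] φ ∧ ∀ v w, ⟪fderiv ℝ φ (extChartAt (𝓡 d) z z) v,
        fderiv ℝ φ (extChartAt (𝓡 d) z z) w⟫ = ⟪v, w⟫ := by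
    intro z
    obtain ⟨φ, h1, h2, h3⟩ := hh z
    refine ⟨φ, by rwa [extChartAt_developing hj], ?_, by rwa [extChartAt_developing hj]⟩
    filter_upwards [eventually_chart (mem_extChartAt_source z) h2] with y ⟨hy, hy'⟩
    rw [inChart_apply, hy', Function.comp_apply, developing_symm hj hy]
  refine isEuclideanImmersion_of_inner_fderiv (smoothInCharts_of fun z => ?_) fun z v w => ?_
  · obtain ⟨φ, h1, h2, -⟩ := key z
    exact h1.congr_of_eventuallyEq h2
  · obtain ⟨φ, -, h2, h3⟩ := key z
    rw [h2.fderiv_eq, h3]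
    rfl

theorem isEuclideanImmersion_developing : IsEuclideanImmersion (developingMetric hj) j :=
  isEuclideanImmersion_of_factor hj fun z => ⟨id, contDiffAt_id, Filter.EventuallyEq.rfl, by simp⟩

end

-- Compositions from a common local factorization

universe u

/-- Near `z`, the map `j` is a homeomorphism onto its image and `h` is the composition of `j` and of
a smooth map with isometric differential. -/
structure IsFactorPoint {X W E : Type*} [TopologicalSpace X] [NormedAddCommGroup W]
    [InnerProductSpace ℝ W] [NormedAddCommGroup E] [InnerProductSpace ℝ E] (j : X → W) (h : X → E)
    (z : X) : Prop where
  homeo : ∃ e : OpenPartialHomeomorph X W, z ∈ e.source ∧ Set.EqOn j e e.source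
  factor : ∃ φ : W → E, ContDiffAt ℝ ∞ φ (j z) ∧ h =ᶠ[𝓝 z] φ ∘ j ∧
    ∀ v w, ⟪fderiv ℝ φ (j z) v, fderiv ℝ φ (j z) w⟫ = ⟪v, w⟫

section

variable {W E : Type*} [NormedAddCommGroup W] [InnerProductSpace ℝ W] [NormedAddCommGroup E]
  [InnerProductSpace ℝ E]

/-- By the inverse function theorem `j` is a local diffeomorphism, and `φ = h ∘ j⁻¹`. Its
differential is isometric because `j` and `h` pull the inner products back to the same form at `v`.
-/
theorem isFactorPoint_of_fderiv {V : Type*} [NormedAddCommGroup V] [NormedSpace ℝ V]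
    [FiniteDimensional ℝ V] [CompleteSpace V] [FiniteDimensional ℝ W]
    (hVW : finrank ℝ V = finrank ℝ W) {j : V → W} {h : V → E} {v : V} (hj : ContDiffAt ℝ ∞ j v)
    (hh : ContDiffAt ℝ ∞ h v) (hinj : Function.Injective (fderiv ℝ j v))
    (hisom : ∀ X Y, ⟪fderiv ℝ j v X, fderiv ℝ j v Y⟫ = ⟪fderiv ℝ h v X, fderiv ℝ h v Y⟫) :
    IsFactorPoint j h v := by
  let A : V ≃L[ℝ] W :=
    (LinearEquiv.ofInjectiveOfFinrankEq (fderiv ℝ j v).toLinearMap hinj hVW).toContinuousLinearEquiv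
  have hA : HasFDerivAt j (A : V →L[ℝ] W) v := (hj.differentiableAt (by simp)).hasFDerivAt
  let e := hj.toOpenPartialHomeomorph j hA (by simp)
  have hv : v ∈ e.source := hj.mem_toOpenPartialHomeomorph_source hA (by simp)
  have hjv : j v ∈ e.target := e.map_source hv
  have hev : e.symm (j v) = v := e.left_inv hv
  have hsymm : ContDiffAt ℝ ∞ e.symm (j v) :=
    e.contDiffAt_symm hjv (by rw [hev]; exact hA) (by rw [hev]; exact hj)
  have hh' : ContDiffAt ℝ ∞ h (e.symm (j v)) := by rwa [hev]
  have hφ : ContDiffAt ℝ ∞ (h ∘ e.symm) (j v) := hh'.comp _ hsymm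
  have heq : h =ᶠ[𝓝 v] (h ∘ e.symm) ∘ j := by
    filter_upwards [e.open_source.mem_nhds hv] with y hy
    exact congrArg h (e.left_inv hy).symm
  refine ⟨⟨e, hv, fun _ _ => rfl⟩, h ∘ e.symm, hφ, heq, fun a b => ?_⟩
  have h1 : ∀ X, fderiv ℝ (h ∘ e.symm) (j v) (A X) = fderiv ℝ h v X := fun X => by
    rw [heq.fderiv_eq, fderiv_comp v (hφ.differentiableAt (by simp)) hA.differentiableAt]
    rfl
  obtain ⟨X, rfl⟩ := A.surjective a
  obtain ⟨Y, rfl⟩ := A.surjective b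
  rw [h1, h1]
  exact (hisom X Y).symm

theorem IsFactorPoint.comp {X V : Type*} [TopologicalSpace X] [TopologicalSpace V] {j : X → W}
    {h : X → E} {j' : V → W} {h' : V → E} (c : OpenPartialHomeomorph X V) {z : X}
    (hz : z ∈ c.source) (hj : Set.EqOn j (j' ∘ c) c.source) (hh : Set.EqOn h (h' ∘ c) c.source)
    (H : IsFactorPoint j' h' (c z)) : IsFactorPoint j h z := by
  obtain ⟨⟨e, he, hje⟩, φ, h1, h2, h3⟩ := H
  have hjz : j z = j' (c z) := hj hz
  refine ⟨⟨c.trans e, ⟨hz, he⟩, fun w hw => (hj hw.1).trans (hje hw.2)⟩, φ, by rwa [hjz], ?_,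
    by rwa [hjz]⟩
  filter_upwards [c.open_source.mem_nhds hz, (c.continuousAt hz).eventually h2] with w hw hw'
  rw [hh hw, Function.comp_apply, hw', Function.comp_apply, Function.comp_apply, hj hw]
  rfl

theorem IsFactorPoint.restrict {X : Type*} [TopologicalSpace X] {j : X → W} {h : X → E}
    (N : TopologicalSpace.Opens X) {z : N} (H : IsFactorPoint j h (z : X)) :
    IsFactorPoint (fun w : N => j w) (fun w : N => h w) z := by
  obtain ⟨⟨e, he, hje⟩, φ, h1, h2, h3⟩ := H
  refine ⟨⟨e.subtypeRestr ⟨z⟩, ?_, fun w hw => ?_⟩, φ, h1,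
    continuous_subtype_val.continuousAt.eventually h2, h3⟩
  · rw [OpenPartialHomeomorph.subtypeRestr_source]
    exact he
  · rw [OpenPartialHomeomorph.subtypeRestr_source] at hw
    exact hje hw

end

/-- An isometric immersion that factors near an embedded copy of the manifold. -/
theorem isComposition_of_isFactorPoint {n : ℕ} {M : Type u} [TopologicalSpace M]
    [ChartedSpace (Euc n) M] [IsManifold (𝓡 n) ∞ M] {γ : Metric n M} {g : M → Euc (n + 1)}
    {f : M → Euc (n + 2)} (hg : IsEuclideanImmersion γ g) {X : Type u} [TopologicalSpace X]
    [T2Space X] [SecondCountableTopology X] {j : X → Euc (n + 1)} {h : X → Euc (n + 2)}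
    {s : M → X} (hs : Topology.IsEmbedding s) (hjs : g = j ∘ s) (hhs : f = h ∘ s)
    (H : ∀ x, ∀ᶠ z in 𝓝 (s x), IsFactorPoint j h z) : IsComposition γ g f := by
  -- The interior of the set of factor points: it contains the image of `s`, and on it `j` is a
  -- local homeomorphism, which supplies the charts.
  let N : TopologicalSpace.Opens X :=
    ⟨{z | ∀ᶠ w in 𝓝 z, IsFactorPoint j h w}, isOpen_setOfPred_eventually_nhds⟩
  have hN : ∀ z : N, IsFactorPoint (fun w : N => j w) (fun w : N => h w) z :=
    fun z => IsFactorPoint.restrict N z.2.self_of_nhds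
  have hloc : IsLocalHomeomorph (fun w : N => j w) :=
    IsLocalHomeomorph.mk _ fun z => (hN z).homeo
  let _ := developingChartedSpace hloc
  have := isManifold_developing hloc
  have hj : ∀ z : N, ⇑(chartAt (Euc (n + 1)) z) = fun w : N => j w :=
    fun z => (hloc z).choose_spec.2.symm
  let s' : M → N := fun x => ⟨s x, H x⟩
  have hs' : Topology.IsEmbedding s' := hs.codRestrict (N : Set X) H
  -- The charts of `N` are given by `j`, so in coordinates the embedding is `g` itself; smoothness
  -- and isometry of the embedding are inherited from `g`.
  have hgs : ∀ x z, extChartAt (𝓡 (n + 1)) z ∘ s' ∘ (extChartAt (𝓡 n) x).symm = inChart g x := by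
    intro x z
    rw [extChartAt_developing hj, inChart, hjs]
    rfl
  have hsm : ContMDiff (𝓡 n) (𝓡 (n + 1)) ∞ s' := fun x => by
    rw [contMDiffAt_iff, hgs, ModelWithCorners.range_eq_univ, contDiffWithinAt_univ]
    exact ⟨hs'.continuous.continuousAt, hg.smoothInCharts x x (mem_extChartAt_source x)⟩
  refine ⟨N, inferInstance, inferInstance, inferInstance, inferInstance, inferInstance,
    developingMetric hj, s', fun w => j w, fun w => h w, isFlat_developing hj,
    ⟨⟨hsm, fun p v w => ?_⟩, hs'⟩, isEuclideanImmersion_developing hj,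
    isEuclideanImmersion_of_factor hj fun z => (hN z).factor, hjs, hhs⟩
  have h1 : mfderiv (𝓡 n) (𝓡 (n + 1)) s' p =
      fderiv ℝ (inChart g p) (extChartAt (𝓡 n) p p) := by
    rw [((hsm p).mdifferentiableAt (by simp)).mfderiv, writtenInExtChartAt, hgs,
      ModelWithCorners.range_eq_univ, fderivWithin_univ]
  rw [h1]
  exact hg.inner_fderiv p v w

/-! ### The ruled flat extension -/

/-- The map `(x, t) ↦ G x + t S x` that is ruled along `S`. -/
def ruled {X W : Type*} [AddCommGroup W] [Module ℝ W] (G S : X → W) (z : X × ℝ) : W :=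
  G z.1 + z.2 • S z.1

section

variable {V W : Type*} [NormedAddCommGroup V] [NormedSpace ℝ V] [NormedAddCommGroup W]
  [NormedSpace ℝ W] {G S : V → W}

theorem contDiffAt_ruled {z : V × ℝ} (hG : ContDiffAt ℝ ∞ G z.1) (hS : ContDiffAt ℝ ∞ S z.1) :
    ContDiffAt ℝ ∞ (ruled G S) z :=
  (hG.comp z contDiffAt_fst).add (contDiffAt_snd.smul (hS.comp z contDiffAt_fst))

theorem fderiv_ruled_apply {z : V × ℝ} {G' S' : V →L[ℝ] W} (hG : HasFDerivAt G G' z.1)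
    (hS : HasFDerivAt S S' z.1) (X : V) (t : ℝ) :
    fderiv ℝ (ruled G S) z (X, t) = G' X + z.2 • S' X + t • S z.1 := by
  have h := (hG.comp z hasFDerivAt_fst).add (hasFDerivAt_snd.smul (hS.comp z hasFDerivAt_fst))
  have h1 : HasFDerivAt (ruled G S) _ z := h
  rw [h1.fderiv, add_assoc]
  rfl

/-- Only the range of `D` matters, so the ruling direction does not depend on the chart. -/
theorem transversal_comp {V' E : Type*} [NormedAddCommGroup V'] [NormedSpace ℝ V']
    [NormedAddCommGroup E] [InnerProductSpace ℝ E] [FiniteDimensional ℝ V]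
    [FiniteDimensional ℝ V'] (D : V →L[ℝ] E) (S : V' ≃L[ℝ] V) (ξ : E) :
    transversal (D ∘L (S : V' →L[ℝ] V)) ξ = transversal D ξ := by
  have h : LinearMap.range (D ∘L (S : V' →L[ℝ] V)).toLinearMap = LinearMap.range D.toLinearMap := by
    refine Submodule.ext fun v => ⟨?_, ?_⟩
    · rintro ⟨X, rfl⟩
      exact ⟨S X, rfl⟩
    · rintro ⟨X, rfl⟩
      exact ⟨S.symm X, congrArg D (S.apply_symm_apply X)⟩
  rw [transversal, transversal]
  congr 1
  simp only [h]

end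

section

variable {n : ℕ} {U : Type*} [TopologicalSpace U] [ChartedSpace (Euc n) U]
  [IsManifold (𝓡 n) ∞ U] {γ : Metric n U} {F ξ η : U → Euc (n + 2)}
  {Ψ : U → Euc (n + 2) →L[ℝ] Euc (n + 1)} {g : U → Euc (n + 1)}

/-- The direction in which the hypersurface is extended: the component of `ξ` orthogonal to the
derivative of `η`. -/
def ruling (ξ η : U → Euc (n + 2)) (x : U) : Euc (n + 2) :=
  transversal (fderiv ℝ (inChart η x) (extChartAt (𝓡 n) x x)) (ξ x)

namespace IsDevelopment

variable (h : IsDevelopment γ F ξ η Ψ g) {c : U} {y : Euc n}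
include h

theorem ruling_inChart (hy : y ∈ (extChartAt (𝓡 n) c).target) :
    inChart (ruling ξ η) c y = transversal (fderiv ℝ (inChart η c) y) (inChart ξ c y) := by
  obtain ⟨x, hx, rfl⟩ : ∃ x ∈ (extChartAt (𝓡 n) c).source, extChartAt (𝓡 n) c x = y :=
    ⟨_, (extChartAt (𝓡 n) c).map_target hy, (extChartAt (𝓡 n) c).right_inv hy⟩
  have hxx := mem_extChartAt_source (I := 𝓡 n) x
  rw [inChart_extChartAt _ hx, inChart_extChartAt _ hx,
    fderiv_inChart_change hx hxx (h.smooth_right x x hxx), transversal_comp, ruling]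

theorem contDiffAt_ruling (hn : 3 ≤ n) (hy : y ∈ (extChartAt (𝓡 n) c).target) :
    ContDiffAt ℝ ∞ (inChart (ruling ξ η) c) y := by
  have ho := (isOpen_extChartAt_target (I := 𝓡 n) c).mem_nhds hy
  refine (contDiffAt_transversal (V := Euc n) (F := inChart F c) (by simp) (by simpa using hn)
    ?_ (h.split.eventually_frame hy)).congr_of_eventuallyEq ?_
  · filter_upwards [ho] with z hz
    exact h.split.smooth.contDiffAt hz
  · filter_upwards [ho] with z hz
    exact h.ruling_inChart hz

theorem inner_ruling (hy : y ∈ (extChartAt (𝓡 n) c).target) :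
    ⟪inChart η c y, inChart (ruling ξ η) c y⟫ = 0 := by
  have h1 : ∀ X, fderiv ℝ (inChart η c) y X ∈ (ℝ ∙ inChart η c y)ᗮ := fun X =>
    Submodule.mem_orthogonal_singleton_iff_inner_right.2
      (h.split.inner_fderiv_self h.smooth_right hy X)
  have h2 : LinearMap.range (fderiv ℝ (inChart η c) y).toLinearMap ≤ (ℝ ∙ inChart η c y)ᗮ := by
    rintro _ ⟨X, rfl⟩
    exact h1 X
  rw [h.ruling_inChart hy, transversal, inner_sub_right, (h.split.frame c y hy).orth', zero_sub,
    neg_eq_zero]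
  exact Submodule.mem_orthogonal_singleton_iff_inner_right.1
    (h2 (Submodule.starProjection_apply_mem _ _))

/-- Differentiating `⟪η, T⟫ = 0` gives `⟪η, dT⟫ = -⟪dη, T⟫`, which is zero because `T` was made
orthogonal to the range of `dη`. -/
theorem inner_fderiv_ruling (hn : 3 ≤ n) (hy : y ∈ (extChartAt (𝓡 n) c).target) (X : Euc n) :
    ⟪inChart η c y, fderiv ℝ (inChart (ruling ξ η) c) y X⟫ = 0 := by
  have h1 := (h.smooth_right.contDiffAt hy).differentiableAt (by simp : (∞ : ℕ∞ω) ≠ 0)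
  have h2 := (h.contDiffAt_ruling hn hy).differentiableAt (by simp)
  have h3 := fderiv_inner_apply ℝ h1 h2 X
  have h4 : (fun y => ⟪inChart η c y, inChart (ruling ξ η) c y⟫) =ᶠ[𝓝 y] fun _ => (0 : ℝ) := by
    filter_upwards [(isOpen_extChartAt_target (I := 𝓡 n) c).mem_nhds hy] with z hz
    exact h.inner_ruling hz
  rw [h4.fderiv_eq, fderiv_const_apply, h.ruling_inChart hy, real_inner_comm (transversal _ _),
    inner_transversal, add_zero] at h3
  exact h3.symm

theorem hasFDerivAt_ruling (hn : 3 ≤ n) (hy : y ∈ (extChartAt (𝓡 n) c).target) :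
    HasFDerivAt (fun y => inChart Ψ c y (inChart (ruling ξ η) c y))
      (inChart Ψ c y ∘L fderiv ℝ (inChart (ruling ξ η) c) y) y := by
  have h1 := ((h.contDiffAt_ruling hn hy).differentiableAt (by simp)).hasFDerivAt
  refine ((h.parallel.deriv c y hy).clm_apply h1).congr_fderiv ?_
  refine ContinuousLinearMap.ext fun X => ?_
  have h2 : inChart Ψ c y (fderiv ℝ (inChart (ruling ξ η) c) y X) + devForm (inChart η c y)
      (inChart Ψ c y) (fderiv ℝ (inChart η c) y X) (inChart (ruling ξ η) c y) =
      inChart Ψ c y (fderiv ℝ (inChart (ruling ξ η) c) y X) := by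
    rw [devForm_apply, h.inner_ruling hy, zero_smul, neg_zero, add_zero]
  exact h2

theorem fderiv_ruled_left (hn : 3 ≤ n) {z : Euc n × ℝ} (hz : z.1 ∈ (extChartAt (𝓡 n) c).target)
    (X : Euc n) (t : ℝ) : fderiv ℝ (ruled (inChart F c) (inChart (ruling ξ η) c)) z (X, t) =
      fderiv ℝ (inChart F c) z.1 X + z.2 • fderiv ℝ (inChart (ruling ξ η) c) z.1 X +
        t • inChart (ruling ξ η) c z.1 :=
  fderiv_ruled_apply ((h.split.smooth.contDiffAt hz).differentiableAt (by simp)).hasFDerivAt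
    ((h.contDiffAt_ruling hn hz).differentiableAt (by simp)).hasFDerivAt X t

theorem fderiv_ruled_right (hn : 3 ≤ n) {z : Euc n × ℝ} (hz : z.1 ∈ (extChartAt (𝓡 n) c).target)
    (X : Euc n × ℝ) : fderiv ℝ (ruled (inChart g c)
        (fun y => inChart Ψ c y (inChart (ruling ξ η) c y))) z X =
      inChart Ψ c z.1 (fderiv ℝ (ruled (inChart F c) (inChart (ruling ξ η) c)) z X) := by
  obtain ⟨X, t⟩ := X
  rw [h.fderiv_ruled_left hn hz, fderiv_ruled_apply (h.deriv c _ hz) (h.hasFDerivAt_ruling hn hz),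
    map_add, map_add, map_smul, map_smul]
  rfl

/-- The differential of the ruled extension of `F` is orthogonal to `η` for all `t`, and `Ψ`
preserves inner products there. -/
theorem inner_fderiv_ruled (hn : 3 ≤ n) {z : Euc n × ℝ} (hz : z.1 ∈ (extChartAt (𝓡 n) c).target)
    (X Y : Euc n × ℝ) :
    ⟪fderiv ℝ (ruled (inChart g c) (fun y => inChart Ψ c y (inChart (ruling ξ η) c y))) z X,
      fderiv ℝ (ruled (inChart g c) (fun y => inChart Ψ c y (inChart (ruling ξ η) c y))) z Y⟫ =
    ⟪fderiv ℝ (ruled (inChart F c) (inChart (ruling ξ η) c)) z X,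
      fderiv ℝ (ruled (inChart F c) (inChart (ruling ξ η) c)) z Y⟫ := by
  have h1 : ⟪inChart η c z.1, fderiv ℝ (ruled (inChart F c) (inChart (ruling ξ η) c)) z X⟫ = 0 := by
    obtain ⟨X, t⟩ := X
    rw [h.fderiv_ruled_left hn hz, inner_add_right, inner_add_right, inner_smul_right,
      inner_smul_right, (h.split.frame c _ hz).normal_right, h.inner_fderiv_ruling hn hz,
      h.inner_ruling hz]
    simp
  have h2 := h.parallel.inner_map ((extChartAt (𝓡 n) c).symm z.1)
    (fderiv ℝ (ruled (inChart F c) (inChart (ruling ξ η) c)) z X)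
    (fderiv ℝ (ruled (inChart F c) (inChart (ruling ξ η) c)) z Y)
  rw [show ⟪η ((extChartAt (𝓡 n) c).symm z.1), _⟫ = (0 : ℝ) from h1, zero_mul, sub_zero] at h2
  rw [h.fderiv_ruled_right hn hz, h.fderiv_ruled_right hn hz]
  exact h2

/-- At `t = 0` the term with the derivative of the ruling disappears and `transversal_ne` applies.
Injectivity near the zero section then follows because it is an open condition. -/
theorem injective_fderiv_ruled (hn : 3 ≤ n) (hy : y ∈ (extChartAt (𝓡 n) c).target) :
    Function.Injective (fderiv ℝ (ruled (inChart g c)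
      (fun y => inChart Ψ c y (inChart (ruling ξ η) c y))) (y, 0)) := by
  refine (injective_iff_map_eq_zero _).2 fun X hX => ?_
  have h1 := h.inner_fderiv_ruled hn (z := (y, 0)) hy X X
  rw [hX, inner_zero_left, eq_comm, inner_self_eq_zero] at h1
  obtain ⟨X, t⟩ := X
  obtain ⟨l, W, hW, hl⟩ := h.split.exists_fderiv_normal hn (by simp) hy
  rw [h.fderiv_ruled_left hn hy, zero_smul, add_zero, h.ruling_inChart hy] at h1
  obtain ⟨hX, ht⟩ := (h.split.frame c y hy).transversal_ne hW hl h1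
  rw [hX, ht]
  rfl

/-- Near the zero section, both ruled maps have the same induced flat metric. -/
theorem eventually_isFactorPoint (hn : 3 ≤ n) (x : U) : ∀ᶠ z in 𝓝 ((x, 0) : U × ℝ),
    IsFactorPoint (ruled g fun x => Ψ x (ruling ξ η x)) (ruled F (ruling ξ η)) z := by
  let j : Euc n × ℝ → Euc (n + 1) :=
    ruled (inChart g x) (fun y => inChart Ψ x y (inChart (ruling ξ η) x y))
  have hj : ∀ z : Euc n × ℝ, z.1 ∈ (extChartAt (𝓡 n) x).target → ContDiffAt ℝ ∞ j z :=
    fun z hz => contDiffAt_ruled (h.smooth.contDiffAt hz)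
      ((h.parallel.smooth.contDiffAt hz).clm_apply (h.contDiffAt_ruling hn hz))
  have hx := mem_extChartAt_target (I := 𝓡 n) x
  have hxs := mem_extChartAt_source (I := 𝓡 n) x
  have h1 : ∀ᶠ v in 𝓝 ((extChartAt (𝓡 n) x x, 0) : Euc n × ℝ),
      IsFactorPoint j (ruled (inChart F x) (inChart (ruling ξ η) x)) v := by
    have hc := ((hj (extChartAt (𝓡 n) x x, 0) hx).fderiv_right (m := ∞) (by simp)).continuousAt
    filter_upwards [hc.eventually (ContinuousLinearMap.isOpen_injective.mem_nhds
        (h.injective_fderiv_ruled hn hx)),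
      continuous_fst.continuousAt.eventually
        ((isOpen_extChartAt_target (I := 𝓡 n) x).mem_nhds hx)] with v hv hv1
    exact isFactorPoint_of_fderiv (by simp) (hj v hv1) (contDiffAt_ruled
      (h.split.smooth.contDiffAt hv1) (h.contDiffAt_ruling hn hv1)) hv
      (h.inner_fderiv_ruled hn hv1)
  let c := (chartAt (Euc n) x).prod (OpenPartialHomeomorph.refl ℝ)
  have hc : ((x, 0) : U × ℝ) ∈ c.source := ⟨mem_chart_source _ x, trivial⟩
  have hsrc : ∀ z : U × ℝ, z ∈ c.source → z.1 ∈ (extChartAt (𝓡 n) x).source := fun z hz => by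
    rw [extChartAt_source]
    exact hz.1
  filter_upwards [c.open_source.mem_nhds hc, (c.continuousAt hc).eventually h1] with z hz hz'
  refine hz'.comp c hz (fun w hw => ?_) (fun w hw => ?_)
  · change g w.1 + w.2 • Ψ w.1 (ruling ξ η w.1) = inChart g x (extChartAt (𝓡 n) x w.1) + w.2 •
      inChart Ψ x (extChartAt (𝓡 n) x w.1) (inChart (ruling ξ η) x (extChartAt (𝓡 n) x w.1))
    rw [inChart_extChartAt _ (hsrc w hw), inChart_extChartAt _ (hsrc w hw),
      inChart_extChartAt _ (hsrc w hw)]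
  · change F w.1 + w.2 • ruling ξ η w.1 = inChart F x (extChartAt (𝓡 n) x w.1) + w.2 •
      inChart (ruling ξ η) x (extChartAt (𝓡 n) x w.1)
    rw [inChart_extChartAt _ (hsrc w hw), inChart_extChartAt _ (hsrc w hw)]

theorem isComposition [T2Space U] [SecondCountableTopology U] (hn : 3 ≤ n) :
    IsComposition γ g F := by
  refine isComposition_of_isFactorPoint h.isEuclideanImmersion
    (j := ruled g fun x => Ψ x (ruling ξ η x)) (h := ruled F (ruling ξ η))
    (s := fun x => (x, (0 : ℝ))) ?_ ?_ ?_ (h.eventually_isFactorPoint hn)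
  · exact isEmbedding_prodMkLeft 0
  · funext x
    simp [ruled]
  · funext x
    simp [ruled]

end IsDevelopment

end

end WideImmersion

end

/-! ### The theorem -/

open WideImmersion in
theorem propositionb0 {n : ℕ} (hn : 3 ≤ n)
    {M : Type*} [TopologicalSpace M] [T2Space M] [SecondCountableTopology M]
    [ChartedSpace (Euc n) M] [IsManifold (𝓡 n) ∞ M]
    (γ : Metric n M) (hsec : NonnegSectionalCurvature γ)
    (f : M → Euc (n + 2)) (hf : IsEuclideanImmersion γ f) (hwide : IsLocallyWide γ f)
    {U : Type*} [TopologicalSpace U] [T2Space U] [SecondCountableTopology U]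
    [ChartedSpace (Euc n) U] [IsManifold (𝓡 n) ∞ U]
    (γU : Metric n U)
    (ρ : U → stratum γ f 1) (hcover : IsUniversalCover ρ)
    (hsmooth : IsLocalDiffeomorph (𝓡 n) (𝓡 n) ∞ (fun x => (ρ x : M)))
    (hmetric : IsIsometricImmersion γU γ (fun x => (ρ x : M))) :
    ∃ g : U → Euc (n + 1),
      IsEuclideanImmersion γU g ∧
      IsConvexHypersurface g ∧
      (∀ x, indexOfRelativeNullity (d := n) g x = 1) ∧
      IsComposition γU g (fun x => f (ρ x : M)) := by
  have hU := hcover.simplyConnectedSpace_connectedComponent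
  obtain ⟨ξ, η, h⟩ := exists_splitImmersion (by omega) hf hmetric fun x => (ρ x).2
  obtain ⟨hξ, hη⟩ := h.smooth_frame hn (by simp)
  obtain ⟨Ψ, hΨ⟩ := h.exists_development (W := Euc (n + 1)) hn (by simp) (by simp) hU
  obtain ⟨g, hg, hdg⟩ := hΨ.exists_primitive h hU
  have H : IsDevelopment γU (f ∘ fun x => (ρ x : M)) ξ η Ψ g :=
    ⟨hf.comp hmetric, h, hξ, hη, hΨ, hg, hdg⟩
  exact ⟨g, H.isEuclideanImmersion, H.isConvexHypersurface, H.indexOfRelativeNullity_eq_one,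
    H.isComposition hn⟩
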